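/- Let $d\ge 1$, let $\mathcal X\subset\mathbb R^d$, and let $P,Q$ be probability measures with $P(\mathcal X)=Q(\mathcal X)=1$. Let $\kappa(x,\mathrm dy)$ be a Markov kernel from $\mathbb R^d$ to $\mathbb R$ (the common conditional law of the label given the covariate), and let $h:\mathbb R^d\times\mathbb R\to\mathbb R$ be measurable and integrable under $P(\mathrm dx)\kappa(x,\mathrm dy)$. Put $\Delta(x,u):=\int h(x,y)\,\kappa(u,\mathrm dy)$, $g(x):=\Delta(x,x)$ and $e(h):=\iint h(x,y)\,\kappa(x,\mathrm dy)\,Q(\mathrm dx)$. Write $B(x,r)$ for the closed Euclidean ball, $|\cdot|$ for Lebesgue measure, $\delta(x)$ for the distance from $x$ to $\mathbb R^d\setminus\mathcal X$, and $\operatorname{co}(\mathcal X)$ for the convex hull. Assume: - (X1) $\mathcal X$ is compact; - (X2) there is $c>0$ with $|B(x,r)\cap\mathcal X|\ge c\,|B(x,r)|$ for all $x\in\mathcal X$ and $0\le r\le\operatorname{diam}(\mathcal X)$; - (X3) $P$ and $Q$ have Lebesgue densities $p,q$, and there are $\underline p,\overline q>0$ with $p\ge\underline p$ and $q\le\overline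 q$ on $\mathcal X$; - (X4) $g$ is Lipschitz on $\mathcal X$; - (X5) $p$ is Lipschitz on $\mathcal X$; - (A) $\sup_{L>0}L^{1/d}\int_{\mathcal X}\exp(-L\,\delta(x)^d)\,\mathrm dQ(x)<\infty$. For $1\le k\le n$ and $m\ge1$, let $(X_i,Y_i)_{1\le i\le n}$ be i.i.d. with law $P(\mathrm dx)\kappa(x,\mathrm dy)$, and let $X^*_1,\dots,X^*_m$ be i.i.d. with law $Q$, independent of $(X_i,Y_i)_i$. Let $\hat\tau_k(x)$ be the $k$-th order statistic of $(\|X_i-x\|)_{1\le i\le n}$. Let $\hat Y^*_1,\dots,\hat Y^*_m$ be random variables such that, for each $j$, the conditional law of $\hat Y_j^*$ given all the $X_i,Y_i,X^*_{j'}$ is $\frac1k\sum_{i=1}^n\mathbf 1\{\|X_i-X_j^*\|\le\hat\tau_k(X_j^*)\}\,\delta_{Y_i}$. Define $$\hat e_1(h)=\frac1m\sum_{j=1}^m h(X_j^*,\hat Y_j^*),\qquad \hat e_2(h)=\frac1n\sum_{i=1}^n\frac{n\,M_k^*(X_i)}{mk}\,h(X_i,Y_i),\qquad M_k^*(x)=\sum_{j=1}^m\mathbf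 1\{\|x-X_j^*\|\le\hat\tau_k(X_j^*)\},$$ and the conditional biases $B_{i,n}:=\mathbb E[\hat e_i(h)\mid X_1,\dots,X_n]-e(h)$, $i=1,2$. 1. Suppose in addition that there are a bounded convex open set $U\supseteq\mathcal X$ and, for every $x\in\mathcal X$, an extension of $\Delta(x,\cdot)|_{\mathcal X}$ to a $C^2$ function on $U$ (still denoted $\Delta(x,\cdot)$) with $\sup_{(x,y)\in\mathcal X\times\operatorname{co}(\mathcal X)}\{\|\nabla_2\Delta(x,y)\|+\|\nabla_2^2\Delta(x,y)\|\}<\infty$. Then there is a constant $C_1$, not depending on $n,m,k$ or on the sample, such that, whenever the variables $h(X_j^*,\hat Y_j^*)$ are integrable, $$\mathbb E[B_{1,n}^2]\le C_1\Big(\frac k{n+1}\Big)^{\min\{4/d,\,3\}}.$$ 2. Suppose in addition that $g|_{\mathcal X}$ extends to a $C^2$ function on some bounded convex open set $U\supseteq\mathcal X$. Then there is a constant $C_2$, not depending on $n,m,k$ or on the sample, such that $$\mathbb E[B_{2,n}^2]\le C_2\Big(\frac k{n+1}\Big)^{\min\{4/d,\,3\}}.$$ -/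

import Mathlib

open MeasureTheory ProbabilityTheory Set
open scoped ENNReal

universe u

noncomputable section

namespace Matching

/-- `ℝ^d` with the Euclidean norm. -/
abbrev E (d : ℕ) : Type := EuclideanSpace ℝ (Fin d)

variable {d n m : ℕ}

/-! ### Regression functions -/

/-- `Δ(x,u) = E[h(x,Y) | X = u]`, where `κ u` is the conditional law of `Y` given `X = u`. -/
def Delta (κ : Kernel (E d) ℝ) (h : E d → ℝ → ℝ) (x u : E d) : ℝ :=
  ∫ y, h x y ∂(κ u)

/-- The regression function `g(x) = E[h(X,Y) | X = x]`. -/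
def regr (κ : Kernel (E d) ℝ) (h : E d → ℝ → ℝ) (x : E d) : ℝ :=
  ∫ y, h x y ∂(κ x)

/-- The target `e(h) = E[h(X*,Y*)]`, the law of `(X*,Y*)` being `Q ⊗ κ`. -/
def targetMean (Q : Measure (E d)) (κ : Kernel (E d) ℝ) (h : E d → ℝ → ℝ) : ℝ :=
  ∫ z, h z.1 z.2 ∂(Q ⊗ₘ κ)

/-! ### The two estimators -/

/-- The `k`-nearest neighbour radius of `x`: the `k`-th order statistic of the distances
`‖X_i - x‖`, i.e. the least `r` such that at least `k` of them are `≤ r` (for `1 ≤ k ≤ n`). -/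
def knnRadius (k : ℕ) (X : Fin n → E d) (x : E d) : ℝ :=
  sInf {r : ℝ | k ≤ (Finset.univ.filter (fun i => ‖X i - x‖ ≤ r)).card}

/-- The first estimator, computed from the target covariates and the generated labels. -/
def est1 (h : E d → ℝ → ℝ) (Xs : Fin m → E d) (Yhat : Fin m → ℝ) : ℝ :=
  (1 / (m : ℝ)) * ∑ j, h (Xs j) (Yhat j)

/-- The number `M_k^*(x)` of target points that have `x` within their `k`-NN radius. -/
def matchCount (k : ℕ) (X : Fin n → E d) (Xs : Fin m → E d) (x : E d) : ℕ :=
  (Finset.univ.filter (fun j => ‖x - Xs j‖ ≤ knnRadius k X (Xs j))).card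

/-- The second (matching) estimator. -/
def est2 (k : ℕ) (h : E d → ℝ → ℝ) (X : Fin n → E d) (Y : Fin n → ℝ) (Xs : Fin m → E d) : ℝ :=
  (1 / (n : ℝ)) * ∑ i, ((n : ℝ) * (matchCount k X Xs (X i) : ℝ) / ((m : ℝ) * (k : ℝ))) *
    h (X i) (Y i)

/-! ### Sampling model -/

/-- `(X_i,Y_i)`, `i < n`, are i.i.d. with law `P ⊗ κ`; `X*_j`, `j < m`, are i.i.d. with law `Q`;
the two samples are independent. -/
structure IsSample {Ω : Type*} [MeasurableSpace Ω] (μ : Measure Ω)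
    (P Q : Measure (E d)) (κ : Kernel (E d) ℝ)
    (X : Fin n → Ω → E d) (Y : Fin n → Ω → ℝ) (Xs : Fin m → Ω → E d) : Prop where
  measurable_X : ∀ i, Measurable (X i)
  measurable_Y : ∀ i, Measurable (Y i)
  measurable_Xs : ∀ j, Measurable (Xs j)
  law_XY : ∀ i, μ.map (fun ω => (X i ω, Y i ω)) = P ⊗ₘ κ
  law_Xs : ∀ j, μ.map (Xs j) = Q
  indep_XY : iIndepFun (fun i ω => (X i ω, Y i ω)) μ
  indep_Xs : iIndepFun Xs μ
  indep : IndepFun (fun ω i => (X i ω, Y i ω)) (fun ω j => Xs j ω) μ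

/-- The sigma-algebra generated by `X_i, Y_i, X*_j`. -/
abbrev dataSigma {Ω : Type*} (X : Fin n → Ω → E d) (Y : Fin n → Ω → ℝ) (Xs : Fin m → Ω → E d) :
    MeasurableSpace Ω :=
  MeasurableSpace.comap
    (fun ω => ((fun i => (X i ω, Y i ω)), (fun j => Xs j ω)) :
      Ω → (Fin n → E d × ℝ) × (Fin m → E d)) inferInstance

/-- The sigma-algebra generated by `X = (X_1, …, X_n)`. -/
abbrev covSigma {Ω : Type*} (X : Fin n → Ω → E d) : MeasurableSpace Ω :=
  MeasurableSpace.comap (fun ω i => X i ω : Ω → Fin n → E d) inferInstance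

open Classical in
/-- The labels `Ŷ_j` have, given the data, the conditional law
`k⁻¹ ∑_i 1{‖X_i - X*_j‖ ≤ τ_k(X*_j)} δ_{Y_i}`. -/
structure IsLabels {Ω : Type*} [MeasurableSpace Ω] (μ : Measure Ω) (k : ℕ)
    (X : Fin n → Ω → E d) (Y : Fin n → Ω → ℝ) (Xs : Fin m → Ω → E d)
    (Yhat : Fin m → Ω → ℝ) : Prop where
  measurable : ∀ j, Measurable (Yhat j)
  condLaw : ∀ j, ∀ B : Set ℝ, MeasurableSet B →
    μ[(Yhat j ⁻¹' B).indicator (fun _ => (1 : ℝ)) | dataSigma X Y Xs] =ᵐ[μ]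
      fun ω => (k : ℝ)⁻¹ * ∑ i,
        if ‖X i ω - Xs j ω‖ ≤ knnRadius k (fun i => X i ω) (Xs j ω) ∧ Y i ω ∈ B
          then (1 : ℝ) else 0

/-- The conditional bias `E[ê | X] - e(h)`. -/
def condBias {Ω : Type*} [MeasurableSpace Ω] (μ : Measure Ω) (X : Fin n → Ω → E d)
    (est : Ω → ℝ) (e : ℝ) : Ω → ℝ :=
  fun ω => (μ[est | covSigma X]) ω - e

/-- The conditional bias of the first estimator. -/
def B1 {Ω : Type*} [MeasurableSpace Ω] (Q : Measure (E d)) (κ : Kernel (E d) ℝ)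
    (h : E d → ℝ → ℝ) (μ : Measure Ω) (X : Fin n → Ω → E d) (Xs : Fin m → Ω → E d)
    (Yhat : Fin m → Ω → ℝ) : Ω → ℝ :=
  condBias μ X (fun ω => est1 h (fun j => Xs j ω) (fun j => Yhat j ω)) (targetMean Q κ h)

/-- The conditional bias of the second estimator. -/
def B2 {Ω : Type*} [MeasurableSpace Ω] (Q : Measure (E d)) (κ : Kernel (E d) ℝ)
    (h : E d → ℝ → ℝ) (μ : Measure Ω) (k : ℕ) (X : Fin n → Ω → E d) (Y : Fin n → Ω → ℝ)
    (Xs : Fin m → Ω → E d) : Ω → ℝ :=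
  condBias μ X (fun ω => est2 k h (fun i => X i ω) (fun i => Y i ω) (fun j => Xs j ω))
    (targetMean Q κ h)

/-! ### Assumptions -/

/-- The volume of balls intersected with the domain is comparable to that of the balls. -/
def BallVolume (𝒳 : Set (E d)) : Prop :=
  ∃ c : ℝ, 0 < c ∧ ∀ x ∈ 𝒳, ∀ r : ℝ, 0 ≤ r → r ≤ Metric.diam 𝒳 →
    ENNReal.ofReal c * volume (Metric.closedBall x r) ≤ volume (Metric.closedBall x r ∩ 𝒳)

/-- `p` is a density of `P` with respect to Lebesgue measure. -/
structure IsDensity (P : Measure (E d)) (p : E d → ℝ) : Prop where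
  measurable : Measurable p
  nonneg : ∀ x, 0 ≤ p x
  eq : P = volume.withDensity (fun x => ENNReal.ofReal (p x))

/-- The geometric condition
`sup_{L>0} L^{1/d} ∫_𝒳 exp(-L δ(x)^d) dQ(x) < ∞`, with `δ(x)` the distance to `𝒳ᶜ`. -/
def GeomCondition (𝒳 : Set (E d)) (Q : Measure (E d)) : Prop :=
  ∃ M : ℝ, ∀ L : ℝ, 0 < L →
    L ^ (1 / (d : ℝ)) * ∫ x in 𝒳, Real.exp (-L * (Metric.infDist x 𝒳ᶜ) ^ d) ∂Q ≤ M

/-- Every `Δ(x,·)`, `x ∈ 𝒳`, extends to a `C²` function on a common bounded convex open set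
`U ⊇ 𝒳`, with gradients and Hessians bounded uniformly over `𝒳 × co(𝒳)`. -/
def SmoothDelta (𝒳 : Set (E d)) (κ : Kernel (E d) ℝ) (h : E d → ℝ → ℝ) : Prop :=
  ∃ U : Set (E d), IsOpen U ∧ Convex ℝ U ∧ Bornology.IsBounded U ∧ 𝒳 ⊆ U ∧
    ∃ D : E d → E d → ℝ,
      (∀ x ∈ 𝒳, ContDiffOn ℝ 2 (D x) U ∧ EqOn (D x) (Delta κ h x) 𝒳) ∧
      ∃ M : ℝ, ∀ x ∈ 𝒳, ∀ y ∈ convexHull ℝ 𝒳,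
        ‖fderiv ℝ (D x) y‖ + ‖fderiv ℝ (fderiv ℝ (D x)) y‖ ≤ M

/-- `g` extends to a `C²` function on a bounded convex open set `U ⊇ 𝒳`. -/
def SmoothRegr (𝒳 : Set (E d)) (κ : Kernel (E d) ℝ) (h : E d → ℝ → ℝ) : Prop :=
  ∃ U : Set (E d), IsOpen U ∧ Convex ℝ U ∧ Bornology.IsBounded U ∧ 𝒳 ⊆ U ∧
    ∃ G : E d → ℝ, ContDiffOn ℝ 2 G U ∧ EqOn G (regr κ h) 𝒳

end Matching

end

/-!
Given the source covariates `X`, the conditional expectation of either estimator is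
`∫ k⁻¹ ∑_{i ∈ kNN(x)} L x (X i) dQ(x)`, with `L x u = Δ(x,u)` for the first and `L x u = g(u)` for
the second. As exactly `k` points are nearest neighbours of `x` and `e(h) = ∫ L x x dQ(x)`, the
conditional bias is the same average of the increments `Φ x u = L x u - L x x`, for which
`Φ x u = A_x (u - x) + O(‖u - x‖²)`. With `ε = (k/n)^{1/d}`, the order of the `k`-NN radius, its
mean square splits as follows.

* Mean. Given the other points, a neighbour of `x` is distributed as `P` restricted to a ball
  centred at `x`. If that ball lies inside `𝒳`, the linear term cancels by symmetry up to the
  Lipschitz constant of `p`, which leaves `O(ε²)`. Otherwise `δ(x)` is at most the `k`-NN radius,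
  the increment is only `O(ε)`, but by the geometric condition such `x` have `Q`-mass `O(ε)`.
* Variance. Removing `X i` affects the averages only at those `x` that have `X i` as a neighbour
  (and swaps `X i` for the `(k+1)`-st neighbour there), so that the Efron–Stein inequality bounds
  the variance by `O(ε² · k/n) = O(ε^{d+2})`.

The total `O(ε⁴ + ε^{d+2})` is of order `(k/n)^{min(4/d, 1 + 2/d)}`, and `1 + 2/d` is at least
`4/d` for `d ≥ 2` and equals `3` for `d = 1`.
-/

noncomputable section

namespace Matching

section OrderStatistics

variable {ι α : Type*} [ConditionallyCompleteLinearOrder α] {s : Finset ι} {k : ℕ} {a : ι → α}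

/-- The `k`-th order statistic of the family `(a i)_{i ∈ s}`: the least `r` such that at least `k`
of the `a i` are at most `r`. It is meaningful for `1 ≤ k ≤ #s` only. -/
def ordStat (s : Finset ι) (k : ℕ) (a : ι → α) : α :=
  sInf {r | k ≤ {i ∈ s | a i ≤ r}.card}

lemma knnRadius_eq_ordStat {d n : ℕ} (k : ℕ) (X : Fin n → E d) (x : E d) :
    knnRadius k X x = ordStat Finset.univ k (fun i ↦ ‖X i - x‖) := rfl

lemma ordStat_congr {b : ι → α} (hab : ∀ i ∈ s, a i = b i) : ordStat s k a = ordStat s k b := by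
  unfold ordStat
  congr! 5 with r
  exact Finset.filter_congr fun i hi ↦ by rw [hab i hi]

lemma isLeast_ordStat (hk : 1 ≤ k) (hks : k ≤ s.card) :
    IsLeast {r | k ≤ {i ∈ s | a i ≤ r}.card} (ordStat s k a) := by
  -- The count only jumps at values of the family, so the least such value already qualifies.
  set T := {j ∈ s | k ≤ {i ∈ s | a i ≤ a j}.card}
  have exists_mem_T_le {r : α} (hr : k ≤ {i ∈ s | a i ≤ r}.card) : ∃ j ∈ T, a j ≤ r := by
    obtain ⟨j, hj, hmax⟩ := Finset.exists_max_image _ a (Finset.card_pos.1 (hk.trans hr))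
    rw [Finset.mem_filter] at hj
    refine ⟨j, Finset.mem_filter.2 ⟨hj.1, hr.trans (Finset.card_le_card fun i hi ↦ ?_)⟩, hj.2⟩
    exact Finset.mem_filter.2 ⟨(Finset.mem_filter.1 hi).1, hmax i hi⟩
  obtain ⟨top, -, htop⟩ := Finset.exists_max_image s a (Finset.card_pos.1 (hk.trans hks))
  obtain ⟨j, hjT, -⟩ := exists_mem_T_le (r := a top) (by rwa [Finset.filter_true_of_mem htop])
  obtain ⟨j₀, hj₀, hmin⟩ := Finset.exists_min_image T a ⟨j, hjT⟩
  have hleast : IsLeast {r | k ≤ {i ∈ s | a i ≤ r}.card} (a j₀) := by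
    refine ⟨(Finset.mem_filter.1 hj₀).2, fun r hr ↦ ?_⟩
    obtain ⟨j, hj, hjr⟩ := exists_mem_T_le hr
    exact (hmin j hj).trans hjr
  rwa [ordStat, hleast.csInf_eq]

lemma le_card_filter_le_ordStat (hk : 1 ≤ k) (hks : k ≤ s.card) :
    k ≤ {i ∈ s | a i ≤ ordStat s k a}.card :=
  (isLeast_ordStat hk hks).1

lemma ordStat_le_iff (hk : 1 ≤ k) (hks : k ≤ s.card) {r : α} :
    ordStat s k a ≤ r ↔ k ≤ {i ∈ s | a i ≤ r}.card :=
  ⟨fun h ↦ (le_card_filter_le_ordStat hk hks).trans <| Finset.card_le_card <|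
    Finset.monotone_filter_right s fun _ _ hi ↦ hi.trans h, fun h ↦ (isLeast_ordStat hk hks).2 h⟩

lemma ordStat_le_of_forall_le (hk : 1 ≤ k) (hks : k ≤ s.card) {r : α} (hr : ∀ i ∈ s, a i ≤ r) :
    ordStat s k a ≤ r := by
  rwa [ordStat_le_iff hk hks, Finset.filter_true_of_mem hr]

lemma le_ordStat_of_forall_le (hk : 1 ≤ k) (hks : k ≤ s.card) {r : α} (hr : ∀ i ∈ s, r ≤ a i) :
    r ≤ ordStat s k a := by
  obtain ⟨i, hi⟩ :=
    Finset.card_pos.1 (hk.trans (le_card_filter_le_ordStat (a := a) hk hks))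
  rw [Finset.mem_filter] at hi
  exact (hr i hi.1).trans hi.2

lemma ordStat_mono_right {l : ℕ} (hk : 1 ≤ k) (hkl : k ≤ l) (hls : l ≤ s.card) :
    ordStat s k a ≤ ordStat s l a :=
  (ordStat_le_iff hk (hkl.trans hls)).2
    (hkl.trans (le_card_filter_le_ordStat (hk.trans hkl) hls))

lemma card_filter_lt_ordStat_lt (hk : 1 ≤ k) (hks : k ≤ s.card) :
    {i ∈ s | a i < ordStat s k a}.card < k := by
  by_contra! hcard
  obtain ⟨j, hj, hmax⟩ := Finset.exists_max_image _ a (Finset.card_pos.1 (hk.trans hcard))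
  refine (Finset.mem_filter.1 hj).2.not_ge ((ordStat_le_iff hk hks).2 <| hcard.trans <|
    Finset.card_le_card fun i hi ↦ Finset.mem_filter.2 ⟨(Finset.mem_filter.1 hi).1, hmax i hi⟩)

lemma card_filter_le_ordStat (hk : 1 ≤ k) (hks : k ≤ s.card) (ha : InjOn a s) :
    {i ∈ s | a i ≤ ordStat s k a}.card = k := by
  classical
  refine le_antisymm ?_ (le_card_filter_le_ordStat hk hks)
  have card_eq_le_one : {i ∈ s | a i = ordStat s k a}.card ≤ 1 :=
    Finset.card_le_one.2 fun i hi j hj ↦ by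
      rw [Finset.mem_filter] at hi hj
      exact ha hi.1 hj.1 (hi.2.trans hj.2.symm)
  have card_lt := card_filter_lt_ordStat_lt (a := a) hk hks
  have card_le := Finset.card_union_le {i ∈ s | a i < ordStat s k a} {i ∈ s | a i = ordStat s k a}
  simp only [← Finset.filter_or, ← le_iff_lt_or_eq] at card_le
  lia

variable [DecidableEq ι] {i : ι}

lemma ordStat_le_ordStat_erase (hk : 1 ≤ k) (hks : k ≤ (s.erase i).card) :
    ordStat s k a ≤ ordStat (s.erase i) k a :=
  (ordStat_le_iff hk (hks.trans Finset.card_erase_le)).2 <|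
    (le_card_filter_le_ordStat hk hks).trans <| Finset.card_le_card <|
      Finset.filter_subset_filter _ (Finset.erase_subset _ _)

lemma ordStat_erase_le_ordStat_succ (hk : 1 ≤ k) (hi : i ∈ s) (hks : k + 1 ≤ s.card) :
    ordStat (s.erase i) k a ≤ ordStat s (k + 1) a := by
  rw [ordStat_le_iff hk (by rw [Finset.card_erase_of_mem hi]; lia), Finset.filter_erase]
  have := le_card_filter_le_ordStat (a := a) (by lia : 1 ≤ k + 1) hks
  have := Finset.pred_card_le_card_erase (s := {j ∈ s | a j ≤ ordStat s (k + 1) a}) (a := i)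
  lia

lemma le_ordStat_iff_le_ordStat_erase (hk : 1 ≤ k) (hi : i ∈ s) (hks : k + 1 ≤ s.card) :
    a i ≤ ordStat s k a ↔ a i ≤ ordStat (s.erase i) k a := by
  have hks' : k ≤ (s.erase i).card := by rw [Finset.card_erase_of_mem hi]; lia
  refine ⟨fun h ↦ h.trans (ordStat_le_ordStat_erase hk hks'), fun h ↦ ?_⟩
  by_contra! hlt
  refine (hlt.trans_le h).not_ge ?_
  rw [ordStat_le_iff hk hks', Finset.filter_erase, Finset.erase_eq_of_notMem (by simp [hlt])]
  exact le_card_filter_le_ordStat hk (by lia)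

lemma abs_sum_filter_sub_sum_filter_erase_le (hk : 1 ≤ k) (hi : i ∈ s) (hks : k + 1 ≤ s.card)
    (ha : InjOn a s) {φ : ι → ℝ} {c : ℝ} (hφ : ∀ j ∈ s, a j ≤ ordStat s (k + 1) a → |φ j| ≤ c) :
    |∑ j ∈ s with a j ≤ ordStat s k a, φ j -
        ∑ j ∈ s.erase i with a j ≤ ordStat (s.erase i) k a, φ j| ≤
      if a i ≤ ordStat s k a then 2 * c else 0 := by
  have hks' : k ≤ (s.erase i).card := by rw [Finset.card_erase_of_mem hi]; lia
  set S := {j ∈ s | a j ≤ ordStat s k a} with hS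
  set S' := {j ∈ s.erase i | a j ≤ ordStat (s.erase i) k a} with hS'
  have card_S : S.card = k := card_filter_le_ordStat hk (by lia) ha
  have card_S' : S'.card = k := card_filter_le_ordStat hk hks' (ha.mono (by simp))
  have erase_subset : S.erase i ⊆ S' := by
    intro j hj
    rw [Finset.mem_erase, hS, Finset.mem_filter] at hj
    exact Finset.mem_filter.2 ⟨Finset.mem_erase.2 ⟨hj.1, hj.2.1⟩,
      hj.2.2.trans (ordStat_le_ordStat_erase hk hks')⟩
  split_ifs with hai
  · have hiS : i ∈ S := Finset.mem_filter.2 ⟨hi, hai⟩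
    obtain ⟨j, hj⟩ : ∃ j, S' \ S.erase i = {j} := by
      rw [← Finset.card_eq_one, Finset.card_sdiff_of_subset erase_subset,
        Finset.card_erase_of_mem hiS]
      lia
    have hjS' : j ∈ S' := (Finset.mem_sdiff.1 (hj ▸ Finset.mem_singleton_self j)).1
    rw [hS', Finset.mem_filter, Finset.mem_erase] at hjS'
    calc |∑ j ∈ S, φ j - ∑ j ∈ S', φ j| = |φ i - φ j| := by
          rw [← Finset.add_sum_erase S φ hiS, ← Finset.sum_sdiff erase_subset, hj,
            Finset.sum_singleton, add_sub_add_right_eq_sub]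
      _ ≤ |φ i| + |φ j| := abs_sub _ _
      _ ≤ c + c := add_le_add (hφ i hi (hai.trans (ordStat_mono_right hk (by lia) hks)))
          (hφ j hjS'.1.2 (hjS'.2.trans (ordStat_erase_le_ordStat_succ hk hi hks)))
      _ = 2 * c := (two_mul c).symm
  · have hiS : i ∉ S := fun h ↦ hai (Finset.mem_filter.1 h).2
    rw [Finset.erase_eq_of_notMem hiS] at erase_subset
    rw [Finset.eq_of_subset_of_card_le erase_subset (by lia), sub_self, abs_zero]

end OrderStatistics

lemma measurable_ordStat {ι β : Type*} [MeasurableSpace β] {s : Finset ι} {k : ℕ} (hk : 1 ≤ k)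
    (hks : k ≤ s.card) {a : β → ι → ℝ} (ha : ∀ i, Measurable fun z ↦ a z i) :
    Measurable fun z ↦ ordStat s k (a z) := by
  refine measurable_of_Iic fun r ↦ ?_
  have preimage_Iic : (fun z ↦ ordStat s k (a z)) ⁻¹' Iic r =
      (fun z ↦ ∑ i ∈ s, if a z i ≤ r then 1 else 0) ⁻¹' Ici k := by
    ext z
    rw [mem_preimage, mem_Iic, ordStat_le_iff hk hks, Finset.card_filter, mem_preimage, mem_Ici]
  rw [preimage_Iic]
  exact Finset.measurable_fun_sum s (fun i _ ↦ .ite (measurableSet_le (ha i) measurable_const)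
    measurable_const measurable_const) measurableSet_Ici

section EfronStein

variable {α β : Type*} [MeasurableSpace α] [MeasurableSpace β] {μ : Measure α} {ν : Measure β}

lemma integral_sq_eq_sq_integral_add_variance [IsProbabilityMeasure μ] {f : α → ℝ}
    (hf : MemLp f 2 μ) : ∫ x, f x ^ 2 ∂μ = (∫ x, f x ∂μ) ^ 2 + Var[f; μ] := by
  rw [variance_eq_sub hf]
  simp only [Pi.pow_apply]
  ring

lemma sq_integral_le_integral_sq [IsProbabilityMeasure μ] {f : α → ℝ} (hf : MemLp f 2 μ) :
    (∫ x, f x ∂μ) ^ 2 ≤ ∫ x, f x ^ 2 ∂μ := by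
  rw [integral_sq_eq_sq_integral_add_variance hf]
  exact le_add_of_nonneg_right (variance_nonneg f μ)

lemma variance_le_integral_sub_sq [IsProbabilityMeasure μ] {f : α → ℝ}
    (hf : AEStronglyMeasurable f μ) (c : ℝ) : Var[f; μ] ≤ ∫ x, (f x - c) ^ 2 ∂μ := by
  rw [← variance_sub_const hf c]
  exact variance_le_expectation_sq (hf.sub aestronglyMeasurable_const)

lemma ae_memLp_two_prodMk_left [SFinite μ] [SFinite ν] {f : α × β → ℝ}
    (hf : MemLp f 2 (μ.prod ν)) : ∀ᵐ a ∂μ, MemLp (fun b ↦ f (a, b)) 2 ν := by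
  filter_upwards [hf.1.prodMk_left, hf.integrable_sq.prod_right_ae] with a hmeas hint
  exact (memLp_two_iff_integrable_sq hmeas).2 hint

lemma memLp_two_integral_prod [IsProbabilityMeasure μ] [IsProbabilityMeasure ν] {f : α × β → ℝ}
    (hf : MemLp f 2 (μ.prod ν)) : MemLp (fun a ↦ ∫ b, f (a, b) ∂ν) 2 μ := by
  have hmeas := hf.1.integral_prod_right'
  refine (memLp_two_iff_integrable_sq hmeas).2 <|
    hf.integrable_sq.integral_prod_left.mono' (hmeas.pow 2) ?_
  filter_upwards [ae_memLp_two_prodMk_left hf] with a ha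
  rw [Real.norm_of_nonneg (sq_nonneg _)]
  exact sq_integral_le_integral_sq ha

lemma integral_sq_integral_prod_le [IsProbabilityMeasure μ] [IsProbabilityMeasure ν]
    {f : α × β → ℝ} (hf : MemLp f 2 (μ.prod ν)) :
    ∫ a, (∫ b, f (a, b) ∂ν) ^ 2 ∂μ ≤ ∫ z, f z ^ 2 ∂(μ.prod ν) := by
  rw [integral_prod _ hf.integrable_sq]
  refine integral_mono_ae (memLp_two_integral_prod hf).integrable_sq
    hf.integrable_sq.integral_prod_left ?_
  filter_upwards [ae_memLp_two_prodMk_left hf] with a ha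
  exact sq_integral_le_integral_sq ha

lemma variance_prod_eq [IsProbabilityMeasure μ] [IsProbabilityMeasure ν] {f : α × β → ℝ}
    (hf : MemLp f 2 (μ.prod ν)) :
    Var[f; μ.prod ν] =
      Var[fun a ↦ ∫ b, f (a, b) ∂ν; μ] + ∫ a, Var[fun b ↦ f (a, b); ν] ∂μ := by
  have hF := memLp_two_integral_prod hf
  have integral_variance : ∫ a, Var[fun b ↦ f (a, b); ν] ∂μ =
      ∫ z, f z ^ 2 ∂(μ.prod ν) - ∫ a, (∫ b, f (a, b) ∂ν) ^ 2 ∂μ := by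
    rw [integral_prod _ hf.integrable_sq,
      ← integral_sub hf.integrable_sq.integral_prod_left hF.integrable_sq]
    refine integral_congr_ae ?_
    filter_upwards [ae_memLp_two_prodMk_left hf] with a ha
    exact variance_eq_sub ha
  rw [integral_variance, variance_eq_sub hf, variance_eq_sub hF,
    integral_prod _ (hf.integrable one_le_two)]
  simp only [Pi.pow_apply]
  ring

lemma variance_prod_le [IsProbabilityMeasure μ] [IsProbabilityMeasure ν] {f : α × β → ℝ}
    {g : β → ℝ} (hf : MemLp f 2 (μ.prod ν)) (hg : MemLp g 2 ν) :
    Var[f; μ.prod ν] ≤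
      ∫ z, (f z - g z.2) ^ 2 ∂(μ.prod ν) + ∫ a, Var[fun b ↦ f (a, b); ν] ∂μ := by
  rw [variance_prod_eq hf]
  gcongr
  calc Var[fun a ↦ ∫ b, f (a, b) ∂ν; μ]
      ≤ ∫ a, (∫ b, f (a, b) ∂ν - ∫ b, g b ∂ν) ^ 2 ∂μ :=
        variance_le_integral_sub_sq hf.1.integral_prod_right' _
    _ = ∫ a, (∫ b, (f (a, b) - g b) ∂ν) ^ 2 ∂μ := by
        refine integral_congr_ae ?_
        filter_upwards [ae_memLp_two_prodMk_left hf] with a ha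
        rw [integral_sub (ha.integrable one_le_two) (hg.integrable one_le_two)]
    _ ≤ ∫ z, (f z - g z.2) ^ 2 ∂(μ.prod ν) :=
        integral_sq_integral_prod_le (f := fun z ↦ f z - g z.2) (hf.sub (hg.comp_snd μ))

lemma measurePreserving_finCons {n : ℕ} {α : Fin (n + 1) → Type*} [∀ i, MeasurableSpace (α i)]
    (P : ∀ i, Measure (α i)) [∀ i, SigmaFinite (P i)] :
    MeasurePreserving (fun z : α 0 × (∀ i : Fin n, α i.succ) ↦ (Fin.cons z.1 z.2 : ∀ i, α i))
      ((P 0).prod (Measure.pi fun i ↦ P i.succ)) (Measure.pi P) := by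
  have hmeas : Measurable fun z : α 0 × (∀ i : Fin n, α i.succ) ↦
      (Fin.cons z.1 z.2 : ∀ i, α i) := by
    refine measurable_pi_lambda _ (Fin.cases measurable_fst fun i ↦ ?_)
    simp only [Fin.cons_succ]
    fun_prop
  refine ⟨hmeas, (Measure.pi_eq fun s hs ↦ ?_).symm⟩
  have preimage_pi : (fun z : α 0 × (∀ i : Fin n, α i.succ) ↦ (Fin.cons z.1 z.2 : ∀ i, α i)) ⁻¹'
      univ.pi s = s 0 ×ˢ univ.pi fun i : Fin n ↦ s i.succ := by
    ext z
    simp [Fin.forall_fin_succ]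
  rw [Measure.map_apply hmeas (MeasurableSet.univ_pi hs), preimage_pi, Measure.prod_prod,
    Measure.pi_pi, Fin.prod_univ_succ]

theorem variance_pi_le_sum_integral_sub_sq {n : ℕ} {α : Fin n → Type*}
    [∀ i, MeasurableSpace (α i)] (P : ∀ i, Measure (α i)) [∀ i, IsProbabilityMeasure (P i)]
    {f : (∀ i, α i) → ℝ} {g : Fin n → (∀ i, α i) → ℝ} (hf : MemLp f 2 (Measure.pi P))
    (hg : ∀ i, MemLp (g i) 2 (Measure.pi P))
    (hg_update : ∀ i x y, g i (Function.update x i y) = g i x) :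
    Var[f; Measure.pi P] ≤ ∑ i, ∫ x, (f x - g i x) ^ 2 ∂(Measure.pi P) := by
  induction n with
  | zero =>
    have f_const : f = fun _ ↦ f finZeroElim := by
      ext x; rw [Subsingleton.elim x finZeroElim]
    rw [f_const, variance_eq_integral aemeasurable_const]
    simp
  | succ n ih =>
    set ν := Measure.pi fun i : Fin n ↦ P i.succ
    have hcons := measurePreserving_finCons P
    have hf' := hf.comp_measurePreserving hcons
    have hg' := fun i ↦ (hg i).comp_measurePreserving hcons
    have integral_sub_sq (i) : ∫ x, (f x - g i x) ^ 2 ∂(Measure.pi P) =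
        ∫ z, (f (Fin.cons z.1 z.2) - g i (Fin.cons z.1 z.2)) ^ 2 ∂((P 0).prod ν) := by
      rw [← hcons.map_eq, integral_map hcons.aemeasurable]
      rw [hcons.map_eq]
      exact (hf.1.sub (hg i).1).pow 2
    have hsub_sq (i) := (hf'.sub (hg' i)).integrable_sq
    obtain ⟨a₀, ha₀⟩ := (ae_memLp_two_prodMk_left (hg' 0)).exists
    have g_zero (z : α 0 × _) : g 0 (Fin.cons z.1 z.2) = g 0 (Fin.cons a₀ z.2) := by
      rw [← hg_update 0 (Fin.cons a₀ z.2) z.1, Fin.update_cons_zero]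
    have integral_variance_le : ∫ a, Var[fun b ↦ f (Fin.cons a b); ν] ∂(P 0) ≤
        ∑ i : Fin n, ∫ x, (f x - g i.succ x) ^ 2 ∂(Measure.pi P) := by
      simp only [integral_sub_sq]
      rw [Finset.sum_congr rfl fun i _ ↦ integral_prod _ (hsub_sq i.succ),
        ← integral_finsetSum _ fun i _ ↦ (hsub_sq i.succ).integral_prod_left]
      refine integral_mono_of_nonneg (.of_forall fun _ ↦ variance_nonneg _ _)
        (integrable_finsetSum _ fun i _ ↦ (hsub_sq i.succ).integral_prod_left) ?_
      filter_upwards [ae_memLp_two_prodMk_left hf',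
        ae_all_iff.2 fun i : Fin n ↦ ae_memLp_two_prodMk_left (hg' i.succ)] with a hfa hga
      exact ih (fun i ↦ P i.succ) hfa hga fun i x y ↦ by
        rw [← hg_update i.succ (Fin.cons a x) y, Fin.cons_update]
    calc Var[f; Measure.pi P]
        = Var[fun z ↦ f (Fin.cons z.1 z.2); (P 0).prod ν] :=
          (hcons.variance_fun_comp hf.1.aemeasurable).symm
      _ ≤ ∫ z, (f (Fin.cons z.1 z.2) - g 0 (Fin.cons a₀ z.2)) ^ 2 ∂((P 0).prod ν) +
            ∫ a, Var[fun b ↦ f (Fin.cons a b); ν] ∂(P 0) :=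
          variance_prod_le (g := fun b ↦ g 0 (Fin.cons a₀ b)) hf' ha₀
      _ ≤ _ := by
          rw [Fin.sum_univ_succ, integral_sub_sq 0]
          simp only [g_zero]
          gcongr

end EfronStein

lemma measurePreserving_update {ι : Type*} [Fintype ι] [DecidableEq ι] {α : ι → Type*}
    [∀ i, MeasurableSpace (α i)] (P : ∀ i, Measure (α i)) [∀ i, IsProbabilityMeasure (P i)]
    (i : ι) : MeasurePreserving (fun z : (∀ j, α j) × α i ↦ Function.update z.1 i z.2)
      ((Measure.pi P).prod (P i)) (Measure.pi P) := by
  have hmeas : Measurable fun z : (∀ j, α j) × α i ↦ Function.update z.1 i z.2 := by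
    refine measurable_pi_lambda _ fun j ↦ ?_
    rcases eq_or_ne j i with rfl | hj
    · simpa using measurable_snd
    · simp only [Function.update_of_ne hj]
      fun_prop
  refine ⟨hmeas, (Measure.pi_eq fun s hs ↦ ?_).symm⟩
  have preimage_pi : (fun z : (∀ j, α j) × α i ↦ Function.update z.1 i z.2) ⁻¹' univ.pi s =
      univ.pi (Function.update s i univ) ×ˢ s i := by
    ext z
    simp only [mem_preimage, mem_univ_pi, mem_prod]
    refine ⟨fun h ↦ ⟨fun j ↦ ?_, by simpa using h i⟩, fun ⟨h₁, h₂⟩ j ↦ ?_⟩ <;>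
      rcases eq_or_ne j i with rfl | hj
    · simp
    · simpa [hj] using h j
    · simpa using h₂
    · simpa [hj] using h₁ j
  rw [Measure.map_apply hmeas (MeasurableSet.univ_pi hs), preimage_pi, Measure.prod_prod,
    Measure.pi_pi, ← Finset.prod_erase_mul _ _ (Finset.mem_univ i), Function.update_self,
    measure_univ, mul_one, ← Finset.prod_erase_mul Finset.univ _ (Finset.mem_univ i)]
  congr 1
  exact Finset.prod_congr rfl fun j hj ↦ by rw [Function.update_of_ne (Finset.ne_of_mem_erase hj)]

section BallMeasures

variable {d : ℕ} {𝒳 : Set (E d)} {P : Measure (E d)} {p : E d → ℝ} {b : ℝ}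

lemma measureReal_closedBall_eq (x : E d) {r : ℝ} (hr : 0 ≤ r) :
    volume.real (Metric.closedBall x r) = r ^ d * volume.real (Metric.ball (0 : E d) 1) := by
  simp [Measure.real, Measure.addHaar_closedBall volume x hr, ENNReal.toReal_ofReal, hr]

lemma measureReal_unitBall_pos : 0 < volume.real (Metric.ball (0 : E d) 1) :=
  ENNReal.toReal_pos (Metric.measure_ball_pos volume _ one_pos).ne' measure_ball_lt_top.ne

lemma IsDensity.le_smul_restrict (hp : IsDensity P p) (h𝒳 : MeasurableSet 𝒳) (hP : P 𝒳ᶜ = 0)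
    (hpb : ∀ x ∈ 𝒳, p x ≤ b) : P ≤ ENNReal.ofReal b • volume.restrict 𝒳 := by
  rw [← Measure.restrict_eq_self_of_ae_mem (show ∀ᵐ x ∂P, x ∈ 𝒳 from hP), hp.eq,
    restrict_withDensity h𝒳, ← withDensity_const]
  exact withDensity_mono <| (ae_restrict_mem h𝒳).mono fun x hx ↦ ENNReal.ofReal_le_ofReal (hpb x hx)

lemma IsDensity.smul_restrict_le (hp : IsDensity P p) (h𝒳 : MeasurableSet 𝒳)
    (hpb : ∀ x ∈ 𝒳, b ≤ p x) : ENNReal.ofReal b • volume.restrict 𝒳 ≤ P := by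
  refine le_trans ?_ (Measure.restrict_le_self (s := 𝒳))
  rw [hp.eq, restrict_withDensity h𝒳, ← withDensity_const]
  exact withDensity_mono <| (ae_restrict_mem h𝒳).mono fun x hx ↦ ENNReal.ofReal_le_ofReal (hpb x hx)

lemma IsDensity.measureReal_le (hp : IsDensity P p) (h𝒳 : MeasurableSet 𝒳) (hP : P 𝒳ᶜ = 0)
    (hb : 0 ≤ b) (hpb : ∀ x ∈ 𝒳, p x ≤ b) {B : Set (E d)} (hB : volume B ≠ ∞) :
    P.real B ≤ b * volume.real B := by
  rw [Measure.real, Measure.real, ← ENNReal.toReal_ofReal hb, ← ENNReal.toReal_mul]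
  refine ENNReal.toReal_mono (ENNReal.mul_ne_top ENNReal.ofReal_ne_top hB) ?_
  calc P B ≤ ENNReal.ofReal b * volume.restrict 𝒳 B := hp.le_smul_restrict h𝒳 hP hpb B
    _ ≤ ENNReal.ofReal b * volume B := by gcongr; exact Measure.restrict_le_self

/-- `P` is upper Ahlfors regular with constant `C`: every ball of radius `r` has mass at most
`C r ^ d`. -/
def UpperRegular (P : Measure (E d)) (C : ℝ) : Prop :=
  ∀ x r, 0 ≤ r → P.real (Metric.closedBall x r) ≤ C * r ^ d

lemma IsDensity.exists_upperRegular (hp : IsDensity P p) (h𝒳 : MeasurableSet 𝒳)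
    (hP : P 𝒳ᶜ = 0) (hpb : ∃ b : ℝ, 0 < b ∧ ∀ x ∈ 𝒳, p x ≤ b) :
    ∃ C : ℝ, 0 < C ∧ UpperRegular P C := by
  obtain ⟨b, hb, hpb⟩ := hpb
  refine ⟨b * volume.real (Metric.ball (0 : E d) 1), mul_pos hb measureReal_unitBall_pos,
    fun x r hr ↦ ?_⟩
  calc P.real (Metric.closedBall x r)
      ≤ b * volume.real (Metric.closedBall x r) :=
        hp.measureReal_le h𝒳 hP hb.le hpb measure_closedBall_lt_top.ne
    _ = _ := by rw [measureReal_closedBall_eq x hr]; ring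

/-- `P` is lower Ahlfors regular on `𝒳` with constant `c`: balls centred in `𝒳` carry mass at least
`c r ^ d`, for radii up to the diameter of `𝒳`. -/
def LowerRegular (𝒳 : Set (E d)) (P : Measure (E d)) (c : ℝ) : Prop :=
  ∀ x ∈ 𝒳, ∀ r, 0 ≤ r → r ≤ Metric.diam 𝒳 → c * r ^ d ≤ P.real (Metric.closedBall x r)

lemma BallVolume.exists_lowerRegular [IsFiniteMeasure P] (h𝒳ball : BallVolume 𝒳)
    (hp : IsDensity P p) (h𝒳 : MeasurableSet 𝒳) (hpb : ∃ b : ℝ, 0 < b ∧ ∀ x ∈ 𝒳, b ≤ p x) :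
    ∃ c : ℝ, 0 < c ∧ LowerRegular 𝒳 P c := by
  obtain ⟨b, hb, hpb⟩ := hpb
  obtain ⟨c, hc, hvol⟩ := h𝒳ball
  refine ⟨b * c * volume.real (Metric.ball (0 : E d) 1),
    mul_pos (mul_pos hb hc) measureReal_unitBall_pos, fun x hx r hr hr_diam ↦ ?_⟩
  have mul_volume_le : ENNReal.ofReal b * (ENNReal.ofReal c * volume (Metric.closedBall x r)) ≤
      P (Metric.closedBall x r) := by
    calc ENNReal.ofReal b * (ENNReal.ofReal c * volume (Metric.closedBall x r))
        ≤ ENNReal.ofReal b * volume (Metric.closedBall x r ∩ 𝒳) := by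
          gcongr; exact hvol x hx r hr hr_diam
      _ = ENNReal.ofReal b * volume.restrict 𝒳 (Metric.closedBall x r) := by
          rw [Measure.restrict_apply measurableSet_closedBall]
      _ ≤ P (Metric.closedBall x r) := hp.smul_restrict_le h𝒳 hpb _
  have := ENNReal.toReal_mono (measure_ne_top _ _) mul_volume_le
  simp only [ENNReal.toReal_mul, ENNReal.toReal_ofReal hb.le, ENNReal.toReal_ofReal hc.le,
    ← Measure.real_def] at this
  rw [measureReal_closedBall_eq x hr] at this
  linarith

end BallMeasures

section KnnRadius

variable {d n k : ℕ}

lemma measurable_knnRadius (hk : 1 ≤ k) (hkn : k ≤ n) :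
    Measurable fun z : (Fin n → E d) × E d ↦ knnRadius k z.1 z.2 := by
  simp only [knnRadius_eq_ordStat]
  exact measurable_ordStat hk (by simpa using hkn) fun i ↦ by fun_prop

lemma measurable_knnRadius_left (hk : 1 ≤ k) (hkn : k ≤ n) (x : E d) :
    Measurable fun X : Fin n → E d ↦ knnRadius k X x := by
  simp only [knnRadius_eq_ordStat]
  exact measurable_ordStat hk (by simpa using hkn) fun i ↦ by fun_prop

lemma measurable_knnRadius_right (hk : 1 ≤ k) (hkn : k ≤ n) (X : Fin n → E d) :
    Measurable fun x : E d ↦ knnRadius k X x := by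
  simp only [knnRadius_eq_ordStat]
  exact measurable_ordStat hk (by simpa using hkn) fun i ↦ by fun_prop

lemma knnRadius_nonneg (hk : 1 ≤ k) (hkn : k ≤ n) (X : Fin n → E d) (x : E d) :
    0 ≤ knnRadius k X x := by
  rw [knnRadius_eq_ordStat]
  exact le_ordStat_of_forall_le hk (by simpa using hkn) fun i _ ↦ norm_nonneg _

lemma knnRadius_le_iff (hk : 1 ≤ k) (hkn : k ≤ n) {X : Fin n → E d} {x : E d} {r : ℝ} :
    knnRadius k X x ≤ r ↔ k ≤ ({i | ‖X i - x‖ ≤ r} : Finset (Fin n)).card := by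
  rw [knnRadius_eq_ordStat, ordStat_le_iff hk (by simpa using hkn)]

lemma knnRadius_le_diam (hk : 1 ≤ k) (hkn : k ≤ n) {𝒳 : Set (E d)}
    (h𝒳 : Bornology.IsBounded 𝒳) {X : Fin n → E d} (hX : ∀ i, X i ∈ 𝒳) {x : E d} (hx : x ∈ 𝒳) :
    knnRadius k X x ≤ Metric.diam 𝒳 := by
  rw [knnRadius_eq_ordStat]
  refine ordStat_le_of_forall_le hk (by simpa using hkn) fun i _ ↦ ?_
  rw [← dist_eq_norm]
  exact Metric.dist_le_diam_of_mem h𝒳 (hX i) hx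

lemma ae_pi_forall_mem {ι α : Type*} [Fintype ι] [MeasurableSpace α] {P : Measure α}
    [SigmaFinite P] {s : Set α} (hP : P sᶜ = 0) :
    ∀ᵐ X ∂(Measure.pi fun _ : ι ↦ P), ∀ i, X i ∈ s :=
  ae_all_iff.2 fun _ ↦ Measure.tendsto_eval_ae_ae.eventually (show ∀ᵐ y ∂P, y ∈ s from hP)

end KnnRadius

section ExponentialMoments

lemma half_le_one_sub_exp_neg {y : ℝ} (hy0 : 0 ≤ y) (hy1 : y ≤ 1) :
    y / 2 ≤ 1 - Real.exp (-y) := by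
  have exp_neg_le : Real.exp (-y) ≤ (1 + y)⁻¹ := by
    rw [Real.exp_neg]
    exact inv_anti₀ (by linarith) (by linarith [Real.add_one_le_exp y])
  have inv_le : (1 + y)⁻¹ ≤ 1 - y / 2 := by
    rw [inv_le_iff_one_le_mul₀ (by linarith)]
    nlinarith
  linarith

lemma mgf_indicator_one_le {α : Type*} [MeasurableSpace α] {P : Measure α}
    [IsProbabilityMeasure P] {B : Set α} (hB : MeasurableSet B) (t : ℝ) :
    mgf (B.indicator 1) P t ≤ Real.exp ((Real.exp t - 1) * P.real B) := by
  have exp_indicator (y : α) : Real.exp (t * B.indicator (1 : α → ℝ) y) =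
      1 + (Real.exp t - 1) * B.indicator (1 : α → ℝ) y := by
    by_cases hy : y ∈ B <;> simp [hy]
  have hint : Integrable (B.indicator (1 : α → ℝ)) P := (integrable_const 1).indicator hB
  calc mgf (B.indicator 1) P t = (Real.exp t - 1) * P.real B + 1 := by
        simp only [mgf, exp_indicator]
        rw [integral_add (integrable_const 1) (hint.const_mul _), integral_const_mul,
          integral_indicator_one hB, integral_const, probReal_univ, one_smul, add_comm]
    _ ≤ _ := Real.add_one_le_exp _

/-- A Chernoff bound with parameter `-1 / k`, which is how `k` enters the denominator. -/
lemma measureReal_pi_card_mem_le {n k : ℕ} (hk : 1 ≤ k) {α : Type*} [MeasurableSpace α]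
    {P : Measure α} [IsProbabilityMeasure P] {B : Set α} (hB : MeasurableSet B) :
    (Measure.pi fun _ : Fin n ↦ P).real {X | ∑ i, B.indicator (1 : α → ℝ) (X i) ≤ k} ≤
      Real.exp 1 * Real.exp (-(n * P.real B / (2 * k))) := by
  have hk0 : (0 : ℝ) < k := by exact_mod_cast hk
  have hB1 : Measurable (B.indicator (1 : α → ℝ)) := measurable_one.indicator hB
  set t : ℝ := -(1 / k) with ht
  have exp_t_le : Real.exp t - 1 ≤ -(1 / (2 * k)) := by
    have := half_le_one_sub_exp_neg (y := 1 / (k : ℝ)) (by positivity)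
      (by rw [div_le_one hk0]; exact_mod_cast hk)
    rw [ht, show 1 / (2 * (k : ℝ)) = 1 / k / 2 by field_simp]
    linarith
  have mgf_sum : mgf (∑ i, fun X : Fin n → α ↦ B.indicator (1 : α → ℝ) (X i))
      (Measure.pi fun _ ↦ P) t = mgf (B.indicator 1) P t ^ n := by
    have hindep : iIndepFun (fun i (X : Fin n → α) ↦ B.indicator (1 : α → ℝ) (X i))
        (Measure.pi fun _ ↦ P) := iIndepFun_pi fun _ ↦ hB1.aemeasurable
    have hmgf (i : Fin n) : mgf (fun X : Fin n → α ↦ B.indicator (1 : α → ℝ) (X i))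
        (Measure.pi fun _ ↦ P) t = mgf (B.indicator 1) P t := by
      have heval := measurePreserving_eval (fun _ : Fin n ↦ P) i
      rw [← heval.map_eq, mgf_map heval.measurable.aemeasurable (by fun_prop), heval.map_eq]
      rfl
    rw [hindep.mgf_sum (fun i ↦ hB1.comp (measurable_pi_apply i)), Finset.prod_congr rfl
      fun i _ ↦ hmgf i, Finset.prod_const, Finset.card_univ, Fintype.card_fin]
  have integrable_exp : Integrable (fun X : Fin n → α ↦ Real.exp (t * (∑ i, fun X : Fin n → α ↦
      B.indicator (1 : α → ℝ) (X i)) X)) (Measure.pi fun _ ↦ P) := by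
    refine .of_bound (by fun_prop) 1 (.of_forall fun X ↦ ?_)
    rw [Real.norm_of_nonneg (Real.exp_pos _).le, Real.exp_le_one_iff, Finset.sum_apply]
    exact mul_nonpos_of_nonpos_of_nonneg (by rw [ht]; simp) <|
      Finset.sum_nonneg fun i _ ↦ indicator_nonneg (by simp) _
  have chernoff := measure_le_le_exp_mul_mgf (k : ℝ) (by rw [ht]; simp) integrable_exp
  rw [mgf_sum] at chernoff
  simp only [Finset.sum_apply] at chernoff
  calc (Measure.pi fun _ : Fin n ↦ P).real {X | ∑ i, B.indicator (1 : α → ℝ) (X i) ≤ k}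
      ≤ Real.exp (-t * k) * mgf (B.indicator 1) P t ^ n := chernoff
    _ ≤ Real.exp 1 * Real.exp (-(1 / (2 * k)) * P.real B) ^ n := by
        gcongr
        · exact pow_nonneg mgf_nonneg n
        · rw [ht, neg_neg, one_div_mul_cancel hk0.ne']
        · exact mgf_nonneg
        · exact (mgf_indicator_one_le hB t).trans (by gcongr)
    _ = _ := by rw [← Real.exp_nat_mul]; congr 2; ring

lemma integral_exp_le_of_measureReal_lt_le {Ω : Type*} [MeasurableSpace Ω] {μ : Measure Ω}
    [IsProbabilityMeasure μ] {Z : Ω → ℝ} (hZ : AEMeasurable Z μ) {C : ℝ} (hC : 0 ≤ C)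
    (htail : ∀ t, 0 < t → μ.real {ω | t < Z ω} ≤ C * Real.exp (-(2 * t))) :
    Integrable (fun ω ↦ Real.exp (Z ω)) μ ∧ ∫ ω, Real.exp (Z ω) ∂μ ≤ 1 + C := by
  have exp_nonneg : 0 ≤ᵐ[μ] fun ω ↦ Real.exp (Z ω) := .of_forall fun ω ↦ (Real.exp_pos _).le
  have hexp : AEMeasurable (fun ω ↦ Real.exp (Z ω)) μ := hZ.exp
  have tail_exp (t : ℝ) (ht : t ∈ Ioi 1) :
      μ {ω | t < Real.exp (Z ω)} ≤ ENNReal.ofReal (C * t ^ (-2 : ℝ)) := by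
    have ht0 : 0 < t := one_pos.trans ht
    rw [← ofReal_measureReal]
    simp only [← Real.log_lt_iff_lt_exp ht0]
    refine ENNReal.ofReal_le_ofReal ((htail _ (Real.log_pos ht)).trans_eq ?_)
    rw [Real.rpow_def_of_pos ht0]
    ring_nf
  have lintegral_tail : ∫⁻ t in Ioi (1 : ℝ), ENNReal.ofReal (C * t ^ (-2 : ℝ)) =
      ENNReal.ofReal C := by
    rw [← ofReal_integral_eq_lintegral_ofReal
      ((integrableOn_Ioi_rpow_of_lt (by norm_num) one_pos).const_mul _), integral_const_mul,
      integral_Ioi_rpow_of_lt (by norm_num) one_pos]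
    · norm_num
    · filter_upwards [ae_restrict_mem measurableSet_Ioi] with t ht
      have : 0 < t := one_pos.trans ht
      positivity
  have lintegral_le : ∫⁻ ω, ENNReal.ofReal (Real.exp (Z ω)) ∂μ ≤ ENNReal.ofReal (1 + C) := by
    rw [lintegral_eq_lintegral_meas_lt μ exp_nonneg hexp, ← Ioc_union_Ioi_eq_Ioi zero_le_one,
      lintegral_union measurableSet_Ioi (Ioc_disjoint_Ioi le_rfl),
      ENNReal.ofReal_add zero_le_one hC]
    gcongr
    · calc _ ≤ ∫⁻ _ in Ioc (0 : ℝ) 1, 1 := lintegral_mono fun t ↦ prob_le_one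
        _ = ENNReal.ofReal 1 := by simp
    · exact (setLIntegral_mono' measurableSet_Ioi tail_exp).trans_eq lintegral_tail
  refine ⟨⟨hexp.aestronglyMeasurable, ?_⟩, ?_⟩
  · rw [hasFiniteIntegral_iff_ofReal exp_nonneg]
    exact lintegral_le.trans_lt ENNReal.ofReal_lt_top
  · rw [integral_eq_lintegral_of_nonneg_ae exp_nonneg hexp.aestronglyMeasurable]
    exact ENNReal.toReal_le_of_le_ofReal (by positivity) lintegral_le

variable {d n k : ℕ} {𝒳 : Set (E d)} {P : Measure (E d)} [IsProbabilityMeasure P] {c : ℝ} {x : E d}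

lemma measureReal_lt_knnRadius_le_closedBall (hk : 1 ≤ k) (hkn : k ≤ n) (x : E d) (r : ℝ) :
    (Measure.pi fun _ : Fin n ↦ P).real {X | r < knnRadius k X x} ≤
      Real.exp 1 * Real.exp (-(n * P.real (Metric.closedBall x r) / (2 * k))) := by
  refine le_trans (measureReal_mono fun X hX ↦ ?_)
    (measureReal_pi_card_mem_le hk measurableSet_closedBall)
  rw [mem_ofPred_eq, ← not_le, knnRadius_le_iff hk hkn, not_le, Finset.card_filter] at hX
  calc ∑ i, (Metric.closedBall x r).indicator (1 : E d → ℝ) (X i)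
      = ∑ i, if ‖X i - x‖ ≤ r then 1 else 0 := by
        refine Finset.sum_congr rfl fun i _ ↦ ?_
        by_cases hi : ‖X i - x‖ ≤ r <;> simp [hi, dist_eq_norm]
    _ ≤ k := by exact_mod_cast hX.le

lemma LowerRegular.measureReal_lt_knnRadius_le (hc : LowerRegular 𝒳 P c) (hk : 1 ≤ k)
    (hkn : k ≤ n) (h𝒳 : Bornology.IsBounded 𝒳) (hP : P 𝒳ᶜ = 0) (hx : x ∈ 𝒳) {r : ℝ}
    (hr : 0 ≤ r) : (Measure.pi fun _ : Fin n ↦ P).real {X | r < knnRadius k X x} ≤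
      Real.exp 1 * Real.exp (-(c * n / (2 * k) * r ^ d)) := by
  rcases le_or_gt r (Metric.diam 𝒳) with hr_diam | hr_diam
  · refine (measureReal_lt_knnRadius_le_closedBall hk hkn x r).trans ?_
    gcongr
    calc c * n / (2 * k) * r ^ d = n * (c * r ^ d) / (2 * k) := by ring
      _ ≤ _ := by gcongr; exact hc x hx r hr hr_diam
  · have measure_eq_zero : (Measure.pi fun _ : Fin n ↦ P) {X | r < knnRadius k X x} = 0 :=
      measure_mono_null (fun X hX hX𝒳 ↦ (hr_diam.trans hX).not_ge
        (knnRadius_le_diam hk hkn h𝒳 hX𝒳 hx)) (ae_pi_forall_mem hP)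
    rw [Measure.real, measure_eq_zero, ENNReal.toReal_zero]
    positivity

theorem LowerRegular.integral_exp_knnRadius_le (hc : LowerRegular 𝒳 P c) (hc0 : 0 < c)
    (hd : 1 ≤ d) (hk : 1 ≤ k) (hkn : k ≤ n) (h𝒳 : Bornology.IsBounded 𝒳) (hP : P 𝒳ᶜ = 0)
    (hx : x ∈ 𝒳) :
    Integrable (fun X ↦ Real.exp (c * n / (4 * k) * knnRadius k X x ^ d))
        (Measure.pi fun _ : Fin n ↦ P) ∧
      ∫ X, Real.exp (c * n / (4 * k) * knnRadius k X x ^ d) ∂(Measure.pi fun _ : Fin n ↦ P) ≤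
        1 + Real.exp 1 := by
  have : (0 : ℝ) < k := by exact_mod_cast hk
  have : (0 : ℝ) < n := by exact_mod_cast hk.trans hkn
  set lam := c * n / (4 * k) with hlam
  have hlam0 : 0 < lam := by positivity
  refine integral_exp_le_of_measureReal_lt_le
    (((measurable_knnRadius_left hk hkn x).pow_const d).const_mul lam).aemeasurable
    (Real.exp_pos 1).le fun t ht ↦ ?_
  set r := (t / lam) ^ (d : ℝ)⁻¹
  have hrd : r ^ d = t / lam := Real.rpow_inv_natCast_pow (by positivity) (by lia)
  calc (Measure.pi fun _ : Fin n ↦ P).real {X | t < lam * knnRadius k X x ^ d}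
      ≤ (Measure.pi fun _ : Fin n ↦ P).real {X | r < knnRadius k X x} := by
        refine measureReal_mono fun X hX ↦ ?_
        rw [mem_ofPred_eq, mul_comm, ← div_lt_iff₀ hlam0, ← hrd] at hX
        exact lt_of_pow_lt_pow_left₀ d (knnRadius_nonneg hk hkn X x) hX
    _ ≤ Real.exp 1 * Real.exp (-(c * n / (2 * k) * r ^ d)) :=
        hc.measureReal_lt_knnRadius_le hk hkn h𝒳 hP hx (by positivity)
    _ = Real.exp 1 * Real.exp (-(2 * t)) := by
        rw [hrd, hlam]
        congr 2
        field_simp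
        ring

end ExponentialMoments

section PowExp

variable {d : ℕ}

lemma pow_le_factorial_mul_exp (hd : 1 ≤ d) (s : ℕ) {v : ℝ} (hv : 0 ≤ v) :
    v ^ s ≤ (s.factorial * 2 ^ s : ℝ) * Real.exp (v ^ d / 2) := by
  rcases le_total v 1 with hv1 | hv1
  · have one_le_factorial : (1 : ℝ) ≤ s.factorial := by exact_mod_cast s.factorial_pos
    have one_le_two_pow : (1 : ℝ) ≤ 2 ^ s := one_le_pow₀ one_le_two
    have one_le_exp : 1 ≤ Real.exp (v ^ d / 2) := Real.one_le_exp (by positivity)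
    calc v ^ s ≤ 1 := pow_le_one₀ hv hv1
      _ ≤ _ := one_le_mul_of_one_le_of_one_le
        (one_le_mul_of_one_le_of_one_le one_le_factorial one_le_two_pow) one_le_exp
  · calc v ^ s ≤ (v ^ d) ^ s := by gcongr; exact le_self_pow₀ hv1 (by lia)
      _ = (s.factorial * 2 ^ s) * ((v ^ d / 2) ^ s / s.factorial) := by
          rw [div_pow]
          field_simp
      _ ≤ _ := by
          gcongr
          exact Real.pow_div_factorial_le_exp _ (by positivity) s

lemma pow_le_mul_exp (hd : 1 ≤ d) (s : ℕ) {lam ε T : ℝ} (hε : 0 < ε) (hlam : lam * ε ^ d = 1)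
    (hT : 0 ≤ T) : T ^ s ≤ (s.factorial * 2 ^ s : ℝ) * ε ^ s * Real.exp (lam * T ^ d / 2) := by
  have hlam : lam = 1 / ε ^ d := eq_one_div_of_mul_eq_one_left hlam
  calc T ^ s = ε ^ s * (T / ε) ^ s := by rw [div_pow]; field_simp
    _ ≤ ε ^ s * ((s.factorial * 2 ^ s : ℝ) * Real.exp ((T / ε) ^ d / 2)) := by
        gcongr
        exact pow_le_factorial_mul_exp hd s (by positivity)
    _ = _ := by rw [hlam, div_pow]; ring_nf

lemma ite_pow_le_mul_exp (hd : 1 ≤ d) (s : ℕ) {lam ε T δ : ℝ} (hlam0 : 0 ≤ lam) (hε : 0 < ε)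
    (hlam : lam * ε ^ d = 1) (hT : 0 ≤ T) (hδ : 0 ≤ δ) :
    (if δ ≤ T then T ^ s else 0) ≤ (s.factorial * 2 ^ s : ℝ) * ε ^ s *
      Real.exp (-(lam / 2) * δ ^ d) * Real.exp (lam * T ^ d) := by
  split_ifs with hδT
  · refine (pow_le_mul_exp hd s hε hlam hT).trans ?_
    rw [mul_assoc _ (Real.exp _), ← Real.exp_add]
    gcongr
    have : lam * δ ^ d ≤ lam * T ^ d := by gcongr
    linarith
  · positivity

lemma pow_add_ite_pow_le_mul_exp (hd : 1 ≤ d) {lam ε R T δ : ℝ} (hε : 0 < ε)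
    (hlam : lam * ε ^ d = 1) (hR : 0 ≤ R) (hRT : R ≤ T) (hδ : 0 ≤ δ) :
    R ^ (d + 2) + (if δ ≤ R then R ^ (d + 1) else 0) ≤
      ((d + 2).factorial * 2 ^ (d + 2) : ℝ) *
        (ε ^ (d + 2) + ε ^ (d + 1) * Real.exp (-(lam / 2) * δ ^ d)) * Real.exp (lam * T ^ d) := by
  have hlam0 : 0 ≤ lam := (pos_of_mul_pos_left (by rw [hlam]; exact one_pos) (by positivity)).le
  have factorial_le : ((d + 1).factorial * 2 ^ (d + 1) : ℝ) ≤ (d + 2).factorial * 2 ^ (d + 2) := by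
    gcongr <;> norm_num
  calc R ^ (d + 2) + (if δ ≤ R then R ^ (d + 1) else 0)
      ≤ ((d + 2).factorial * 2 ^ (d + 2) : ℝ) * ε ^ (d + 2) * Real.exp (lam * R ^ d) +
        ((d + 1).factorial * 2 ^ (d + 1) : ℝ) * ε ^ (d + 1) * Real.exp (-(lam / 2) * δ ^ d) *
          Real.exp (lam * R ^ d) := by
        gcongr
        · refine (pow_le_mul_exp hd _ hε hlam hR).trans ?_
          gcongr
          exact half_le_self (by positivity)
        · exact ite_pow_le_mul_exp hd _ hlam0 hε hlam hR hδ
    _ ≤ ((d + 2).factorial * 2 ^ (d + 2) : ℝ) * ε ^ (d + 2) * Real.exp (lam * T ^ d) +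
        ((d + 2).factorial * 2 ^ (d + 2) : ℝ) * ε ^ (d + 1) * Real.exp (-(lam / 2) * δ ^ d) *
          Real.exp (lam * T ^ d) := by gcongr
    _ = _ := by ring

end PowExp

section LocalAverages

lemma setIntegral_closedBall_map_sub_center {F G : Type*} [NormedAddCommGroup F]
    [MeasurableSpace F] [BorelSpace F] [NormedSpace ℝ F] [NormedAddCommGroup G] [NormedSpace ℝ G]
    (μ : Measure F) [μ.IsAddLeftInvariant] [μ.IsNegInvariant] (A : F →L[ℝ] G) (x : F) (r : ℝ) :
    ∫ y in Metric.closedBall x r, A (y - x) ∂μ = 0 := by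
  rw [← integral_indicator measurableSet_closedBall]
  set I : F → G := (Metric.closedBall x r).indicator fun y ↦ A (y - x) with hI
  have reflect_sub (y : F) : x + x - y - x = -(y - x) := by abel
  have I_reflect (y : F) : I (x + x - y) = -I y := by
    have mem_iff : x + x - y ∈ Metric.closedBall x r ↔ y ∈ Metric.closedBall x r := by
      rw [Metric.mem_closedBall, Metric.mem_closedBall, dist_eq_norm, dist_eq_norm, reflect_sub,
        norm_neg]
    by_cases hy : y ∈ Metric.closedBall x r
    · simp only [hI, indicator_of_mem hy, indicator_of_mem (mem_iff.2 hy), reflect_sub, map_neg]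
    · simp only [hI, indicator_of_notMem hy, indicator_of_notMem (mem_iff.not.2 hy), neg_zero]
  have integral_reflect : ∫ y, I (x + x - y) ∂μ = ∫ y, I y ∂μ :=
    integral_sub_left_eq_self I μ _
  simp only [I_reflect, integral_neg] at integral_reflect
  have : IsAddTorsionFree G := .of_isTorsionFree ℝ G
  exact self_eq_neg.1 integral_reflect.symm

lemma closedBall_subset_of_lt_infDist_compl {α : Type*} [PseudoMetricSpace α] {s : Set α} {x : α}
    {r : ℝ} (hr : r < Metric.infDist x sᶜ) : Metric.closedBall x r ⊆ s := by
  intro y hy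
  by_contra hys
  exact (hr.trans_le (Metric.infDist_le_dist_of_mem hys)).not_ge (Metric.mem_closedBall'.1 hy)

variable {d : ℕ} {𝒳 : Set (E d)} {P : Measure (E d)} {x : E d} {r C M : ℝ}

lemma abs_setIntegral_closedBall_le [IsFiniteMeasure P] (hP : P 𝒳ᶜ = 0) (hM : 0 ≤ M)
    (hC : P.real (Metric.closedBall x r) ≤ C * r ^ d) {φ : E d → ℝ} {s : ℕ}
    (hφ : ∀ u ∈ 𝒳, |φ u| ≤ M * ‖u - x‖ ^ s) (hr : 0 ≤ r) :
    |∫ y in Metric.closedBall x r, φ y ∂P| ≤ M * C * r ^ (d + s) := by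
  have ae_abs_le : ∀ᵐ y ∂P.restrict (Metric.closedBall x r), ‖φ y‖ ≤ M * r ^ s := by
    filter_upwards [ae_restrict_mem measurableSet_closedBall,
      ae_restrict_of_ae (show ∀ᵐ y ∂P, y ∈ 𝒳 from hP)] with y hy hy𝒳
    rw [Metric.mem_closedBall, dist_eq_norm] at hy
    exact (hφ y hy𝒳).trans (by gcongr)
  calc |∫ y in Metric.closedBall x r, φ y ∂P|
      ≤ M * r ^ s * P.real (Metric.closedBall x r) :=
        norm_setIntegral_le_of_norm_le_const_ae (measure_lt_top _ _) ae_abs_le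
    _ ≤ M * r ^ s * (C * r ^ d) := by gcongr
    _ = _ := by ring

/-- By symmetry of the ball, `p` may be replaced by `p - p x` in `∫ A (y - x) p(y) dy`, which gains
a factor `r`. -/
lemma abs_setIntegral_closedBall_map_sub_center_le {p : E d → ℝ} (hp : IsDensity P p) {K : NNReal}
    (hK : LipschitzOnWith K p 𝒳) {A : E d →L[ℝ] ℝ} (hA : ‖A‖ ≤ M) (hr : 0 ≤ r)
    (hball : Metric.closedBall x r ⊆ 𝒳) :
    |∫ y in Metric.closedBall x r, A (y - x) ∂P| ≤
      M * (K * volume.real (Metric.ball (0 : E d) 1)) * r ^ (d + 2) := by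
  have hcompact : IsCompact (Metric.closedBall x r) := isCompact_closedBall x r
  have hA_cont : ContinuousOn (fun y ↦ A (y - x)) (Metric.closedBall x r) := by fun_prop
  have hp_cont : ContinuousOn p (Metric.closedBall x r) := (hK.mono hball).continuousOn
  have integral_eq : ∫ y in Metric.closedBall x r, A (y - x) ∂P =
      ∫ y in Metric.closedBall x r, (p y - p x) * A (y - x) := by
    have integral_density : ∫ y in Metric.closedBall x r, A (y - x) ∂P =
        ∫ y in Metric.closedBall x r, p y * A (y - x) := by
      conv_lhs => rw [hp.eq]
      rw [setIntegral_withDensity_eq_setIntegral_toReal_smul hp.measurable.ennreal_ofReal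
        (.of_forall fun _ ↦ ENNReal.ofReal_lt_top) _ measurableSet_closedBall]
      simp only [ENNReal.toReal_ofReal (hp.nonneg _), smul_eq_mul]
    simp only [sub_mul]
    have integrable_pA : IntegrableOn (fun y ↦ p y * A (y - x)) (Metric.closedBall x r) :=
      (hp_cont.mul hA_cont).integrableOn_compact hcompact
    rw [integral_sub integrable_pA ((hA_cont.integrableOn_compact hcompact).const_mul _),
      integral_const_mul, setIntegral_closedBall_map_sub_center volume, mul_zero, sub_zero,
      integral_density]
  have norm_le (y : E d) (hy : y ∈ Metric.closedBall x r) :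
      ‖(p y - p x) * A (y - x)‖ ≤ K * r * (M * r) := by
    rw [norm_mul]
    refine mul_le_mul ?_ ?_ (norm_nonneg _) (by positivity)
    · rw [← dist_eq_norm]
      exact (hK.dist_le_mul y (hball hy) x (hball (Metric.mem_closedBall_self hr))).trans
        (by gcongr; exact hy)
    · exact A.le_of_opNorm_le_of_le hA (by rwa [← dist_eq_norm])
  calc |∫ y in Metric.closedBall x r, A (y - x) ∂P|
      ≤ K * r * (M * r) * volume.real (Metric.closedBall x r) := by
        rw [integral_eq]
        exact norm_setIntegral_le_of_norm_le_const measure_closedBall_lt_top norm_le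
    _ = _ := by rw [measureReal_closedBall_eq x hr]; ring

end LocalAverages

section LocalIncrements

variable {d : ℕ} {𝒳 : Set (E d)} {M : ℝ} {Φ : E d → E d → ℝ}

/-- `Φ x u` is a function of `u` vanishing to first order at `x` and differentiable there, with
constants uniform in `x ∈ 𝒳`: the common form of the increments `u ↦ Δ(x,u) - Δ(x,x)` and
`u ↦ g(u) - g(x)`. It is extended by zero off `𝒳 × 𝒳`. -/
structure IsLocalIncrement (𝒳 : Set (E d)) (M : ℝ) (Φ : E d → E d → ℝ) : Prop where
  measurable : Measurable (Function.uncurry Φ)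
  eq_zero : ∀ x u, ¬(x ∈ 𝒳 ∧ u ∈ 𝒳) → Φ x u = 0
  abs_le : ∀ x ∈ 𝒳, ∀ u ∈ 𝒳, |Φ x u| ≤ M * ‖u - x‖
  taylor : ∀ x ∈ 𝒳, ∃ A : E d →L[ℝ] ℝ, ‖A‖ ≤ M ∧
    ∀ u ∈ 𝒳, |Φ x u - A (u - x)| ≤ M * ‖u - x‖ ^ 2

lemma IsLocalIncrement.nonneg (hΦ : IsLocalIncrement 𝒳 M Φ) {x : E d} (hx : x ∈ 𝒳) : 0 ≤ M :=
  let ⟨_, hA, _⟩ := hΦ.taylor x hx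
  (norm_nonneg _).trans hA

lemma IsLocalIncrement.abs_le_diam (hΦ : IsLocalIncrement 𝒳 M Φ) (hM : 0 ≤ M)
    (h𝒳 : Bornology.IsBounded 𝒳) (x u : E d) : |Φ x u| ≤ M * Metric.diam 𝒳 := by
  by_cases h : x ∈ 𝒳 ∧ u ∈ 𝒳
  · refine (hΦ.abs_le x h.1 u h.2).trans ?_
    rw [← dist_eq_norm]
    gcongr
    exact Metric.dist_le_diam_of_mem h𝒳 h.2 h.1
  · rw [hΦ.eq_zero x u h, abs_zero]
    exact mul_nonneg hM Metric.diam_nonneg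

theorem IsLocalIncrement.abs_setIntegral_closedBall_le {P : Measure (E d)} [IsFiniteMeasure P]
    {p : E d → ℝ} (hΦ : IsLocalIncrement 𝒳 M Φ) (hp : IsDensity P p)
    (h𝒳 : Bornology.IsBounded 𝒳) (hP : P 𝒳ᶜ = 0) {K : NNReal} (hK : LipschitzOnWith K p 𝒳)
    {C : ℝ} (hC0 : 0 ≤ C) {x : E d} (hx : x ∈ 𝒳) {r : ℝ}
    (hC : P.real (Metric.closedBall x r) ≤ C * r ^ d) (hr : 0 ≤ r) :
    |∫ y in Metric.closedBall x r, Φ x y ∂P| ≤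
      M * (C + K * volume.real (Metric.ball (0 : E d) 1)) *
        (r ^ (d + 2) + if Metric.infDist x 𝒳ᶜ ≤ r then r ^ (d + 1) else 0) := by
  have hM := hΦ.nonneg hx
  rcases lt_or_ge r (Metric.infDist x 𝒳ᶜ) with hlt | hge
  · obtain ⟨A, hA, htaylor⟩ := hΦ.taylor x hx
    have integrable_Φ : IntegrableOn (Φ x) (Metric.closedBall x r) P :=
      Integrable.of_bound (hΦ.measurable.comp measurable_prodMk_left).aestronglyMeasurable
        (M * Metric.diam 𝒳) (.of_forall (hΦ.abs_le_diam hM h𝒳 x))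
    have integrable_A : IntegrableOn (fun y ↦ A (y - x)) (Metric.closedBall x r) P :=
      ContinuousOn.integrableOn_compact (isCompact_closedBall x r) (by fun_prop)
    have integral_split : ∫ y in Metric.closedBall x r, Φ x y ∂P =
        (∫ y in Metric.closedBall x r, (Φ x y - A (y - x)) ∂P) +
          ∫ y in Metric.closedBall x r, A (y - x) ∂P := by
      rw [integral_sub integrable_Φ integrable_A, sub_add_cancel]
    rw [if_neg hlt.not_ge, add_zero, integral_split]
    calc |_ + _| ≤ _ := abs_add_le _ _
      _ ≤ _ := add_le_add (Matching.abs_setIntegral_closedBall_le hP hM hC htaylor hr)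
        (abs_setIntegral_closedBall_map_sub_center_le hp hK hA hr
          (closedBall_subset_of_lt_infDist_compl hlt))
      _ = _ := by ring
  · rw [if_pos hge]
    refine (Matching.abs_setIntegral_closedBall_le hP hM hC (s := 1)
      (by simpa using hΦ.abs_le x hx) hr).trans ?_
    gcongr
    · exact le_add_of_nonneg_right (by positivity)
    · exact le_add_of_nonneg_left (by positivity)

end LocalIncrements

section NearestNeighbourSums

variable {ι : Type*} {d k : ℕ} {s : Finset ι} {Φ : E d → E d → ℝ} {D : ℝ}

/-- The sum of `Φ x (X i)` over the `k` nearest neighbours `X i`, `i ∈ s`, of `x`. The index set `s`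
is kept as a parameter so that one sample point can be left out. -/
def nnSum (s : Finset ι) (k : ℕ) (Φ : E d → E d → ℝ) (X : ι → E d) (x : E d) : ℝ :=
  ∑ i ∈ s with ‖X i - x‖ ≤ ordStat s k (fun j ↦ ‖X j - x‖), Φ x (X i)

/-- The nearest neighbour average of `Φ x (X i)`, averaged over `x ∼ Q`. For a suitable increment
`Φ` this is the conditional bias of either estimator. -/
def nnBias (s : Finset ι) (k : ℕ) (Q : Measure (E d)) (Φ : E d → E d → ℝ) (X : ι → E d) : ℝ :=
  ∫ x, (k : ℝ)⁻¹ * nnSum s k Φ X x ∂Q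

lemma measurable_nnSum (hk : 1 ≤ k) (hks : k ≤ s.card) (hΦ : Measurable (Function.uncurry Φ)) :
    Measurable fun z : (ι → E d) × E d ↦ nnSum s k Φ z.1 z.2 := by
  simp only [nnSum, Finset.sum_filter]
  refine Finset.measurable_fun_sum _ fun i _ ↦ Measurable.ite ?_ ?_ measurable_const
  · exact measurableSet_le (by fun_prop) (measurable_ordStat hk hks fun i ↦ by fun_prop)
  · exact hΦ.comp (by fun_prop : Measurable fun z : (ι → E d) × E d ↦ (z.2, z.1 i))

lemma abs_nnSum_le (hΦ : ∀ x u, |Φ x u| ≤ D) (X : ι → E d) (x : E d) :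
    |nnSum s k Φ X x| ≤ s.card * D := by
  have : 0 ≤ D := (abs_nonneg _).trans (hΦ x x)
  calc |nnSum s k Φ X x|
      ≤ ∑ i ∈ s with ‖X i - x‖ ≤ ordStat s k (fun j ↦ ‖X j - x‖), |Φ x (X i)| :=
        Finset.abs_sum_le_sum_abs _ _
    _ ≤ Finset.card {i ∈ s | ‖X i - x‖ ≤ ordStat s k (fun j ↦ ‖X j - x‖)} * D := by
        rw [← nsmul_eq_mul]
        exact Finset.sum_le_card_nsmul _ _ D fun i _ ↦ hΦ _ _
    _ ≤ s.card * D := by gcongr; exact Finset.filter_subset _ _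

lemma measurable_nnBias (hk : 1 ≤ k) (hks : k ≤ s.card) (hΦ : Measurable (Function.uncurry Φ))
    (Q : Measure (E d)) [SFinite Q] : Measurable (nnBias s k Q Φ) :=
  ((measurable_nnSum hk hks hΦ).const_mul
    (k : ℝ)⁻¹).stronglyMeasurable.integral_prod_right.measurable

lemma abs_nnBias_le (hΦ : ∀ x u, |Φ x u| ≤ D) (Q : Measure (E d)) [IsProbabilityMeasure Q]
    (X : ι → E d) : |nnBias s k Q Φ X| ≤ (k : ℝ)⁻¹ * (s.card * D) := by
  rw [nnBias, integral_const_mul, abs_mul, abs_of_nonneg (by positivity)]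
  gcongr
  simpa using norm_integral_le_of_norm_le_const (μ := Q) (f := nnSum s k Φ X)
    (.of_forall (abs_nnSum_le hΦ X))

lemma memLp_nnBias {ν : Measure (ι → E d)} [IsFiniteMeasure ν] (hk : 1 ≤ k) (hks : k ≤ s.card)
    (hΦm : Measurable (Function.uncurry Φ)) (hΦ : ∀ x u, |Φ x u| ≤ D) (Q : Measure (E d))
    [IsProbabilityMeasure Q] (q : ℝ≥0∞) : MemLp (nnBias s k Q Φ) q ν :=
  .of_bound (measurable_nnBias hk hks hΦm Q).aestronglyMeasurable _
    (.of_forall (abs_nnBias_le hΦ Q))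

lemma nnSum_update_of_notMem [DecidableEq ι] {i : ι} (hi : i ∉ s) (X : ι → E d) (y x : E d) :
    nnSum s k Φ (Function.update X i y) x = nnSum s k Φ X x := by
  have update_eq (j : ι) (hj : j ∈ s) : Function.update X i y j = X j :=
    Function.update_of_ne (ne_of_mem_of_not_mem hj hi) _ _
  simp only [nnSum, Finset.sum_filter]
  rw [ordStat_congr fun j hj ↦ by rw [update_eq j hj]]
  exact Finset.sum_congr rfl fun j hj ↦ by rw [update_eq j hj]

lemma nnBias_update_of_notMem [DecidableEq ι] {i : ι} (hi : i ∉ s) (Q : Measure (E d))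
    (X : ι → E d) (y : E d) : nnBias s k Q Φ (Function.update X i y) = nnBias s k Q Φ X := by
  simp only [nnBias, nnSum_update_of_notMem hi]

end NearestNeighbourSums

section Ties

variable {ι F : Type*} [Fintype ι] [NormedAddCommGroup F] [MeasurableSpace F] [BorelSpace F]
  [SecondCountableTopology F] {P : Measure F} [IsProbabilityMeasure P]

lemma ae_pi_norm_sub_ne_norm_sub (hP : ∀ x r, P (Metric.sphere x r) = 0) {i j : ι} (hij : i ≠ j)
    (x : F) : ∀ᵐ X ∂(Measure.pi fun _ : ι ↦ P), ‖X i - x‖ ≠ ‖X j - x‖ := by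
  classical
  have hmp := measurePreserving_update (fun _ : ι ↦ P) i
  have hmeas : MeasurableSet {X : ι → F | ‖X i - x‖ ≠ ‖X j - x‖} :=
    (measurableSet_eq_fun (by fun_prop) (by fun_prop)).compl
  rw [← hmp.map_eq, ae_map_iff hmp.aemeasurable hmeas]
  refine (Measure.ae_prod_iff_ae_ae (hmp.measurable hmeas)).2 (.of_forall fun X ↦
    measure_mono_null (fun y hy ↦ ?_) (hP x ‖X j - x‖))
  simpa [Function.update_of_ne hij.symm] using hy

lemma ae_pi_ae_injective_norm_sub (hP : ∀ x r, P (Metric.sphere x r) = 0) (Q : Measure F)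
    [SFinite Q] : ∀ᵐ X ∂(Measure.pi fun _ : ι ↦ P), ∀ᵐ x ∂Q,
      Function.Injective fun i ↦ ‖X i - x‖ := by
  have ae_ae_ne (i j : ι) : ∀ᵐ X ∂(Measure.pi fun _ : ι ↦ P), ∀ᵐ x ∂Q,
      i ≠ j → ‖X i - x‖ ≠ ‖X j - x‖ := by
    by_cases hij : i = j
    · simp [hij]
    · simp only [ne_eq, hij, not_false_eq_true, true_imp_iff]
      refine (Measure.ae_ae_comm ?_).2 (.of_forall fun x ↦ ae_pi_norm_sub_ne_norm_sub hP hij x)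
      exact (measurableSet_eq_fun (by fun_prop) (by fun_prop)).compl
  filter_upwards [ae_all_iff.2 fun i ↦ ae_all_iff.2 (ae_ae_ne i)] with X hX
  filter_upwards [ae_all_iff.2 fun i ↦ ae_all_iff.2 (hX i)] with x hx i j hij
  exact not_not.1 fun hne ↦ hx i j hne hij

lemma IsDensity.measure_sphere_eq_zero {d : ℕ} (hd : 1 ≤ d) {P : Measure (E d)} {p : E d → ℝ}
    (hp : IsDensity P p) (x : E d) (r : ℝ) : P (Metric.sphere x r) = 0 := by
  have : NeZero d := ⟨by lia⟩
  rw [hp.eq]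
  exact withDensity_absolutelyContinuous _ _ (Measure.addHaar_sphere volume x r)

end Ties

section BoundaryWeight

variable {d : ℕ} {𝒳 : Set (E d)} {lam : ℝ}

/-- The weight `exp (-(λ/2) δ(x)^d)`, with `δ(x)` the distance from `x` to `𝒳ᶜ`: up to constants,
a bound for the probability that a nearest neighbour ball around `x` meets `𝒳ᶜ`, when its radius is
of order `λ^(-1/d)`. -/
def boundaryWeight (𝒳 : Set (E d)) (lam : ℝ) (x : E d) : ℝ :=
  Real.exp (-(lam / 2) * Metric.infDist x 𝒳ᶜ ^ d)

lemma integrable_boundaryWeight (hlam : 0 ≤ lam) {Q : Measure (E d)} [IsFiniteMeasure Q] :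
    Integrable (boundaryWeight 𝒳 lam) Q := by
  refine .of_bound (Measurable.aestronglyMeasurable ?_) 1 (.of_forall fun x ↦ ?_)
  · exact Real.measurable_exp.comp
      ((Metric.continuous_infDist_pt _).measurable.pow_const d |>.const_mul _)
  · have : 0 ≤ Metric.infDist x 𝒳ᶜ := Metric.infDist_nonneg
    rw [boundaryWeight, Real.norm_of_nonneg (Real.exp_pos _).le, Real.exp_le_one_iff, neg_mul]
    exact neg_nonpos.2 (by positivity)

lemma GeomCondition.exists_integral_boundaryWeight_le (hd : 1 ≤ d) {Q : Measure (E d)}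
    (hQ : Q 𝒳ᶜ = 0) (hA : GeomCondition 𝒳 Q) :
    ∃ M : ℝ, 0 ≤ M ∧ ∀ lam ε : ℝ, 0 < ε → lam * ε ^ d = 1 →
      ∫ x, boundaryWeight 𝒳 lam x ∂Q ≤ M * ε := by
  obtain ⟨M, hM⟩ := hA
  rw [Measure.restrict_eq_self_of_ae_mem (show ∀ᵐ x ∂Q, x ∈ 𝒳 from hQ)] at hM
  have hM0 : 0 ≤ M := le_trans (mul_nonneg (by positivity)
    (integral_nonneg fun x ↦ (Real.exp_pos _).le)) (hM 1 one_pos)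
  refine ⟨M * 2, by positivity, fun lam ε hε hlam ↦ ?_⟩
  have hlam0 : 0 < lam := pos_of_mul_pos_left (by rw [hlam]; exact one_pos) (by positivity)
  have weight_nonneg : 0 ≤ ∫ x, boundaryWeight 𝒳 lam x ∂Q :=
    integral_nonneg fun x ↦ (Real.exp_pos _).le
  have inv_le_rpow : (2 * ε)⁻¹ ≤ (lam / 2) ^ (1 / (d : ℝ)) := by
    rw [one_div, Real.le_rpow_inv_iff_of_pos (by positivity) (by positivity)
      (by exact_mod_cast hd), Real.rpow_natCast, inv_pow, mul_pow,
      inv_le_iff_one_le_mul₀ (by positivity)]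
    have : (2 : ℝ) ≤ 2 ^ d := le_self_pow₀ one_le_two (by lia)
    calc (1 : ℝ) ≤ 2 ^ d / 2 * (lam * ε ^ d) := by rw [hlam]; linarith
      _ = _ := by ring
  have := (mul_le_mul_of_nonneg_right inv_le_rpow weight_nonneg).trans (hM _ (half_pos hlam0))
  rw [inv_mul_le_iff₀ (by positivity)] at this
  linarith

end BoundaryWeight

section MeanOfNearestNeighbourBias

variable {d n k : ℕ} {𝒳 : Set (E d)} {P : Measure (E d)} [IsProbabilityMeasure P] {x : E d}
  {c lam ε : ℝ}

lemma le_card_univ_erase (hkn : k + 1 ≤ n) (i : Fin n) : k ≤ (Finset.univ.erase i).card := by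
  rw [Finset.card_erase_of_mem (Finset.mem_univ i), Finset.card_fin]
  lia

/-- `X i` is among the `k` nearest neighbours iff it lies in the `k`-nearest neighbour ball of the
remaining points, whose radius is independent of `X i`. -/
lemma integral_ite_le_ordStat_eq (hk : 1 ≤ k) (hkn : k + 1 ≤ n) {φ : E d → ℝ}
    (hφ : Measurable φ) {D : ℝ} (hD : ∀ u, |φ u| ≤ D) (x : E d) (i : Fin n) :
    ∫ X, (if ‖X i - x‖ ≤ ordStat Finset.univ k (fun j ↦ ‖X j - x‖) then φ (X i) else 0)
        ∂(Measure.pi fun _ : Fin n ↦ P) =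
      ∫ X, ∫ y in Metric.closedBall x (ordStat (Finset.univ.erase i) k fun j ↦ ‖X j - x‖), φ y ∂P
        ∂(Measure.pi fun _ : Fin n ↦ P) := by
  set R : (Fin n → E d) → ℝ := fun X ↦ ordStat (Finset.univ.erase i) k fun j ↦ ‖X j - x‖
  have le_iff (X : Fin n → E d) :
      ‖X i - x‖ ≤ ordStat Finset.univ k (fun j ↦ ‖X j - x‖) ↔ X i ∈ Metric.closedBall x (R X) := by
    rw [mem_closedBall_iff_norm]
    exact le_ordStat_iff_le_ordStat_erase (a := fun j ↦ ‖X j - x‖) hk (Finset.mem_univ i)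
      (by simpa using hkn)
  have R_update (X : Fin n → E d) (y : E d) : R (Function.update X i y) = R X :=
    ordStat_congr fun j hj ↦ by rw [Function.update_of_ne (Finset.ne_of_mem_erase hj)]
  set F : (Fin n → E d) → ℝ := fun X ↦ (Metric.closedBall x (R X)).indicator φ (X i) with hF
  have measurable_F : Measurable F := by
    have hRm : Measurable R := measurable_ordStat hk (le_card_univ_erase hkn i) fun i ↦ by fun_prop
    have hball : MeasurableSet {X : Fin n → E d | X i ∈ Metric.closedBall x (R X)} :=
      measurableSet_le (by fun_prop) hRm
    exact (hφ.comp (measurable_pi_apply i)).indicator hball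
  have hmp := measurePreserving_update (fun _ : Fin n ↦ P) i
  have integrable_F : Integrable (fun z : (Fin n → E d) × E d ↦ F (Function.update z.1 i z.2))
      ((Measure.pi fun _ : Fin n ↦ P).prod P) :=
    .of_bound (measurable_F.comp hmp.measurable).aestronglyMeasurable D (.of_forall fun z ↦
      (norm_indicator_le_norm_self _ _).trans (hD _))
  calc _ = ∫ X, F X ∂(Measure.pi fun _ : Fin n ↦ P) := by
        congr with X
        by_cases h : X i ∈ Metric.closedBall x (R X)
        · simp only [hF, if_pos ((le_iff X).2 h), indicator_of_mem h]
        · simp only [hF, if_neg (mt (le_iff X).1 h), indicator_of_notMem h]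
    _ = ∫ X, ∫ y, F (Function.update X i y) ∂P ∂(Measure.pi fun _ : Fin n ↦ P) := by
        rw [← integral_prod _ integrable_F, ← hmp.map_eq,
          integral_map hmp.aemeasurable measurable_F.aestronglyMeasurable, hmp.map_eq]
    _ = ∫ X, ∫ y in Metric.closedBall x (R X), φ y ∂P ∂(Measure.pi fun _ : Fin n ↦ P) := by
        simp only [hF, R_update, Function.update_self, integral_indicator measurableSet_closedBall]

lemma LowerRegular.integral_knnRadius_pow_le (hc : LowerRegular 𝒳 P c) (hc0 : 0 < c) (hd : 1 ≤ d)
    (hk : 1 ≤ k) (hkn : k ≤ n) (h𝒳 : Bornology.IsBounded 𝒳) (hP : P 𝒳ᶜ = 0) (hx : x ∈ 𝒳)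
    (hε : 0 < ε) (hcε : c * n / (4 * k) * ε ^ d = 1) (s : ℕ) :
    ∫ X, knnRadius k X x ^ s ∂(Measure.pi fun _ : Fin n ↦ P) ≤
      (s.factorial * 2 ^ s : ℝ) * ε ^ s * (1 + Real.exp 1) := by
  obtain ⟨integrable_exp, integral_exp_le⟩ :=
    hc.integral_exp_knnRadius_le hc0 hd hk hkn h𝒳 hP hx
  have pow_le (X : Fin n → E d) : knnRadius k X x ^ s ≤ (s.factorial * 2 ^ s : ℝ) * ε ^ s *
      Real.exp (c * n / (4 * k) * knnRadius k X x ^ d) := by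
    have := knnRadius_nonneg hk hkn X x
    refine (pow_le_mul_exp hd s hε hcε this).trans ?_
    gcongr
    exact half_le_self (by positivity)
  refine (integral_mono_of_nonneg (.of_forall fun X ↦ pow_nonneg (knnRadius_nonneg hk hkn X x) s)
    (integrable_exp.const_mul _) (.of_forall pow_le)).trans ?_
  rw [integral_const_mul]
  gcongr

lemma LowerRegular.abs_integral_ite_le_ordStat_le (hc : LowerRegular 𝒳 P c) (hc0 : 0 < c)
    (hd : 1 ≤ d) (hk : 1 ≤ k) (hkn : k + 1 ≤ n) (h𝒳 : Bornology.IsBounded 𝒳) (hP : P 𝒳ᶜ = 0)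
    (hx : x ∈ 𝒳) (hlam : lam = c * n / (4 * (k + 1 : ℕ))) (hε : 0 < ε) (hlamε : lam * ε ^ d = 1)
    {φ : E d → ℝ} (hφ : Measurable φ) {D : ℝ} (hD : ∀ u, |φ u| ≤ D) {C : ℝ} (hC : 0 ≤ C)
    (hball : ∀ r, 0 ≤ r → |∫ y in Metric.closedBall x r, φ y ∂P| ≤
      C * (r ^ (d + 2) + if Metric.infDist x 𝒳ᶜ ≤ r then r ^ (d + 1) else 0)) (i : Fin n) :
    |∫ X, (if ‖X i - x‖ ≤ ordStat Finset.univ k (fun j ↦ ‖X j - x‖) then φ (X i) else 0)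
        ∂(Measure.pi fun _ : Fin n ↦ P)| ≤
      C * ((d + 2).factorial * 2 ^ (d + 2) : ℝ) * (1 + Real.exp 1) *
        (ε ^ (d + 2) + ε ^ (d + 1) * boundaryWeight 𝒳 lam x) := by
  obtain ⟨integrable_exp, integral_exp_le⟩ :=
    hc.integral_exp_knnRadius_le hc0 hd (by lia : 1 ≤ k + 1) hkn h𝒳 hP hx
  rw [← hlam] at integrable_exp integral_exp_le
  have : 0 ≤ boundaryWeight 𝒳 lam x := (Real.exp_pos _).le
  set A := C * (((d + 2).factorial * 2 ^ (d + 2) : ℝ) *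
    (ε ^ (d + 2) + ε ^ (d + 1) * boundaryWeight 𝒳 lam x)) with hA
  have ball_le (X : Fin n → E d) :
      ‖∫ y in Metric.closedBall x (ordStat (Finset.univ.erase i) k fun j ↦ ‖X j - x‖), φ y ∂P‖ ≤
        A * Real.exp (lam * knnRadius (k + 1) X x ^ d) := by
    have radius_nonneg : 0 ≤ ordStat (Finset.univ.erase i) k fun j ↦ ‖X j - x‖ :=
      le_ordStat_of_forall_le hk (le_card_univ_erase hkn i) fun j _ ↦ norm_nonneg _
    have radius_le : (ordStat (Finset.univ.erase i) k fun j ↦ ‖X j - x‖) ≤ knnRadius (k + 1) X x :=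
      ordStat_erase_le_ordStat_succ hk (Finset.mem_univ i) (by simpa using hkn)
    refine (hball _ radius_nonneg).trans ?_
    rw [hA, mul_assoc]
    gcongr
    exact pow_add_ite_pow_le_mul_exp hd hε hlamε radius_nonneg radius_le Metric.infDist_nonneg
  rw [integral_ite_le_ordStat_eq hk hkn hφ hD x i]
  refine (norm_integral_le_of_norm_le (integrable_exp.const_mul A) (.of_forall ball_le)).trans ?_
  calc _ ≤ A * (1 + Real.exp 1) := by rw [integral_const_mul]; gcongr
    _ = _ := by rw [hA]; ring

lemma LowerRegular.abs_integral_nnSum_le (hc : LowerRegular 𝒳 P c) (hc0 : 0 < c)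
    (hd : 1 ≤ d) (hk : 1 ≤ k) (hkn : k + 1 ≤ n) (h𝒳 : Bornology.IsBounded 𝒳) (hP : P 𝒳ᶜ = 0)
    (hx : x ∈ 𝒳) (hlam : lam = c * n / (4 * (k + 1 : ℕ))) (hε : 0 < ε) (hlamε : lam * ε ^ d = 1)
    {Φ : E d → E d → ℝ} (hΦ : Measurable (Φ x)) {D : ℝ} (hD : ∀ u, |Φ x u| ≤ D) {C : ℝ}
    (hC : 0 ≤ C) (hball : ∀ r, 0 ≤ r → |∫ y in Metric.closedBall x r, Φ x y ∂P| ≤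
      C * (r ^ (d + 2) + if Metric.infDist x 𝒳ᶜ ≤ r then r ^ (d + 1) else 0)) :
    |∫ X, nnSum Finset.univ k Φ X x ∂(Measure.pi fun _ : Fin n ↦ P)| ≤
      n * (C * ((d + 2).factorial * 2 ^ (d + 2) : ℝ) * (1 + Real.exp 1) *
        (ε ^ (d + 2) + ε ^ (d + 1) * boundaryWeight 𝒳 lam x)) := by
  have integrable_term (i : Fin n) : Integrable (fun X : Fin n → E d ↦
      if ‖X i - x‖ ≤ ordStat Finset.univ k (fun j ↦ ‖X j - x‖) then Φ x (X i) else 0)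
      (Measure.pi fun _ ↦ P) := by
    refine .of_bound (Measurable.ite ?_ (hΦ.comp (measurable_pi_apply i))
      measurable_const).aestronglyMeasurable D (.of_forall fun X ↦ ?_)
    · exact measurableSet_le (by fun_prop)
        (measurable_ordStat hk (by rw [Finset.card_fin]; lia) fun i ↦ by fun_prop)
    · split_ifs
      · exact hD _
      · simpa using (abs_nonneg _).trans (hD x)
  simp only [nnSum, Finset.sum_filter]
  rw [integral_finsetSum _ fun i _ ↦ integrable_term i]
  refine (Finset.abs_sum_le_sum_abs _ _).trans ?_
  simpa using Finset.sum_le_card_nsmul Finset.univ _ _ fun i _ ↦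
    hc.abs_integral_ite_le_ordStat_le hc0 hd hk hkn h𝒳 hP hx hlam hε hlamε hΦ hD hC hball i

lemma integral_nnBias_eq {Q : Measure (E d)} [IsFiniteMeasure Q] (hk : 1 ≤ k) (hkn : k ≤ n)
    {Φ : E d → E d → ℝ} (hΦ : Measurable (Function.uncurry Φ)) {D : ℝ} (hD : ∀ x u, |Φ x u| ≤ D) :
    ∫ X, nnBias Finset.univ k Q Φ X ∂(Measure.pi fun _ : Fin n ↦ P) =
      (k : ℝ)⁻¹ * ∫ x, ∫ X, nnSum Finset.univ k Φ X x ∂(Measure.pi fun _ : Fin n ↦ P) ∂Q := by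
  simp only [nnBias, integral_const_mul]
  rw [integral_integral_swap]
  exact .of_bound (measurable_nnSum hk (by simpa using hkn) hΦ).aestronglyMeasurable _
    (.of_forall fun z ↦ abs_nnSum_le hD _ _)

/-- The mean of the bias is a boundary effect: in the interior the first order Taylor term averages
out, and the mass near the boundary contributes one more factor `ε`. -/
theorem LowerRegular.exists_abs_integral_nnBias_le (hc : LowerRegular 𝒳 P c) (hc0 : 0 < c)
    (hd : 1 ≤ d) {Q : Measure (E d)} [IsProbabilityMeasure Q] {p : E d → ℝ} (hp : IsDensity P p)
    (h𝒳 : Bornology.IsBounded 𝒳) (hP : P 𝒳ᶜ = 0) (hQ : Q 𝒳ᶜ = 0) {K : NNReal}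
    (hK : LipschitzOnWith K p 𝒳) {C M : ℝ} (hC0 : 0 ≤ C) (hC : UpperRegular P C)
    (hA : GeomCondition 𝒳 Q) {Φ : E d → E d → ℝ} (hM : 0 ≤ M) (hΦ : IsLocalIncrement 𝒳 M Φ) :
    ∃ B : ℝ, 0 ≤ B ∧ ∀ n k : ℕ, 1 ≤ k → k + 1 ≤ n → ∀ ε : ℝ, 0 < ε →
      c * n / (4 * (k + 1 : ℕ)) * ε ^ d = 1 →
      |∫ X, nnBias Finset.univ k Q Φ X ∂(Measure.pi fun _ : Fin n ↦ P)| ≤ B * ε ^ 2 := by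
  obtain ⟨G, hG0, hG⟩ := hA.exists_integral_boundaryWeight_le hd hQ
  set A := M * (C + K * volume.real (Metric.ball (0 : E d) 1))
  set B := A * ((d + 2).factorial * 2 ^ (d + 2) : ℝ) * (1 + Real.exp 1)
  refine ⟨8 / c * B * (1 + G), by positivity, fun n k hk hkn ε hε hlamε ↦ ?_⟩
  have one_le_k : (1 : ℝ) ≤ k := by exact_mod_cast hk
  set lam := c * n / (4 * (k + 1 : ℕ)) with hlam
  have hlam0 : 0 ≤ lam := by positivity
  have hΦD := hΦ.abs_le_diam hM h𝒳
  have weight_integrable := (integrable_boundaryWeight (𝒳 := 𝒳) (Q := Q) hlam0).const_mul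
    (ε ^ (d + 1))
  have abs_integral_le : |∫ x, ∫ X, nnSum Finset.univ k Φ X x ∂(Measure.pi fun _ : Fin n ↦ P) ∂Q| ≤
      ∫ x, n * (B * (ε ^ (d + 2) + ε ^ (d + 1) * boundaryWeight 𝒳 lam x)) ∂Q := by
    rw [← Real.norm_eq_abs]
    refine norm_integral_le_of_norm_le
      ((((integrable_const (ε ^ (d + 2))).add weight_integrable).const_mul B).const_mul (n : ℝ)) ?_
    filter_upwards [show ∀ᵐ x ∂Q, x ∈ 𝒳 from hQ] with x hx
    exact hc.abs_integral_nnSum_le hc0 hd hk hkn h𝒳 hP hx hlam hε hlamε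
      (hΦ.measurable.comp measurable_prodMk_left) (hΦD x) (by positivity) fun r hr ↦
      hΦ.abs_setIntegral_closedBall_le hp h𝒳 hP hK hC0 hx (hC x r hr) hr
  have ratio_le : (k : ℝ)⁻¹ * n * ε ^ d ≤ 8 / c := by
    have : (k : ℝ)⁻¹ * n * ε ^ d = 4 * (k + 1) / (c * k) * (lam * ε ^ d) := by
      rw [hlam]; push_cast; field_simp
    rw [this, hlamε, mul_one, div_le_div_iff₀ (by positivity) hc0]
    nlinarith
  rw [integral_nnBias_eq hk (by lia) hΦ.measurable hΦD, abs_mul, abs_of_nonneg (by positivity)]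
  calc (k : ℝ)⁻¹ * |∫ x, ∫ X, nnSum Finset.univ k Φ X x ∂(Measure.pi fun _ : Fin n ↦ P) ∂Q|
      ≤ (k : ℝ)⁻¹ * (n * (B * (ε ^ (d + 2) + ε ^ (d + 1) * (G * ε)))) := by
        gcongr
        refine abs_integral_le.trans ?_
        rw [integral_const_mul, integral_const_mul, integral_add (integrable_const _)
          weight_integrable, integral_const_mul, integral_const, probReal_univ, one_smul]
        gcongr
        exact hG lam ε hε hlamε
    _ = ((k : ℝ)⁻¹ * n * ε ^ d) * (B * (1 + G) * ε ^ 2) := by ring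
    _ ≤ 8 / c * (B * (1 + G) * ε ^ 2) := by gcongr
    _ = _ := by ring

end MeanOfNearestNeighbourBias

section Variance

variable {d n k : ℕ} {𝒳 : Set (E d)} {Q : Measure (E d)} [IsProbabilityMeasure Q]
  {X : Fin n → E d} {x x' : E d} {M c ε : ℝ} {Φ : E d → E d → ℝ}

/-- The influence of the sample point `X i` on the nearest neighbour average at `x`: it vanishes
unless `X i` is among the `k` nearest neighbours of `x`, in which case removing `X i` changes
neighbours within the `(k + 1)`-nearest neighbour radius. -/
def nnWeight (k : ℕ) (X : Fin n → E d) (i : Fin n) (x : E d) : ℝ :=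
  if ‖X i - x‖ ≤ knnRadius k X x then knnRadius (k + 1) X x else 0

lemma measurable_nnWeight (hk : 1 ≤ k) (hkn : k + 1 ≤ n) (X : Fin n → E d) (i : Fin n) :
    Measurable (nnWeight k X i) :=
  Measurable.ite (measurableSet_le (by fun_prop) (measurable_knnRadius_right hk (by lia) X))
    (measurable_knnRadius_right (by lia) hkn X) measurable_const

lemma nnWeight_nonneg (hkn : k + 1 ≤ n) (X : Fin n → E d) (i : Fin n) (x : E d) :
    0 ≤ nnWeight k X i x :=
  ite_nonneg (knnRadius_nonneg (by lia) hkn X x) le_rfl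

lemma nnWeight_le (hkn : k + 1 ≤ n) (X : Fin n → E d) (i : Fin n) (x : E d) :
    nnWeight k X i x ≤ knnRadius (k + 1) X x := by
  unfold nnWeight
  split_ifs
  exacts [le_rfl, knnRadius_nonneg (by lia) hkn X x]

lemma nnWeight_mul_nnWeight_le (hk : 1 ≤ k) (hkn : k + 1 ≤ n)
    (hle : knnRadius (k + 1) X x' ≤ knnRadius (k + 1) X x) (i : Fin n) :
    nnWeight k X i x * nnWeight k X i x' ≤ if ‖X i - x‖ ≤ knnRadius k X x then
      (if ‖x' - x‖ ≤ 2 * knnRadius (k + 1) X x then knnRadius (k + 1) X x ^ 2 else 0) else 0 := by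
  set T := knnRadius (k + 1) X x
  have radius_mono (y : E d) : knnRadius k X y ≤ knnRadius (k + 1) X y :=
    ordStat_mono_right hk (by lia) (by simpa using hkn)
  by_cases hx : ‖X i - x‖ ≤ knnRadius k X x
  · rw [if_pos hx]
    by_cases hx' : ‖X i - x'‖ ≤ knnRadius k X x'
    · have norm_le : ‖x' - x‖ ≤ 2 * T := by
        rw [← sub_sub_sub_cancel_left x x' (X i)]
        linarith [norm_sub_le (X i - x) (X i - x'), radius_mono x, radius_mono x']
      rw [if_pos norm_le, sq]
      exact mul_le_mul (nnWeight_le hkn X i x) ((nnWeight_le hkn X i x').trans hle)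
        (nnWeight_nonneg hkn X i x') (knnRadius_nonneg (by lia) hkn X x)
    · rw [nnWeight, nnWeight, if_neg hx', mul_zero]
      split_ifs <;> positivity
  · rw [nnWeight, if_neg hx, zero_mul, if_neg hx]

lemma sum_nnWeight_mul_le (hk : 1 ≤ k) (hkn : k + 1 ≤ n)
    (hinj : Function.Injective fun i ↦ ‖X i - x‖)
    (hle : knnRadius (k + 1) X x' ≤ knnRadius (k + 1) X x) :
    ∑ i, nnWeight k X i x * nnWeight k X i x' ≤
      k * if ‖x' - x‖ ≤ 2 * knnRadius (k + 1) X x then knnRadius (k + 1) X x ^ 2 else 0 := by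
  have card_eq : Finset.card {i | ‖X i - x‖ ≤ knnRadius k X x} = k :=
    card_filter_le_ordStat (a := fun i ↦ ‖X i - x‖) hk (by rw [Finset.card_fin]; lia) hinj.injOn
  refine (Finset.sum_le_sum fun i _ ↦ nnWeight_mul_nnWeight_le hk hkn hle i).trans (le_of_eq ?_)
  rw [← Finset.sum_filter, Finset.sum_const, card_eq, nsmul_eq_mul]

lemma integrable_knnRadius_pow (hk : 1 ≤ k) (hkn : k ≤ n) (h𝒳 : Bornology.IsBounded 𝒳)
    (hQ : Q 𝒳ᶜ = 0) (hX : ∀ i, X i ∈ 𝒳) (s : ℕ) : Integrable (fun x ↦ knnRadius k X x ^ s) Q := by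
  refine .of_bound ((measurable_knnRadius_right hk hkn X).pow_const s).aestronglyMeasurable
    (Metric.diam 𝒳 ^ s) ?_
  filter_upwards [show ∀ᵐ x ∂Q, x ∈ 𝒳 from hQ] with x hx
  have := knnRadius_nonneg hk hkn X x
  rw [Real.norm_of_nonneg (by positivity)]
  gcongr
  exact knnRadius_le_diam hk hkn h𝒳 hX hx

lemma integrable_nnWeight (hk : 1 ≤ k) (hkn : k + 1 ≤ n) (h𝒳 : Bornology.IsBounded 𝒳)
    (hQ : Q 𝒳ᶜ = 0) (hX : ∀ i, X i ∈ 𝒳) (i : Fin n) : Integrable (nnWeight k X i) Q := by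
  refine (integrable_knnRadius_pow (by lia) hkn h𝒳 hQ hX 1).mono'
    (measurable_nnWeight hk hkn X i).aestronglyMeasurable (.of_forall fun x ↦ ?_)
  rw [Real.norm_of_nonneg (nnWeight_nonneg hkn X i x), pow_one]
  exact nnWeight_le hkn X i x

lemma UpperRegular.integral_ite_norm_sub_le {C : ℝ} (hC : UpperRegular Q C) {T : E d → ℝ}
    (hT0 : ∀ x, 0 ≤ T x) (hTm : Measurable T) (hT2 : Integrable (fun x ↦ T x ^ 2) Q)
    (hTd : Integrable (fun x ↦ T x ^ (d + 2)) Q) :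
    Integrable (fun z : E d × E d ↦ if ‖z.2 - z.1‖ ≤ 2 * T z.1 then T z.1 ^ 2 else 0) (Q.prod Q) ∧
      ∫ z, (if ‖z.2 - z.1‖ ≤ 2 * T z.1 then T z.1 ^ 2 else 0) ∂(Q.prod Q) ≤
        C * 2 ^ d * ∫ x, T x ^ (d + 2) ∂Q := by
  have integrable_ite : Integrable
      (fun z : E d × E d ↦ if ‖z.2 - z.1‖ ≤ 2 * T z.1 then T z.1 ^ 2 else 0) (Q.prod Q) := by
    refine (hT2.comp_fst Q).mono' (Measurable.ite (measurableSet_le (by fun_prop) (by fun_prop))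
      (by fun_prop) measurable_const).aestronglyMeasurable (.of_forall fun z ↦ ?_)
    split_ifs
    · rw [Real.norm_of_nonneg (by positivity)]
    · simpa using sq_nonneg (T z.1)
  refine ⟨integrable_ite, ?_⟩
  rw [integral_prod _ integrable_ite, ← integral_const_mul]
  refine integral_mono integrable_ite.integral_prod_left (hTd.const_mul _) fun x ↦ ?_
  have inner_eq : ∫ x', (if ‖x' - x‖ ≤ 2 * T x then T x ^ 2 else 0) ∂Q =
      T x ^ 2 * Q.real (Metric.closedBall x (2 * T x)) := by
    have := integral_indicator_const (μ := Q) (T x ^ 2)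
      (Metric.isClosed_closedBall (x := x) (ε := 2 * T x)).measurableSet
    rw [smul_eq_mul, mul_comm (Q.real _)] at this
    rw [← this]
    simp only [indicator, mem_closedBall_iff_norm]
  calc _ = T x ^ 2 * Q.real (Metric.closedBall x (2 * T x)) := inner_eq
    _ ≤ T x ^ 2 * (C * (2 * T x) ^ d) := by
        gcongr
        exact hC x _ (mul_nonneg two_pos.le (hT0 x))
    _ = C * 2 ^ d * T x ^ (d + 2) := by rw [mul_pow]; ring

/-- Expanding the square as a double integral over `x` and `x'`, a sample point contributes only if
it is a nearest neighbour of both, which forces `x` and `x'` to be close. -/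
lemma UpperRegular.sum_sq_integral_nnWeight_le {C : ℝ} (hC : UpperRegular Q C) (hk : 1 ≤ k)
    (hkn : k + 1 ≤ n) (h𝒳 : Bornology.IsBounded 𝒳) (hQ : Q 𝒳ᶜ = 0) (hX : ∀ i, X i ∈ 𝒳)
    (hinj : ∀ᵐ x ∂Q, Function.Injective fun i ↦ ‖X i - x‖) :
    ∑ i, (∫ x, nnWeight k X i x ∂Q) ^ 2 ≤
      k * (2 * (C * 2 ^ d) * ∫ x, knnRadius (k + 1) X x ^ (d + 2) ∂Q) := by
  set T : E d → ℝ := knnRadius (k + 1) X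
  have integrable_pow := integrable_knnRadius_pow (by lia) hkn h𝒳 hQ hX
  set F : E d × E d → ℝ := fun z ↦ if ‖z.2 - z.1‖ ≤ 2 * T z.1 then T z.1 ^ 2 else 0
  have F_nonneg (z : E d × E d) : 0 ≤ F z := ite_nonneg (sq_nonneg _) le_rfl
  obtain ⟨integrable_F, integral_F_le⟩ : Integrable F (Q.prod Q) ∧
      ∫ z, F z ∂(Q.prod Q) ≤ C * 2 ^ d * ∫ x, T x ^ (d + 2) ∂Q :=
    hC.integral_ite_norm_sub_le (knnRadius_nonneg (by lia) hkn X)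
      (measurable_knnRadius_right (by lia) hkn X) (integrable_pow 2) (integrable_pow (d + 2))
  have integrable_F_swap : Integrable (fun z ↦ F z.swap) (Q.prod Q) := integrable_F.swap
  have integrable_mul (i : Fin n) :
      Integrable (fun z : E d × E d ↦ nnWeight k X i z.1 * nnWeight k X i z.2) (Q.prod Q) :=
    (integrable_nnWeight hk hkn h𝒳 hQ hX i).mul_prod (integrable_nnWeight hk hkn h𝒳 hQ hX i)
  calc ∑ i, (∫ x, nnWeight k X i x ∂Q) ^ 2
      = ∑ i, ∫ z, nnWeight k X i z.1 * nnWeight k X i z.2 ∂(Q.prod Q) :=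
        Finset.sum_congr rfl fun i _ ↦ by rw [integral_prod_mul, sq]
    _ = ∫ z, ∑ i, nnWeight k X i z.1 * nnWeight k X i z.2 ∂(Q.prod Q) :=
        (integral_finsetSum _ fun i _ ↦ integrable_mul i).symm
    _ ≤ ∫ z, k * (F z + F z.swap) ∂(Q.prod Q) := by
        refine integral_mono_ae (integrable_finsetSum _ fun i _ ↦ integrable_mul i)
          ((integrable_F.add integrable_F_swap).const_mul _) ?_
        filter_upwards [Measure.quasiMeasurePreserving_fst.ae hinj,
          Measure.quasiMeasurePreserving_snd.ae hinj] with z inj_fst inj_snd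
        rcases le_total (T z.2) (T z.1) with h | h
        · refine (sum_nnWeight_mul_le hk hkn inj_fst h).trans ?_
          gcongr
          exact le_add_of_nonneg_right (F_nonneg _)
        · simp only [mul_comm (nnWeight k X _ z.1)]
          refine (sum_nnWeight_mul_le hk hkn inj_snd h).trans ?_
          gcongr
          exact le_add_of_nonneg_left (F_nonneg _)
    _ = k * (2 * ∫ z, F z ∂(Q.prod Q)) := by
        rw [integral_const_mul, integral_add integrable_F integrable_F_swap, integral_prod_swap,
          two_mul]
    _ ≤ _ := by rw [mul_assoc 2]; gcongr

lemma IsLocalIncrement.abs_nnBias_sub_erase_le (hΦ : IsLocalIncrement 𝒳 M Φ) (hM : 0 ≤ M)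
    (hk : 1 ≤ k) (hkn : k + 1 ≤ n) (h𝒳 : Bornology.IsBounded 𝒳) (hQ : Q 𝒳ᶜ = 0)
    (hX : ∀ i, X i ∈ 𝒳) (hinj : ∀ᵐ x ∂Q, Function.Injective fun i ↦ ‖X i - x‖) (i : Fin n) :
    |nnBias Finset.univ k Q Φ X - nnBias (Finset.univ.erase i) k Q Φ X| ≤
      (k : ℝ)⁻¹ * (2 * M) * ∫ x, nnWeight k X i x ∂Q := by
  have integrable_nnSum {s : Finset (Fin n)} (hs : k ≤ s.card) :
      Integrable (fun x ↦ (k : ℝ)⁻¹ * nnSum s k Φ X x) Q :=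
    (Integrable.of_bound ((measurable_nnSum hk hs hΦ.measurable).comp
      measurable_prodMk_left).aestronglyMeasurable _
      (.of_forall (abs_nnSum_le (hΦ.abs_le_diam hM h𝒳) X))).const_mul _
  rw [nnBias, nnBias, ← integral_sub (integrable_nnSum (by rw [Finset.card_fin]; lia))
    (integrable_nnSum (le_card_univ_erase hkn i)), ← integral_const_mul, ← Real.norm_eq_abs]
  refine norm_integral_le_of_norm_le ((integrable_nnWeight hk hkn h𝒳 hQ hX i).const_mul _) ?_
  filter_upwards [hinj, show ∀ᵐ x ∂Q, x ∈ 𝒳 from hQ] with x hx hx𝒳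
  rw [← mul_sub, norm_mul, Real.norm_of_nonneg (by positivity : 0 ≤ (k : ℝ)⁻¹), mul_assoc]
  gcongr
  refine (abs_sum_filter_sub_sum_filter_erase_le (a := fun j ↦ ‖X j - x‖) hk (Finset.mem_univ i)
    (by simpa using hkn) hx.injOn (φ := fun j ↦ Φ x (X j)) (c := M * knnRadius (k + 1) X x)
    fun j _ hj ↦ ?_).trans (le_of_eq ?_)
  · exact (hΦ.abs_le x hx𝒳 (X j) (hX j)).trans (mul_le_mul_of_nonneg_left hj hM)
  · rw [nnWeight, ← knnRadius_eq_ordStat, mul_ite, mul_zero, mul_assoc]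

lemma IsLocalIncrement.sum_sq_nnBias_sub_erase_le (hΦ : IsLocalIncrement 𝒳 M Φ) (hM : 0 ≤ M)
    (hk : 1 ≤ k) (hkn : k + 1 ≤ n) (h𝒳 : Bornology.IsBounded 𝒳) (hQ : Q 𝒳ᶜ = 0) {C : ℝ}
    (hC0 : 0 ≤ C) (hC : UpperRegular Q C) (hX : ∀ i, X i ∈ 𝒳)
    (hinj : ∀ᵐ x ∂Q, Function.Injective fun i ↦ ‖X i - x‖) :
    ∑ i, (nnBias Finset.univ k Q Φ X - nnBias (Finset.univ.erase i) k Q Φ X) ^ 2 ≤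
      8 * M ^ 2 * (C * 2 ^ d) * ∫ x, knnRadius (k + 1) X x ^ (d + 2) ∂Q := by
  set I := ∫ x, knnRadius (k + 1) X x ^ (d + 2) ∂Q
  have : 0 ≤ I := integral_nonneg fun x ↦ pow_nonneg (knnRadius_nonneg (by lia) hkn X x) _
  have one_le_k : (1 : ℝ) ≤ k := by exact_mod_cast hk
  calc ∑ i, (nnBias Finset.univ k Q Φ X - nnBias (Finset.univ.erase i) k Q Φ X) ^ 2
      ≤ ∑ i, ((k : ℝ)⁻¹ * (2 * M)) ^ 2 * (∫ x, nnWeight k X i x ∂Q) ^ 2 := by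
        refine Finset.sum_le_sum fun i _ ↦ ?_
        rw [← mul_pow, ← sq_abs]
        gcongr
        exact hΦ.abs_nnBias_sub_erase_le hM hk hkn h𝒳 hQ hX hinj i
    _ ≤ ((k : ℝ)⁻¹ * (2 * M)) ^ 2 * (k * (2 * (C * 2 ^ d) * I)) := by
        rw [← Finset.mul_sum]
        gcongr
        exact hC.sum_sq_integral_nnWeight_le hk hkn h𝒳 hQ hX hinj
    _ = (k : ℝ)⁻¹ * (8 * M ^ 2 * (C * 2 ^ d) * I) := by field_simp; ring
    _ ≤ 8 * M ^ 2 * (C * 2 ^ d) * I :=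
        mul_le_of_le_one_left (by positivity) (inv_le_one_of_one_le₀ one_le_k)

theorem LowerRegular.sum_integral_sq_nnBias_sub_le {P : Measure (E d)} [IsProbabilityMeasure P]
    (hc : LowerRegular 𝒳 P c) (hc0 : 0 < c) (hd : 1 ≤ d) (hk : 1 ≤ k) (hkn : k + 1 ≤ n)
    (hPsphere : ∀ x r, P (Metric.sphere x r) = 0) (h𝒳 : Bornology.IsBounded 𝒳) (hP : P 𝒳ᶜ = 0)
    (hQ : Q 𝒳ᶜ = 0) {C : ℝ} (hC0 : 0 ≤ C) (hC : UpperRegular Q C) (hM : 0 ≤ M)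
    (hΦ : IsLocalIncrement 𝒳 M Φ) (hε : 0 < ε) (hcε : c * n / (4 * (k + 1 : ℕ)) * ε ^ d = 1) :
    ∑ i, ∫ X, (nnBias Finset.univ k Q Φ X - nnBias (Finset.univ.erase i) k Q Φ X) ^ 2
        ∂(Measure.pi fun _ : Fin n ↦ P) ≤
      8 * M ^ 2 * (C * 2 ^ d) *
        (((d + 2).factorial * 2 ^ (d + 2) : ℝ) * ε ^ (d + 2) * (1 + Real.exp 1)) := by
  set ν := Measure.pi fun _ : Fin n ↦ P
  have integrable_pow : Integrable (Function.uncurry fun (X : Fin n → E d) (x : E d) ↦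
      knnRadius (k + 1) X x ^ (d + 2)) (ν.prod Q) := by
    refine .of_bound ((measurable_knnRadius (by lia) hkn).pow_const (d + 2)).aestronglyMeasurable
      (Metric.diam 𝒳 ^ (d + 2)) ?_
    filter_upwards [Measure.quasiMeasurePreserving_fst.ae (ae_pi_forall_mem hP),
      Measure.quasiMeasurePreserving_snd.ae (show ∀ᵐ x ∂Q, x ∈ 𝒳 from hQ)] with z hz₁ hz₂
    have := knnRadius_nonneg (by lia) hkn z.1 z.2
    rw [Function.uncurry, Real.norm_of_nonneg (by positivity)]
    gcongr
    exact knnRadius_le_diam (by lia) hkn h𝒳 hz₁ hz₂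
  have integrable_sq (i : Fin n) : Integrable (fun X ↦
      (nnBias Finset.univ k Q Φ X - nnBias (Finset.univ.erase i) k Q Φ X) ^ 2) ν :=
    have hΦD := hΦ.abs_le_diam hM h𝒳
    ((memLp_nnBias hk (by rw [Finset.card_fin]; lia) hΦ.measurable hΦD Q 2).sub
      (memLp_nnBias hk (le_card_univ_erase hkn i) hΦ.measurable hΦD Q 2)).integrable_sq
  rw [← integral_finsetSum _ fun i _ ↦ integrable_sq i]
  calc _ ≤ ∫ X, 8 * M ^ 2 * (C * 2 ^ d) * ∫ x, knnRadius (k + 1) X x ^ (d + 2) ∂Q ∂ν := by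
        refine integral_mono_ae (integrable_finsetSum _ fun i _ ↦ integrable_sq i)
          (integrable_pow.integral_prod_left.const_mul _) ?_
        filter_upwards [ae_pi_forall_mem hP, ae_pi_ae_injective_norm_sub hPsphere Q] with X hX hinj
        exact hΦ.sum_sq_nnBias_sub_erase_le hM hk hkn h𝒳 hQ hC0 hC hX hinj
    _ = 8 * M ^ 2 * (C * 2 ^ d) * ∫ x, ∫ X, knnRadius (k + 1) X x ^ (d + 2) ∂ν ∂Q := by
        rw [integral_const_mul, integral_integral_swap integrable_pow]
    _ ≤ 8 * M ^ 2 * (C * 2 ^ d) *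
        ∫ _, (((d + 2).factorial * 2 ^ (d + 2) : ℝ) * ε ^ (d + 2) * (1 + Real.exp 1)) ∂Q := by
        gcongr ?_ * ?_
        refine integral_mono_ae integrable_pow.integral_prod_right (integrable_const _) ?_
        filter_upwards [show ∀ᵐ x ∂Q, x ∈ 𝒳 from hQ] with x hx
        exact hc.integral_knnRadius_pow_le hc0 hd (by lia) hkn h𝒳 hP hx hε hcε (d + 2)
    _ = _ := by simp

end Variance

section MeanSquare

variable {d n k : ℕ} {𝒳 : Set (E d)} {P Q : Measure (E d)} [IsProbabilityMeasure P]
  [IsProbabilityMeasure Q] {M c : ℝ} {Φ : E d → E d → ℝ}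

lemma pow_le_rpow_mul_rpow (hd : 1 ≤ d) {ε a t m : ℝ} (hε : 0 ≤ ε) (ha : 0 ≤ a) (ht : 0 < t)
    (ht1 : t ≤ 1) (h : ε ^ d ≤ a * t) (s : ℕ) (hm : m ≤ s / d) :
    ε ^ s ≤ a ^ (s / d : ℝ) * t ^ m := by
  have d_ne_zero : (d : ℝ) ≠ 0 := by exact_mod_cast (by lia : d ≠ 0)
  calc ε ^ s = (ε ^ d) ^ (s / d : ℝ) := by
        rw [← Real.rpow_natCast, ← Real.rpow_natCast, ← Real.rpow_mul hε,
          mul_div_cancel₀ _ d_ne_zero]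
    _ ≤ (a * t) ^ (s / d : ℝ) := by gcongr
    _ = a ^ (s / d : ℝ) * t ^ (s / d : ℝ) := Real.mul_rpow ha ht.le
    _ ≤ a ^ (s / d : ℝ) * t ^ m :=
        mul_le_mul_of_nonneg_left (Real.rpow_le_rpow_of_exponent_ge ht ht1 hm) (by positivity)

lemma min_four_div_three_le (hd : 1 ≤ d) : min (4 / d : ℝ) 3 ≤ (d + 2 : ℕ) / d := by
  rcases hd.eq_or_lt with rfl | hd
  · exact (min_le_right _ _).trans (by norm_num)
  · refine (min_le_left _ _).trans ?_
    gcongr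
    exact_mod_cast (by lia : 4 ≤ d + 2)

lemma exists_pow_le_mul_div (hd : 1 ≤ d) (hc : 0 < c) (hk : 1 ≤ k) (hkn : k + 1 ≤ n) :
    ∃ ε : ℝ, 0 < ε ∧ c * n / (4 * (k + 1 : ℕ)) * ε ^ d = 1 ∧ ε ^ d ≤ 16 / c * (k / (n + 1)) := by
  have one_le_k : (1 : ℝ) ≤ k := by exact_mod_cast hk
  have one_le_n : (1 : ℝ) ≤ n := by exact_mod_cast (by lia : 1 ≤ n)
  set lam := c * n / (4 * (k + 1 : ℕ)) with hlam
  have lam_pos : 0 < lam := by positivity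
  have pow_eq : ((1 / lam) ^ (d : ℝ)⁻¹) ^ d = 1 / lam :=
    Real.rpow_inv_natCast_pow (by positivity) (by lia)
  refine ⟨(1 / lam) ^ (d : ℝ)⁻¹, by positivity, by rw [pow_eq, mul_one_div_cancel lam_pos.ne'], ?_⟩
  rw [pow_eq, hlam, one_div_div, div_mul_div_comm, div_le_div_iff₀ (by positivity) (by positivity)]
  push_cast
  calc 4 * ((k : ℝ) + 1) * (c * (n + 1)) ≤ 4 * (k + k) * (c * (n + n)) := by gcongr
    _ = 16 * k * (c * n) := by ring

lemma integral_sq_nnBias_self_le (hn : 1 ≤ n) {D : ℝ} (hΦ : ∀ x u, |Φ x u| ≤ D) {m : ℝ}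
    (hm : m ≤ 3) : ∫ X, nnBias Finset.univ n Q Φ X ^ 2 ∂(Measure.pi fun _ : Fin n ↦ P) ≤
      8 * D ^ 2 * ((n : ℝ) / (n + 1)) ^ m := by
  have one_le_n : (1 : ℝ) ≤ n := by exact_mod_cast hn
  have sq_le (X : Fin n → E d) : nnBias Finset.univ n Q Φ X ^ 2 ≤ D ^ 2 := by
    have abs_le := abs_nnBias_le (s := Finset.univ) (k := n) hΦ Q X
    rw [Finset.card_univ, Fintype.card_fin, inv_mul_cancel_left₀ (by positivity)] at abs_le
    exact sq_le_sq' (neg_le_of_abs_le abs_le) (le_of_abs_le abs_le)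
  have half_le : (1 / 2 : ℝ) ≤ n / (n + 1) := by
    rw [div_le_div_iff₀ two_pos (by positivity)]
    linarith
  have le_rpow : 1 / 8 ≤ ((n : ℝ) / (n + 1)) ^ m := by
    calc (1 / 8 : ℝ) = (1 / 2) ^ (3 : ℝ) := by norm_num
      _ ≤ ((n : ℝ) / (n + 1)) ^ (3 : ℝ) := Real.rpow_le_rpow (by norm_num) half_le (by norm_num)
      _ ≤ ((n : ℝ) / (n + 1)) ^ m := Real.rpow_le_rpow_of_exponent_ge (by positivity)
          ((div_le_one (by positivity)).2 (by linarith)) hm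
  calc _ ≤ ∫ _, D ^ 2 ∂(Measure.pi fun _ : Fin n ↦ P) :=
        integral_mono_of_nonneg (.of_forall fun X ↦ sq_nonneg _) (integrable_const _)
          (.of_forall sq_le)
    _ = 8 * D ^ 2 * (1 / 8) := by simp; ring
    _ ≤ _ := by gcongr

lemma LowerRegular.exists_integral_sq_nnBias_le (hc : LowerRegular 𝒳 P c) (hc0 : 0 < c)
    (hd : 1 ≤ d) {p : E d → ℝ} (hp : IsDensity P p) (h𝒳 : Bornology.IsBounded 𝒳) (hP : P 𝒳ᶜ = 0)
    (hQ : Q 𝒳ᶜ = 0) {K : NNReal} (hK : LipschitzOnWith K p 𝒳) {CP CQ : ℝ} (hCP0 : 0 ≤ CP)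
    (hCP : UpperRegular P CP) (hCQ0 : 0 ≤ CQ) (hCQ : UpperRegular Q CQ) (hA : GeomCondition 𝒳 Q)
    (hM : 0 ≤ M) (hΦ : IsLocalIncrement 𝒳 M Φ) :
    ∃ A B : ℝ, 0 ≤ A ∧ 0 ≤ B ∧ ∀ n k : ℕ, 1 ≤ k → k + 1 ≤ n → ∀ ε : ℝ, 0 < ε →
      c * n / (4 * (k + 1 : ℕ)) * ε ^ d = 1 →
      ∫ X, nnBias Finset.univ k Q Φ X ^ 2 ∂(Measure.pi fun _ : Fin n ↦ P) ≤
        A * ε ^ 4 + B * ε ^ (d + 2) := by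
  obtain ⟨A, -, abs_mean_le⟩ :=
    hc.exists_abs_integral_nnBias_le hc0 hd hp h𝒳 hP hQ hK hCP0 hCP hA hM hΦ
  refine ⟨A ^ 2, 8 * M ^ 2 * (CQ * 2 ^ d) *
    (((d + 2).factorial * 2 ^ (d + 2) : ℝ) * (1 + Real.exp 1)), by positivity, by positivity,
    fun n k hk hkn ε hε hcε ↦ ?_⟩
  have hΦD := hΦ.abs_le_diam hM h𝒳
  have memLp_univ : MemLp (nnBias Finset.univ k Q Φ) 2 (Measure.pi fun _ : Fin n ↦ P) :=
    memLp_nnBias hk (by rw [Finset.card_fin]; lia) hΦ.measurable hΦD Q 2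
  have efron_stein : Var[nnBias Finset.univ k Q Φ; Measure.pi fun _ : Fin n ↦ P] ≤ _ :=
    variance_pi_le_sum_integral_sub_sq (fun _ ↦ P) memLp_univ
      (fun i ↦ memLp_nnBias hk (le_card_univ_erase hkn i) hΦ.measurable hΦD Q 2)
      fun i X y ↦ nnBias_update_of_notMem (Finset.notMem_erase i _) Q X y
  rw [integral_sq_eq_sq_integral_add_variance memLp_univ]
  refine add_le_add ?_ (efron_stein.trans ((hc.sum_integral_sq_nnBias_sub_le hc0 hd hk hkn
    (hp.measure_sphere_eq_zero hd) h𝒳 hP hQ hCQ0 hCQ hM hΦ hε hcε).trans (le_of_eq (by ring))))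
  calc _ = |∫ X, nnBias Finset.univ k Q Φ X ∂(Measure.pi fun _ : Fin n ↦ P)| ^ 2 := (sq_abs _).symm
    _ ≤ (A * ε ^ 2) ^ 2 := by gcongr; exact abs_mean_le n k hk hkn ε hε hcε
    _ = _ := by ring

theorem IsLocalIncrement.exists_integral_sq_nnBias_le (hΦ : IsLocalIncrement 𝒳 M Φ) (hM : 0 ≤ M)
    (hd : 1 ≤ d) (hP : P 𝒳ᶜ = 0) (hQ : Q 𝒳ᶜ = 0) (hX1 : IsCompact 𝒳) (hX2 : BallVolume 𝒳)
    {p q : E d → ℝ} (hp : IsDensity P p) (hq : IsDensity Q q)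
    (hpinf : ∃ pinf : ℝ, 0 < pinf ∧ ∀ x ∈ 𝒳, pinf ≤ p x)
    (hqsup : ∃ qsup : ℝ, 0 < qsup ∧ ∀ x ∈ 𝒳, q x ≤ qsup)
    (hX5 : ∃ K, LipschitzOnWith K p 𝒳) (hA : GeomCondition 𝒳 Q) :
    ∃ C : ℝ, ∀ n k : ℕ, 1 ≤ k → k ≤ n →
      ∫ X, nnBias Finset.univ k Q Φ X ^ 2 ∂(Measure.pi fun _ : Fin n ↦ P) ≤
        C * ((k : ℝ) / ((n : ℝ) + 1)) ^ (min (4 / (d : ℝ)) 3) := by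
  have h𝒳 := hX1.isBounded
  obtain ⟨K, hK⟩ := hX5
  have hpsup : ∃ b : ℝ, 0 < b ∧ ∀ x ∈ 𝒳, p x ≤ b := by
    obtain ⟨b, hb⟩ := (hX1.image_of_continuousOn hK.continuousOn).bddAbove
    exact ⟨max b 1, by positivity, fun x hx ↦ (hb ⟨x, hx, rfl⟩).trans (le_max_left _ _)⟩
  obtain ⟨CP, hCP0, hCP⟩ := hp.exists_upperRegular hX1.measurableSet hP hpsup
  obtain ⟨CQ, hCQ0, hCQ⟩ := hq.exists_upperRegular hX1.measurableSet hQ hqsup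
  obtain ⟨c, hc0, hc⟩ := hX2.exists_lowerRegular hp hX1.measurableSet hpinf
  obtain ⟨A, B, hA0, hB0, hAB⟩ := hc.exists_integral_sq_nnBias_le hc0 hd hp h𝒳 hP hQ hK hCP0.le
    hCP hCQ0.le hCQ hA hM hΦ
  set C := A * (16 / c) ^ ((4 : ℕ) / d : ℝ) + B * (16 / c) ^ ((d + 2 : ℕ) / d : ℝ) with hC
  have hC0 : 0 ≤ C := by positivity
  refine ⟨8 * (M * Metric.diam 𝒳) ^ 2 + C, fun n k hk hkn ↦ ?_⟩
  set m := min (4 / (d : ℝ)) 3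
  set t := (k : ℝ) / (n + 1)
  have t_pos : 0 < t := by positivity
  have t_le_one : t ≤ 1 := (div_le_one (by positivity)).2 (by exact_mod_cast hkn.trans n.le_succ)
  rcases hkn.eq_or_lt with rfl | hkn
  · refine (integral_sq_nnBias_self_le hk (hΦ.abs_le_diam hM h𝒳)
      (min_le_right (4 / (d : ℝ)) 3)).trans ?_
    gcongr
    exact le_add_of_nonneg_right hC0
  · obtain ⟨ε, hε, hcε, hεt⟩ := exists_pow_le_mul_div hd hc0 hk hkn
    calc _ ≤ A * ε ^ 4 + B * ε ^ (d + 2) := hAB n k hk hkn ε hε hcε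
      _ ≤ A * ((16 / c) ^ ((4 : ℕ) / d : ℝ) * t ^ m) +
          B * ((16 / c) ^ ((d + 2 : ℕ) / d : ℝ) * t ^ m) := by
          gcongr
          · exact pow_le_rpow_mul_rpow hd hε.le (by positivity) t_pos t_le_one hεt 4 (by simp [m])
          · exact pow_le_rpow_mul_rpow hd hε.le (by positivity) t_pos t_le_one hεt (d + 2)
              (min_four_div_three_le hd)
      _ = C * t ^ m := by rw [hC]; ring
      _ ≤ (8 * (M * Metric.diam 𝒳) ^ 2 + C) * t ^ m := by
          gcongr
          exact le_add_of_nonneg_left (by positivity)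

end MeanSquare

section CompProd

variable {ι α β γ : Type*} [Fintype ι] [MeasurableSpace α] [MeasurableSpace β]
  [MeasurableSpace γ]

lemma lintegral_pi_eq_lintegral_update [DecidableEq ι] (P : Measure α) [IsProbabilityMeasure P]
    (i : ι) {f : (ι → α) → ℝ≥0∞} (hf : Measurable f) :
    ∫⁻ z, f z ∂(Measure.pi fun _ ↦ P) =
      ∫⁻ z, ∫⁻ x, f (Function.update z i x) ∂P ∂(Measure.pi fun _ ↦ P) := by
  have update_preserving := measurePreserving_update (fun _ : ι ↦ P) i
  have measurable_comp : Measurable fun z : (ι → α) × α ↦ f (Function.update z.1 i z.2) :=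
    hf.comp update_preserving.measurable
  rw [← update_preserving.lintegral_comp hf, lintegral_prod _ measurable_comp.aemeasurable]

lemma map_pi_fst_compProd (P : Measure α) [IsProbabilityMeasure P] (κ : Kernel α β)
    [IsMarkovKernel κ] : (Measure.pi fun _ : ι ↦ P ⊗ₘ κ).map (fun z l ↦ (z l).1) =
      Measure.pi fun _ ↦ P := by
  have map_fst (_ : ι) : (P ⊗ₘ κ).map Prod.fst = P := Measure.fst_compProd P κ
  have (l : ι) : SigmaFinite ((P ⊗ₘ κ).map (Prod.fst : α × β → α)) := by
    rw [map_fst l]; infer_instance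
  rw [Measure.pi_map_pi (f := fun (_ : ι) (v : α × β) ↦ v.1) fun _ ↦ measurable_fst.aemeasurable]
  exact congrArg Measure.pi (funext map_fst)

lemma map_pi_compProd_eval (P : Measure α) [IsProbabilityMeasure P] (κ : Kernel α β)
    [IsMarkovKernel κ] (i : ι) :
    (Measure.pi fun _ : ι ↦ P ⊗ₘ κ).map (fun z ↦ ((fun l ↦ (z l).1), (z i).2)) =
      (Measure.pi fun _ ↦ P) ⊗ₘ κ.comap (fun X : ι → α ↦ X i) (measurable_pi_apply i) := by
  classical
  have measurable_fst_pi : Measurable fun (z : ι → α × β) l ↦ (z l).1 := by fun_prop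
  refine Measure.ext_of_lintegral _ fun f hf ↦ ?_
  set K : (ι → α) → ℝ≥0∞ := fun X ↦ ∫⁻ y, f (X, y) ∂(κ (X i)) with hK
  have measurable_K : Measurable K := Measurable.lintegral_kernel_prod_right
    (κ := κ.comap (fun X : ι → α ↦ X i) (measurable_pi_apply i)) hf
  have lintegral_update (z : ι → α × β) :
      ∫⁻ v, f ((fun l ↦ (Function.update z i v l).1), (Function.update z i v i).2) ∂(P ⊗ₘ κ) =
        ∫⁻ x, K (Function.update (fun l ↦ (z l).1) i x) ∂P := by
    have fst_update (v : α × β) : (fun l ↦ (Function.update z i v l).1) =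
        Function.update (fun l ↦ (z l).1) i v.1 := Function.comp_update Prod.fst z i v
    simp only [fst_update, Function.update_self]
    rw [Measure.lintegral_compProd]
    · simp only [hK, Function.update_self]
    · exact hf.comp (((measurable_update _).comp measurable_fst).prodMk measurable_snd)
  calc _ = ∫⁻ z, ∫⁻ x, K (Function.update (fun l ↦ (z l).1) i x) ∂P
        ∂(Measure.pi fun _ : ι ↦ P ⊗ₘ κ) := by
        rw [lintegral_map hf (by fun_prop), lintegral_pi_eq_lintegral_update _ i]
        · simp only [lintegral_update]
        · exact hf.comp (by fun_prop)
    _ = ∫⁻ X, ∫⁻ x, K (Function.update X i x) ∂P ∂(Measure.pi fun _ ↦ P) := by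
        rw [← map_pi_fst_compProd P κ, lintegral_map _ measurable_fst_pi]
        exact (measurable_K.comp
          (measurePreserving_update (fun _ ↦ P) i).measurable).lintegral_prod_right'
    _ = _ := by rw [← lintegral_pi_eq_lintegral_update P i measurable_K,
        Measure.lintegral_compProd hf]; rfl

lemma map_prod_compProd (ν : Measure α) [SFinite ν] (κ : Kernel α β) [IsSFiniteKernel κ]
    (Q : Measure γ) [SFinite Q] :
    ((ν ⊗ₘ κ).prod Q).map (fun z ↦ (z.1.1, (z.2, z.1.2))) = ν ⊗ₘ (Kernel.const α Q ×ₖ κ) := by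
  refine Measure.ext_of_lintegral _ fun f hf ↦ ?_
  have measurable_comp : Measurable fun z : (α × β) × γ ↦ f (z.1.1, (z.2, z.1.2)) :=
    hf.comp (by fun_prop)
  rw [lintegral_map hf (by fun_prop), lintegral_prod _ measurable_comp.aemeasurable,
    Measure.lintegral_compProd measurable_comp.lintegral_prod_right', Measure.lintegral_compProd hf]
  refine lintegral_congr fun x ↦ ?_
  have measurable_right : Measurable fun w : γ × β ↦ f (x, w) := hf.comp measurable_prodMk_left
  rw [Kernel.prod_apply, Kernel.const_apply, lintegral_prod_symm _ measurable_right.aemeasurable]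

end CompProd

section Laws

variable {d n m k : ℕ} {Ω : Type*} [MeasurableSpace Ω] {μ : Measure Ω} {P Q : Measure (E d)}
  {κ : Kernel (E d) ℝ} {X : Fin n → Ω → E d} {Y : Fin n → Ω → ℝ} {Xs : Fin m → Ω → E d}

/-- The observed data `(X, Y, X*)` as one random variable, which generates `dataSigma X Y Xs`. -/
def sampleData (X : Fin n → Ω → E d) (Y : Fin n → Ω → ℝ) (Xs : Fin m → Ω → E d) (ω : Ω) :
    (Fin n → E d × ℝ) × (Fin m → E d) :=
  ((fun i ↦ (X i ω, Y i ω)), fun j ↦ Xs j ω)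

/-- The event that `X i` is among the `k` nearest neighbours of the target point `Xs j`. -/
def neighborEvent (k : ℕ) (X : Fin n → Ω → E d) (Xs : Fin m → Ω → E d) (i : Fin n) (j : Fin m) :
    Set Ω :=
  {ω | ‖X i ω - Xs j ω‖ ≤ knnRadius k (fun l ↦ X l ω) (Xs j ω)}

lemma measurableSet_norm_sub_le_knnRadius (hk : 1 ≤ k) (hkn : k ≤ n) (i : Fin n) :
    MeasurableSet {z : (Fin n → E d) × E d | ‖z.1 i - z.2‖ ≤ knnRadius k z.1 z.2} :=
  measurableSet_le (by fun_prop) (measurable_knnRadius hk hkn)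

namespace IsSample

lemma measurable_cov (hS : IsSample μ P Q κ X Y Xs) : Measurable fun ω i ↦ X i ω :=
  measurable_pi_lambda _ hS.measurable_X

lemma measurable_sampleData (hS : IsSample μ P Q κ X Y Xs) : Measurable (sampleData X Y Xs) :=
  (measurable_pi_lambda _ fun i ↦ (hS.measurable_X i).prodMk (hS.measurable_Y i)).prodMk
    (measurable_pi_lambda _ hS.measurable_Xs)

lemma measurableSet_neighborEvent (hS : IsSample μ P Q κ X Y Xs) (hk : 1 ≤ k) (hkn : k ≤ n)
    (i : Fin n) (j : Fin m) : MeasurableSet (neighborEvent k X Xs i j) :=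
  (hS.measurable_cov.prodMk (hS.measurable_Xs j))
    (measurableSet_norm_sub_le_knnRadius hk hkn i)

variable [IsProbabilityMeasure μ]

lemma map_XY (hS : IsSample μ P Q κ X Y Xs) :
    μ.map (fun ω i ↦ (X i ω, Y i ω)) = Measure.pi fun _ ↦ P ⊗ₘ κ := by
  rw [(iIndepFun_iff_map_fun_eq_pi_map fun i ↦
    ((hS.measurable_X i).prodMk (hS.measurable_Y i)).aemeasurable).1 hS.indep_XY]
  simp only [hS.law_XY]

variable [IsProbabilityMeasure P] [IsMarkovKernel κ]

lemma map_cov (hS : IsSample μ P Q κ X Y Xs) :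
    μ.map (fun ω i ↦ X i ω) = Measure.pi fun _ ↦ P := by
  rw [← map_pi_fst_compProd P κ, ← hS.map_XY, Measure.map_map (by fun_prop)
    (measurable_pi_lambda _ fun i ↦ (hS.measurable_X i).prodMk (hS.measurable_Y i))]
  rfl

lemma map_cov_target_label [IsProbabilityMeasure Q] (hS : IsSample μ P Q κ X Y Xs) (i : Fin n)
    (j : Fin m) : μ.map (fun ω ↦ ((fun l ↦ X l ω), (Xs j ω, Y i ω))) =
      (Measure.pi fun _ ↦ P) ⊗ₘ
        (Kernel.const _ Q ×ₖ κ.comap (fun X ↦ X i) (measurable_pi_apply i)) := by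
  have measurable_XY : Measurable fun ω i ↦ (X i ω, Y i ω) :=
    measurable_pi_lambda _ fun i ↦ (hS.measurable_X i).prodMk (hS.measurable_Y i)
  have measurable_eval : Measurable fun z : Fin n → E d × ℝ ↦ ((fun l ↦ (z l).1), (z i).2) := by
    fun_prop
  have map_cov_label : μ.map (fun ω ↦ ((fun l ↦ X l ω), Y i ω)) =
      (Measure.pi fun _ ↦ P) ⊗ₘ κ.comap (fun X ↦ X i) (measurable_pi_apply i) := by
    rw [← map_pi_compProd_eval P κ i, ← hS.map_XY, Measure.map_map measurable_eval measurable_XY]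
    rfl
  have map_prod : μ.map (fun ω ↦ (((fun l ↦ X l ω), Y i ω), Xs j ω)) =
      ((Measure.pi fun _ ↦ P) ⊗ₘ κ.comap (fun X ↦ X i) (measurable_pi_apply i)).prod Q := by
    rw [← map_cov_label, ← hS.law_Xs j]
    exact (indepFun_iff_map_prod_eq_prod_map_map
      (hS.measurable_cov.prodMk (hS.measurable_Y i)).aemeasurable
      (hS.measurable_Xs j).aemeasurable).1 (hS.indep.comp measurable_eval (measurable_pi_apply j))
  rw [← map_prod_compProd, ← map_prod, Measure.map_map (by fun_prop)
    ((hS.measurable_cov.prodMk (hS.measurable_Y i)).prodMk (hS.measurable_Xs j))]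
  rfl

end IsSample

end Laws

section Labels

variable {d n m k : ℕ} {Ω : Type*} {X : Fin n → Ω → E d} {Y : Fin n → Ω → ℝ}
  {Xs : Fin m → Ω → E d} {F : ((Fin n → E d × ℝ) × (Fin m → E d)) × ℝ → ℝ}

lemma measurableSet_dataSigma_neighborEvent (hk : 1 ≤ k) (hkn : k ≤ n) (Y : Fin n → Ω → ℝ)
    (i : Fin n) (j : Fin m) : MeasurableSet[dataSigma X Y Xs] (neighborEvent k X Xs i j) :=
  ⟨_, (by fun_prop : Measurable fun z : (Fin n → E d × ℝ) × (Fin m → E d) ↦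
    ((fun l ↦ (z.1 l).1), z.2 j)) (measurableSet_norm_sub_le_knnRadius hk hkn i), rfl⟩

lemma measurable_dataSigma_label (hF : Measurable F) (i : Fin n) :
    Measurable[dataSigma X Y Xs] fun ω ↦ F (sampleData X Y Xs ω, Y i ω) :=
  (by fun_prop : Measurable fun z : (Fin n → E d × ℝ) × (Fin m → E d) ↦ F (z, (z.1 i).2)).comp
    (comap_measurable (sampleData X Y Xs))

variable [MeasurableSpace Ω] {μ : Measure Ω} {P Q : Measure (E d)} {κ : Kernel (E d) ℝ}
  {Yhat : Fin m → Ω → ℝ}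

lemma IsSample.dataSigma_le (hS : IsSample μ P Q κ X Y Xs) :
    dataSigma X Y Xs ≤ ‹MeasurableSpace Ω› :=
  hS.measurable_sampleData.comap_le

namespace IsLabels

variable [IsProbabilityMeasure μ]

lemma measureReal_inter (hL : IsLabels μ k X Y Xs Yhat) (hS : IsSample μ P Q κ X Y Xs)
    (hk : 1 ≤ k) (hkn : k ≤ n) (j : Fin m) {S : Set ((Fin n → E d × ℝ) × (Fin m → E d))}
    (hSm : MeasurableSet S) {B : Set ℝ} (hB : MeasurableSet B) :
    μ.real (sampleData X Y Xs ⁻¹' S ∩ Yhat j ⁻¹' B) = (k : ℝ)⁻¹ * ∑ i,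
      μ.real (sampleData X Y Xs ⁻¹' S ∩ (neighborEvent k X Xs i j ∩ Y i ⁻¹' B)) := by
  have setIntegral_indicator_one {s t : Set Ω} (ht : MeasurableSet t) :
      ∫ ω in s, t.indicator (fun _ ↦ (1 : ℝ)) ω ∂μ = μ.real (s ∩ t) := by
    rw [setIntegral_indicator ht, setIntegral_const, smul_eq_mul, mul_one]
  have measurableSet_inter (i : Fin n) :
      MeasurableSet (neighborEvent k X Xs i j ∩ Y i ⁻¹' B) :=
    (hS.measurableSet_neighborEvent hk hkn i j).inter (hS.measurable_Y i hB)
  have hYhat : MeasurableSet (Yhat j ⁻¹' B) := hL.measurable j hB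
  have hSD : MeasurableSet[dataSigma X Y Xs] (sampleData X Y Xs ⁻¹' S) := ⟨S, hSm, rfl⟩
  have condLaw : μ[(Yhat j ⁻¹' B).indicator (fun _ ↦ (1 : ℝ)) | dataSigma X Y Xs] =ᵐ[μ] fun ω ↦
      (k : ℝ)⁻¹ * ∑ i, (neighborEvent k X Xs i j ∩ Y i ⁻¹' B).indicator (fun _ ↦ 1) ω := by
    refine (hL.condLaw j B hB).trans (.of_forall fun ω ↦ ?_)
    simp only [indicator]
    congr!
  rw [← setIntegral_indicator_one hYhat,
    ← setIntegral_condExp hS.dataSigma_le ((integrable_const _).indicator hYhat) hSD,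
    integral_congr_ae (ae_restrict_of_ae condLaw), integral_const_mul]
  simp only [← setIntegral_indicator_one (measurableSet_inter _)]
  rw [← integral_finsetSum _ fun i _ ↦ ((integrable_const _).indicator (measurableSet_inter i))]

lemma map_sampleData_prodMk (hL : IsLabels μ k X Y Xs Yhat) (hS : IsSample μ P Q κ X Y Xs)
    (hk : 1 ≤ k) (hkn : k ≤ n) (j : Fin m) :
    μ.map (fun ω ↦ (sampleData X Y Xs ω, Yhat j ω)) = ∑ i, (k : ℝ≥0∞)⁻¹ •
      (μ.restrict (neighborEvent k X Xs i j)).map (fun ω ↦ (sampleData X Y Xs ω, Y i ω)) := by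
  have measurable_label {Z : Ω → ℝ} (hZ : Measurable Z) :
      Measurable fun ω ↦ (sampleData X Y Xs ω, Z ω) := hS.measurable_sampleData.prodMk hZ
  have : IsProbabilityMeasure (μ.map fun ω ↦ (sampleData X Y Xs ω, Yhat j ω)) :=
    Measure.isProbabilityMeasure_map (measurable_label (hL.measurable j)).aemeasurable
  refine Measure.ext_prod fun {S B} hSm hB ↦ ?_
  have restrict_map_apply (i : Fin n) : ((k : ℝ≥0∞)⁻¹ • (μ.restrict
      (neighborEvent k X Xs i j)).map (fun ω ↦ (sampleData X Y Xs ω, Y i ω))) (S ×ˢ B) =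
      ENNReal.ofReal ((k : ℝ)⁻¹ *
        μ.real (sampleData X Y Xs ⁻¹' S ∩ (neighborEvent k X Xs i j ∩ Y i ⁻¹' B))) := by
    have hY := measurable_label (hS.measurable_Y i)
    rw [Measure.smul_apply, Measure.map_apply hY (hSm.prod hB),
      Measure.restrict_apply (hY (hSm.prod hB)), smul_eq_mul, ENNReal.ofReal_mul (by positivity),
      ofReal_measureReal, ENNReal.ofReal_inv_of_pos (by exact_mod_cast hk), ENNReal.ofReal_natCast,
      mk_preimage_prod, inter_right_comm, inter_assoc]
  rw [Measure.map_apply (measurable_label (hL.measurable j)) (hSm.prod hB),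
    Measure.finsetSum_apply, Finset.sum_congr rfl fun i _ ↦ restrict_map_apply i,
    ← ENNReal.ofReal_sum_of_nonneg fun i _ ↦ by positivity, ← Finset.mul_sum,
    ← hL.measureReal_inter hS hk hkn j hSm hB, ofReal_measureReal, mk_preimage_prod]

lemma integrable_map_restrict (hL : IsLabels μ k X Y Xs Yhat) (hS : IsSample μ P Q κ X Y Xs)
    (hk : 1 ≤ k) (hkn : k ≤ n) (j : Fin m) (hF : Measurable F)
    (hint : Integrable (fun ω ↦ F (sampleData X Y Xs ω, Yhat j ω)) μ) (i : Fin n) :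
    Integrable F ((k : ℝ≥0∞)⁻¹ • (μ.restrict (neighborEvent k X Xs i j)).map
      (fun ω ↦ (sampleData X Y Xs ω, Y i ω))) := by
  have hYhat := hS.measurable_sampleData.prodMk (hL.measurable j)
  rw [← Function.comp_def F, ← integrable_map_measure hF.aestronglyMeasurable hYhat.aemeasurable,
    hL.map_sampleData_prodMk hS hk hkn j, integrable_finsetSum_measure] at hint
  exact hint i (Finset.mem_univ i)

lemma integrableOn_neighborEvent (hL : IsLabels μ k X Y Xs Yhat) (hS : IsSample μ P Q κ X Y Xs)
    (hk : 1 ≤ k) (hkn : k ≤ n) (j : Fin m) (hF : Measurable F)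
    (hint : Integrable (fun ω ↦ F (sampleData X Y Xs ω, Yhat j ω)) μ) (i : Fin n) :
    IntegrableOn (fun ω ↦ F (sampleData X Y Xs ω, Y i ω)) (neighborEvent k X Xs i j) μ := by
  have hY := hS.measurable_sampleData.prodMk (hS.measurable_Y i)
  have := hL.integrable_map_restrict hS hk hkn j hF hint i
  rwa [integrable_smul_measure (ENNReal.inv_ne_zero.2 (ENNReal.natCast_ne_top k))
    (ENNReal.inv_ne_top.2 (by exact_mod_cast Nat.one_le_iff_ne_zero.1 hk)),
    integrable_map_measure hF.aestronglyMeasurable hY.aemeasurable] at this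

lemma integral_eq (hL : IsLabels μ k X Y Xs Yhat) (hS : IsSample μ P Q κ X Y Xs) (hk : 1 ≤ k)
    (hkn : k ≤ n) (j : Fin m) (hF : Measurable F)
    (hint : Integrable (fun ω ↦ F (sampleData X Y Xs ω, Yhat j ω)) μ) :
    ∫ ω, F (sampleData X Y Xs ω, Yhat j ω) ∂μ =
      (k : ℝ)⁻¹ * ∑ i, ∫ ω in neighborEvent k X Xs i j, F (sampleData X Y Xs ω, Y i ω) ∂μ := by
  have hYhat := hS.measurable_sampleData.prodMk (hL.measurable j)
  rw [← integral_map hYhat.aemeasurable hF.aestronglyMeasurable,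
    hL.map_sampleData_prodMk hS hk hkn j,
    integral_finsetSum_measure fun i _ ↦ hL.integrable_map_restrict hS hk hkn j hF hint i,
    Finset.mul_sum]
  refine Finset.sum_congr rfl fun i _ ↦ ?_
  rw [integral_smul_measure, integral_map
    (hS.measurable_sampleData.prodMk (hS.measurable_Y i)).aemeasurable hF.aestronglyMeasurable,
    ENNReal.toReal_inv, ENNReal.toReal_natCast, smul_eq_mul]

lemma condExp_dataSigma (hL : IsLabels μ k X Y Xs Yhat) (hS : IsSample μ P Q κ X Y Xs)
    (hk : 1 ≤ k) (hkn : k ≤ n) (j : Fin m) (hF : Measurable F)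
    (hint : Integrable (fun ω ↦ F (sampleData X Y Xs ω, Yhat j ω)) μ) :
    μ[fun ω ↦ F (sampleData X Y Xs ω, Yhat j ω) | dataSigma X Y Xs] =ᵐ[μ] fun ω ↦
      (k : ℝ)⁻¹ * ∑ i, (neighborEvent k X Xs i j).indicator
        (fun ω ↦ F (sampleData X Y Xs ω, Y i ω)) ω := by
  have integrable_indicator (i : Fin n) : Integrable ((neighborEvent k X Xs i j).indicator
      fun ω ↦ F (sampleData X Y Xs ω, Y i ω)) μ :=
    (hL.integrableOn_neighborEvent hS hk hkn j hF hint i).integrable_indicator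
      (hS.measurableSet_neighborEvent hk hkn i j)
  have integrable_sum := (integrable_finsetSum Finset.univ fun i _ ↦
    integrable_indicator i).const_mul (k : ℝ)⁻¹
  refine (ae_eq_condExp_of_forall_setIntegral_eq hS.dataSigma_le hint
    (fun _ _ _ ↦ integrable_sum.integrableOn) ?_ ?_).symm
  · rintro _ ⟨T, hT, rfl⟩ -
    have hTF : Measurable ((Prod.fst ⁻¹' T).indicator F) := hF.indicator (measurable_fst hT)
    have hTm : MeasurableSet (sampleData X Y Xs ⁻¹' T) := hS.measurable_sampleData hT
    have indicator_label (Z : Ω → ℝ) : (fun ω ↦ (Prod.fst ⁻¹' T).indicator F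
        (sampleData X Y Xs ω, Z ω)) = (sampleData X Y Xs ⁻¹' T).indicator
          fun ω ↦ F (sampleData X Y Xs ω, Z ω) := rfl
    have := hL.integral_eq hS hk hkn j hTF (by
      rw [indicator_label]; exact hint.indicator hTm)
    simp only [indicator_label, integral_indicator hTm, Measure.restrict_restrict hTm] at this
    change ∫ ω in sampleData X Y Xs ⁻¹' T, _ ∂μ = ∫ ω in sampleData X Y Xs ⁻¹' T, _ ∂μ
    rw [this, integral_const_mul,
      integral_finsetSum _ fun i _ ↦ (integrable_indicator i).integrableOn]
    simp only [setIntegral_indicator (hS.measurableSet_neighborEvent hk hkn _ j)]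
  · exact ((Finset.measurable_sum _ fun i _ ↦ (measurable_dataSigma_label hF i).indicator
      (measurableSet_dataSigma_neighborEvent hk hkn Y i j)).const_mul
        _).stronglyMeasurable.aestronglyMeasurable

end IsLabels

end Labels

section NeighborMean

variable {d n m k : ℕ} {κ : Kernel (E d) ℝ} {H : E d → E d → ℝ → ℝ}

/-- The mean of `H x (X i) (Y i)` over the `k` nearest neighbours `X i` of the target point `x`.
Letting `H` depend on both points covers the two estimators: `est1` averages `h x (Y i)` in
conditional expectation, `est2` averages `h (X i) (Y i)`. -/
def nnMean (k : ℕ) (H : E d → E d → ℝ → ℝ) (X : Fin n → E d) (Y : Fin n → ℝ) (x : E d) : ℝ :=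
  (k : ℝ)⁻¹ * ∑ i with ‖X i - x‖ ≤ knnRadius k X x, H x (X i) (Y i)

/-- The mean of `H x u` under the law `κ u` of a label at the source point `u`, a common
generalization of `Delta` and `regr`. -/
def labelMean (κ : Kernel (E d) ℝ) (H : E d → E d → ℝ → ℝ) (x u : E d) : ℝ :=
  ∫ y, H x u y ∂(κ u)

lemma measurable_labelMean [IsSFiniteKernel κ]
    (hH : Measurable fun z : (E d × E d) × ℝ ↦ H z.1.1 z.1.2 z.2) :
    Measurable (Function.uncurry (labelMean κ H)) :=
  (StronglyMeasurable.integral_kernel_prod_right'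
    (κ := κ.comap Prod.snd measurable_snd) hH.stronglyMeasurable).measurable

variable {Ω : Type*} {X : Fin n → Ω → E d} {Y : Fin n → Ω → ℝ} {Xs : Fin m → Ω → E d}

lemma nnMean_eq_sum_indicator (j : Fin m) (ω : Ω) :
    nnMean k H (fun i ↦ X i ω) (fun i ↦ Y i ω) (Xs j ω) = (k : ℝ)⁻¹ * ∑ i,
      (neighborEvent k X Xs i j).indicator (fun ω ↦ H (Xs j ω) (X i ω) (Y i ω)) ω := by
  simp only [nnMean, Finset.sum_filter, indicator]
  congr!

lemma nnBias_univ_eq_sum {Q : Measure (E d)} {L : E d → E d → ℝ} (X : Fin n → E d)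
    (hL : ∀ i, Integrable ({x | ‖X i - x‖ ≤ knnRadius k X x}.indicator fun x ↦ L x (X i)) Q) :
    nnBias Finset.univ k Q L X = (k : ℝ)⁻¹ * ∑ i,
      ∫ x, {x | ‖X i - x‖ ≤ knnRadius k X x}.indicator (fun x ↦ L x (X i)) x ∂Q := by
  rw [nnBias, integral_const_mul, ← integral_finsetSum _ fun i _ ↦ hL i]
  simp only [nnSum, Finset.sum_filter, indicator]
  congr!

namespace IsSample

variable [MeasurableSpace Ω] {μ : Measure Ω} [IsProbabilityMeasure μ] {P Q : Measure (E d)}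
  [IsProbabilityMeasure P] [IsProbabilityMeasure Q] [IsMarkovKernel κ]

lemma ae_integrable_prod (hS : IsSample μ P Q κ X Y Xs) (i : Fin n) (j : Fin m)
    {G : (Fin n → E d) × E d × ℝ → ℝ} (hG : Measurable G)
    (hint : Integrable (fun ω ↦ G ((fun l ↦ X l ω), Xs j ω, Y i ω)) μ) :
    ∀ᵐ ω ∂μ, Integrable (fun z ↦ G ((fun l ↦ X l ω), z)) (Q.prod (κ (X i ω))) := by
  have hmeas := hS.measurable_cov.prodMk ((hS.measurable_Xs j).prodMk (hS.measurable_Y i))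
  have hint_map := (integrable_map_measure hG.aestronglyMeasurable hmeas.aemeasurable).2 hint
  rw [hS.map_cov_target_label i j, Measure.integrable_compProd_iff hG.aestronglyMeasurable,
    ← hS.map_cov] at hint_map
  simpa only [Kernel.prod_apply, Kernel.const_apply, Kernel.comap_apply] using
    ae_of_ae_map hS.measurable_cov.aemeasurable hint_map.1

lemma condExp_covSigma (hS : IsSample μ P Q κ X Y Xs) (i : Fin n) (j : Fin m)
    {G : (Fin n → E d) × E d × ℝ → ℝ} (hG : Measurable G)
    (hint : Integrable (fun ω ↦ G ((fun l ↦ X l ω), Xs j ω, Y i ω)) μ) :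
    μ[fun ω ↦ G ((fun l ↦ X l ω), Xs j ω, Y i ω) | covSigma X] =ᵐ[μ]
      fun ω ↦ ∫ z, G ((fun l ↦ X l ω), z) ∂(Q.prod (κ (X i ω))) := by
  have measurable_pair := (hS.measurable_Xs j).prodMk (hS.measurable_Y i)
  have condDistrib_eq := condDistrib_ae_eq_of_measure_eq_compProd (fun ω l ↦ X l ω)
    measurable_pair.aemeasurable ((hS.map_cov_target_label i j).trans (by rw [hS.map_cov]))
  filter_upwards [condExp_prod_ae_eq_integral_condDistrib hS.measurable_cov
    measurable_pair.aemeasurable hG.stronglyMeasurable hint,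
    ae_of_ae_map hS.measurable_cov.aemeasurable condDistrib_eq] with ω hω hcond
  rw [hω, hcond, Kernel.prod_apply, Kernel.const_apply, Kernel.comap_apply]

lemma condExp_nnMean (hS : IsSample μ P Q κ X Y Xs) (hk : 1 ≤ k) (hkn : k ≤ n) (j : Fin m)
    (hH : Measurable fun z : (E d × E d) × ℝ ↦ H z.1.1 z.1.2 z.2)
    (hint : ∀ i, IntegrableOn (fun ω ↦ H (Xs j ω) (X i ω) (Y i ω))
      (neighborEvent k X Xs i j) μ) :
    μ[fun ω ↦ nnMean k H (fun i ↦ X i ω) (fun i ↦ Y i ω) (Xs j ω) | covSigma X] =ᵐ[μ]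
      fun ω ↦ nnBias Finset.univ k Q (labelMean κ H) (fun i ↦ X i ω) := by
  set G : Fin n → (Fin n → E d) × E d × ℝ → ℝ := fun i ↦
    {z | ‖z.1 i - z.2.1‖ ≤ knnRadius k z.1 z.2.1}.indicator fun z ↦ H z.2.1 (z.1 i) z.2.2
  have measurable_G (i : Fin n) : Measurable (G i) :=
    (hH.comp (by fun_prop : Measurable fun z : (Fin n → E d) × E d × ℝ ↦
      ((z.2.1, z.1 i), z.2.2))).indicator ((by fun_prop : Measurable
        fun z : (Fin n → E d) × E d × ℝ ↦ (z.1, z.2.1))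
          (measurableSet_norm_sub_le_knnRadius hk hkn i))
  have integrable_G (i : Fin n) :
      Integrable (fun ω ↦ G i ((fun l ↦ X l ω), Xs j ω, Y i ω)) μ :=
    (hint i).integrable_indicator (hS.measurableSet_neighborEvent hk hkn i j)
  have integral_G (i : Fin n) (X : Fin n → E d) (x : E d) : ∫ y, G i (X, x, y) ∂(κ (X i)) =
      {x | ‖X i - x‖ ≤ knnRadius k X x}.indicator (fun x ↦ labelMean κ H x (X i)) x := by
    by_cases hx : ‖X i - x‖ ≤ knnRadius k X x <;> simp [G, indicator, hx, labelMean]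
  have nnMean_eq : (fun ω ↦ nnMean k H (fun i ↦ X i ω) (fun i ↦ Y i ω) (Xs j ω)) =
      (k : ℝ)⁻¹ • ∑ i, fun ω ↦ G i ((fun l ↦ X l ω), Xs j ω, Y i ω) := by
    ext ω
    rw [nnMean_eq_sum_indicator, Pi.smul_apply, Finset.sum_apply, smul_eq_mul]
    rfl
  rw [nnMean_eq]
  filter_upwards [condExp_smul (k : ℝ)⁻¹ (∑ i, fun ω ↦ G i ((fun l ↦ X l ω), Xs j ω, Y i ω))
      (covSigma X), condExp_finsetSum (fun i _ ↦ integrable_G i) (covSigma X),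
    ae_all_iff.2 fun i ↦ hS.condExp_covSigma i j (measurable_G i) (integrable_G i),
    ae_all_iff.2 fun i ↦ hS.ae_integrable_prod i j (measurable_G i) (integrable_G i)]
    with ω hsmul hsum hcond hprod
  rw [hsmul, Pi.smul_apply, hsum, Finset.sum_apply, smul_eq_mul, nnBias_univ_eq_sum]
  · refine congrArg _ (Finset.sum_congr rfl fun i _ ↦ ?_)
    rw [hcond i, integral_prod _ (hprod i)]
    simp only [integral_G i fun l ↦ X l ω]
  · intro i
    simpa only [integral_G i fun l ↦ X l ω] using (hprod i).integral_prod_left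

end IsSample

end NeighborMean

section ConvexNeighbourhood

variable {V : Type*} [NormedAddCommGroup V] [NormedSpace ℝ V]

open scoped Pointwise in
lemma closure_convexHull_subset_of_isOpen {s U : Set V} (hs : IsCompact s) (hU : IsOpen U)
    (hUc : Convex ℝ U) (hsU : s ⊆ U) : closure (convexHull ℝ s) ⊆ U := by
  obtain ⟨δ, hδ, hδU⟩ := hs.exists_thickening_subset_open hU hsU
  calc closure (convexHull ℝ s) ⊆ Metric.thickening δ (convexHull ℝ s) :=
        Metric.closure_subset_thickening hδ _
    _ = convexHull ℝ (Metric.thickening δ s) := by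
        rw [← add_ball_zero, ← add_ball_zero, convexHull_add, (convex_ball 0 δ).convexHull_eq]
    _ ⊆ U := convexHull_min hδU hUc

lemma isCompact_closure_convexHull [CompleteSpace V] {s : Set V} (hs : IsCompact s) :
    IsCompact (closure (convexHull ℝ s)) :=
  (totallyBounded_convexHull.2 hs.totallyBounded).closure.isCompact_of_isClosed isClosed_closure

end ConvexNeighbourhood

section TaylorBounds

variable {V F : Type*} [NormedAddCommGroup V] [NormedSpace ℝ V] [NormedAddCommGroup F]
  [NormedSpace ℝ F] {K U : Set V} {f : V → F} {M : ℝ}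

lemma norm_sub_le_and_norm_sub_sub_fderiv_le (hU : IsOpen U) (hK : Convex ℝ K) (hKU : K ⊆ U)
    (hf : ContDiffOn ℝ 2 f U)
    (hM : ∀ y ∈ K, ‖fderiv ℝ f y‖ + ‖fderiv ℝ (fderiv ℝ f) y‖ ≤ M) {x u : V} (hx : x ∈ K)
    (hu : u ∈ K) :
    ‖f u - f x‖ ≤ M * ‖u - x‖ ∧ ‖f u - f x - fderiv ℝ f x (u - x)‖ ≤ M * ‖u - x‖ ^ 2 := by
  have norm_fderiv_le (y) (hy : y ∈ K) : ‖fderiv ℝ f y‖ ≤ M :=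
    (le_add_of_nonneg_right (norm_nonneg (fderiv ℝ (fderiv ℝ f) y))).trans (hM y hy)
  have norm_fderiv_fderiv_le (y) (hy : y ∈ K) : ‖fderiv ℝ (fderiv ℝ f) y‖ ≤ M :=
    (le_add_of_nonneg_left (norm_nonneg _)).trans (hM y hy)
  have hf' : ContDiffOn ℝ 1 (fderiv ℝ f) U := hf.fderiv_of_isOpen hU (by norm_num)
  have differentiableAt (y) (hy : y ∈ K) : DifferentiableAt ℝ f y :=
    (hf.differentiableOn (by norm_num)).differentiableAt (hU.mem_nhds (hKU hy))
  have differentiableAt_fderiv (y) (hy : y ∈ K) : DifferentiableAt ℝ (fderiv ℝ f) y :=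
    (hf'.differentiableOn (by norm_num)).differentiableAt (hU.mem_nhds (hKU hy))
  have segment_subset : segment ℝ x u ⊆ K := hK.segment_subset hx hu
  have norm_fderiv_sub_le (y) (hy : y ∈ segment ℝ x u) :
      ‖fderiv ℝ f y - fderiv ℝ f x‖ ≤ M * ‖u - x‖ := by
    have : 0 ≤ M := (norm_nonneg _).trans (norm_fderiv_le x hx)
    refine (hK.norm_image_sub_le_of_norm_fderiv_le differentiableAt_fderiv norm_fderiv_fderiv_le
      hx (segment_subset hy)).trans ?_
    gcongr
    exact norm_sub_le_of_mem_segment hy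
  refine ⟨hK.norm_image_sub_le_of_norm_fderiv_le differentiableAt norm_fderiv_le hx hu, ?_⟩
  rw [pow_two, ← mul_assoc]
  exact (convex_segment x u).norm_image_sub_le_of_norm_fderiv_le'
    (fun y hy ↦ differentiableAt y (segment_subset hy)) norm_fderiv_sub_le
    (left_mem_segment ℝ x u) (right_mem_segment ℝ x u)

lemma exists_norm_fderiv_add_norm_fderiv_fderiv_le (hU : IsOpen U) (hK : IsCompact K)
    (hKU : K ⊆ U) (hf : ContDiffOn ℝ 2 f U) :
    ∃ M : ℝ, ∀ y ∈ K, ‖fderiv ℝ f y‖ + ‖fderiv ℝ (fderiv ℝ f) y‖ ≤ M := by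
  have hf' : ContDiffOn ℝ 1 (fderiv ℝ f) U := hf.fderiv_of_isOpen hU (by norm_num)
  have hf'' : ContinuousOn (fderiv ℝ (fderiv ℝ f)) U :=
    hf'.continuousOn_fderiv_of_isOpen hU (by norm_num)
  have hf''_norm : ContinuousOn (fun y ↦ ‖fderiv ℝ (fderiv ℝ f) y‖) U :=
    ContinuousOn.norm (E := V →L[ℝ] V →L[ℝ] F) hf''
  obtain ⟨M, hM⟩ := hK.bddAbove_image ((hf'.continuousOn.norm.add hf''_norm).mono hKU)
  exact ⟨M, fun y hy ↦ hM ⟨y, hy, rfl⟩⟩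

end TaylorBounds

section LocalIncrement

variable {d : ℕ} {𝒳 : Set (E d)} {M : ℝ} {Ψ : E d → E d → ℝ} {κ : Kernel (E d) ℝ}
  {h : E d → ℝ → ℝ}

/-- The increment `Ψ x u - Ψ x x`, cut off to `0` unless both points lie in `𝒳`: outside of `𝒳`
nothing is known about `Ψ`, and the cut-off makes the increment bounded everywhere. -/
def localIncrement (𝒳 : Set (E d)) (Ψ : E d → E d → ℝ) (x u : E d) : ℝ :=
  (𝒳 ×ˢ 𝒳).indicator (fun z ↦ Ψ z.1 z.2 - Ψ z.1 z.1) (x, u)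

lemma localIncrement_of_mem {x u : E d} (hx : x ∈ 𝒳) (hu : u ∈ 𝒳) :
    localIncrement 𝒳 Ψ x u = Ψ x u - Ψ x x :=
  indicator_of_mem (mk_mem_prod hx hu) _

/-- Each `Ψ x`, `x ∈ 𝒳`, satisfies on `𝒳` a Lipschitz bound and a first order Taylor expansion with
quadratic remainder at `x`, with a common constant `M`. -/
def UniformTaylor (𝒳 : Set (E d)) (M : ℝ) (Ψ : E d → E d → ℝ) : Prop :=
  ∀ x ∈ 𝒳, ∃ A : E d →L[ℝ] ℝ, ‖A‖ ≤ M ∧ ∀ u ∈ 𝒳, |Ψ x u - Ψ x x| ≤ M * ‖u - x‖ ∧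
    |Ψ x u - Ψ x x - A (u - x)| ≤ M * ‖u - x‖ ^ 2

lemma UniformTaylor.isLocalIncrement (hΨ : UniformTaylor 𝒳 M Ψ) (h𝒳 : MeasurableSet 𝒳)
    (hΨm : Measurable (Function.uncurry Ψ)) : IsLocalIncrement 𝒳 M (localIncrement 𝒳 Ψ) where
  measurable := by
    have measurable_diag : Measurable fun z : E d × E d ↦ Ψ z.1 z.1 :=
      hΨm.comp (measurable_fst.prodMk measurable_fst)
    exact (hΨm.sub measurable_diag).indicator (h𝒳.prod h𝒳)
  eq_zero x u hxu := indicator_of_notMem (show (x, u) ∉ 𝒳 ×ˢ 𝒳 from hxu) _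
  abs_le x hx u hu := by
    obtain ⟨A, -, hA⟩ := hΨ x hx
    exact localIncrement_of_mem (Ψ := Ψ) hx hu ▸ (hA u hu).1
  taylor x hx := by
    obtain ⟨A, hAM, hA⟩ := hΨ x hx
    exact ⟨A, hAM, fun u hu ↦ localIncrement_of_mem (Ψ := Ψ) hx hu ▸ (hA u hu).2⟩

lemma uniformTaylor_of_contDiffOn {K U : Set (E d)} (hU : IsOpen U) (hK : Convex ℝ K)
    (hKU : K ⊆ U) (h𝒳K : 𝒳 ⊆ K) {D : E d → E d → ℝ} (hD : ∀ x ∈ 𝒳, ContDiffOn ℝ 2 (D x) U)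
    (hM : ∀ x ∈ 𝒳, ∀ y ∈ K, ‖fderiv ℝ (D x) y‖ + ‖fderiv ℝ (fderiv ℝ (D x)) y‖ ≤ M)
    (hDΨ : ∀ x ∈ 𝒳, EqOn (D x) (Ψ x) 𝒳) : UniformTaylor 𝒳 M Ψ := by
  refine fun x hx ↦ ⟨fderiv ℝ (D x) x, ?_, fun u hu ↦ ?_⟩
  · linarith [hM x hx x (h𝒳K hx), norm_nonneg (fderiv ℝ (fderiv ℝ (D x)) x)]
  rw [← hDΨ x hx hu, ← hDΨ x hx hx]
  exact norm_sub_le_and_norm_sub_sub_fderiv_le hU hK hKU (hD x hx) (hM x hx) (h𝒳K hx) (h𝒳K hu)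

lemma SmoothDelta.exists_uniformTaylor (hD : SmoothDelta 𝒳 κ h) :
    ∃ M, 0 ≤ M ∧ UniformTaylor 𝒳 M (Delta κ h) := by
  obtain ⟨U, hU, hUc, -, h𝒳U, D, hDx, M, hM⟩ := hD
  exact ⟨max M 0, le_max_right _ _, uniformTaylor_of_contDiffOn hU (convex_convexHull ℝ 𝒳)
    (convexHull_min h𝒳U hUc) (subset_convexHull ℝ 𝒳) (fun x hx ↦ (hDx x hx).1)
    (fun x hx y hy ↦ (hM x hx y hy).trans (le_max_left _ _)) fun x hx ↦ (hDx x hx).2⟩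

lemma SmoothRegr.exists_uniformTaylor (hG : SmoothRegr 𝒳 κ h) (h𝒳 : IsCompact 𝒳) :
    ∃ M, 0 ≤ M ∧ UniformTaylor 𝒳 M fun _ u ↦ regr κ h u := by
  obtain ⟨U, hU, hUc, -, h𝒳U, G, hG, hGr⟩ := hG
  have closure_subset := closure_convexHull_subset_of_isOpen h𝒳 hU hUc h𝒳U
  obtain ⟨M, hM⟩ := exists_norm_fderiv_add_norm_fderiv_fderiv_le hU
    (isCompact_closure_convexHull h𝒳) closure_subset hG
  exact ⟨max M 0, le_max_right _ _, uniformTaylor_of_contDiffOn (D := fun _ ↦ G) hU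
    (convex_convexHull ℝ 𝒳).closure closure_subset
    ((subset_convexHull ℝ 𝒳).trans subset_closure) (fun _ _ ↦ hG)
    (fun _ _ y hy ↦ (hM y hy).trans (le_max_left _ _)) fun _ _ ↦ hGr⟩

end LocalIncrement

section Target

variable {d : ℕ} {𝒳 : Set (E d)} {P Q : Measure (E d)} {κ : Kernel (E d) ℝ}
  {h : E d → ℝ → ℝ} {p q : E d → ℝ} {a b : ℝ} {c : ℝ≥0∞}

lemma IsDensity.le_smul (hq : IsDensity Q q) (hp : IsDensity P p) (h𝒳 : MeasurableSet 𝒳)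
    (hQ : Q 𝒳ᶜ = 0) (ha : 0 < a) (hpa : ∀ x ∈ 𝒳, a ≤ p x) (hqb : ∀ x ∈ 𝒳, q x ≤ b) :
    Q ≤ ENNReal.ofReal (b / a) • P := by
  calc Q ≤ ENNReal.ofReal b • volume.restrict 𝒳 := hq.le_smul_restrict h𝒳 hQ hqb
    _ = ENNReal.ofReal (b / a) • ENNReal.ofReal a • volume.restrict 𝒳 := by
        rw [smul_smul, ← ENNReal.ofReal_mul' ha.le, div_mul_cancel₀ b ha.ne']
    _ ≤ ENNReal.ofReal (b / a) • P := by
        gcongr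
        exact hp.smul_restrict_le h𝒳 hpa

lemma compProd_le_smul [SFinite P] [SFinite Q] [IsSFiniteKernel κ] (hQP : Q ≤ c • P) :
    Q ⊗ₘ κ ≤ c • (P ⊗ₘ κ) := by
  refine Measure.le_iff.2 fun s hs ↦ ?_
  rw [Measure.smul_apply, Measure.compProd_apply hs, Measure.compProd_apply hs,
    ← lintegral_smul_measure]
  exact lintegral_mono' hQP le_rfl

lemma integrable_regr [SFinite Q] [IsSFiniteKernel κ]
    (hint : Integrable (Function.uncurry h) (Q ⊗ₘ κ)) : Integrable (regr κ h) Q :=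
  Integrable.integral_compProd (κ := Kernel.const Unit Q) (η := Kernel.prodMkLeft Unit κ)
    (a := ()) hint

lemma targetMean_eq_integral_regr [SFinite Q] [IsSFiniteKernel κ]
    (hint : Integrable (Function.uncurry h) (Q ⊗ₘ κ)) : targetMean Q κ h = ∫ x, regr κ h x ∂Q :=
  Measure.integral_compProd hint

lemma integrable_compProd_target [SFinite P] [SFinite Q] [IsSFiniteKernel κ]
    (hint : Integrable (Function.uncurry h) (P ⊗ₘ κ)) (hq : IsDensity Q q) (hp : IsDensity P p)
    (h𝒳 : MeasurableSet 𝒳) (hQ : Q 𝒳ᶜ = 0)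
    (hpinf : ∃ pinf : ℝ, 0 < pinf ∧ ∀ x ∈ 𝒳, pinf ≤ p x)
    (hqsup : ∃ qsup : ℝ, 0 < qsup ∧ ∀ x ∈ 𝒳, q x ≤ qsup) :
    Integrable (Function.uncurry h) (Q ⊗ₘ κ) := by
  obtain ⟨a, ha, hpa⟩ := hpinf
  obtain ⟨b, -, hqb⟩ := hqsup
  exact (hint.smul_measure ENNReal.ofReal_ne_top).mono_measure
    (compProd_le_smul (hq.le_smul hp h𝒳 hQ ha hpa hqb))

end Target

section Decomposition

variable {ι : Type*} [Fintype ι] {d k : ℕ} {𝒳 : Set (E d)} {Q : Measure (E d)}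
  {L : E d → E d → ℝ} {X : ι → E d}

lemma nnSum_univ_eq_add (hk : 1 ≤ k) (hkι : k ≤ Fintype.card ι) (hX : ∀ i, X i ∈ 𝒳) {x : E d}
    (hx : x ∈ 𝒳) (hinj : Function.Injective fun i ↦ ‖X i - x‖) :
    nnSum Finset.univ k L X x = nnSum Finset.univ k (localIncrement 𝒳 L) X x + k * L x x := by
  have sum_const : ∑ i with ‖X i - x‖ ≤ ordStat Finset.univ k (fun j ↦ ‖X j - x‖), L x x =
      k * L x x := by
    rw [Finset.sum_const, card_filter_le_ordStat hk hkι hinj.injOn, nsmul_eq_mul]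
  rw [nnSum, nnSum, ← sum_const, ← Finset.sum_add_distrib]
  exact Finset.sum_congr rfl fun i _ ↦ by rw [localIncrement_of_mem hx (hX i), sub_add_cancel]

lemma nnBias_univ_eq_add (hk : 1 ≤ k) (hkι : k ≤ Fintype.card ι) (hQ : Q 𝒳ᶜ = 0)
    (hX : ∀ i, X i ∈ 𝒳) (hinj : ∀ᵐ x ∂Q, Function.Injective fun i ↦ ‖X i - x‖)
    (hint : Integrable (nnSum Finset.univ k (localIncrement 𝒳 L) X) Q)
    (hdiag : Integrable (fun x ↦ L x x) Q) :
    nnBias Finset.univ k Q L X =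
      nnBias Finset.univ k Q (localIncrement 𝒳 L) X + ∫ x, L x x ∂Q := by
  rw [nnBias, nnBias, ← integral_add (hint.const_mul _) hdiag]
  refine integral_congr_ae ?_
  filter_upwards [hinj, show ∀ᵐ x ∂Q, x ∈ 𝒳 from hQ] with x hx hx𝒳
  rw [nnSum_univ_eq_add hk hkι hX hx𝒳 hx]
  field_simp

lemma ae_pi_nnBias_eq_add {P : Measure (E d)} [IsProbabilityMeasure P] [IsFiniteMeasure Q]
    (hk : 1 ≤ k) (hkι : k ≤ Fintype.card ι) (hP : P 𝒳ᶜ = 0)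
    (hPsphere : ∀ x r, P (Metric.sphere x r) = 0) (hQ : Q 𝒳ᶜ = 0)
    (hLm : Measurable (Function.uncurry (localIncrement 𝒳 L))) {D : ℝ}
    (hLD : ∀ x u, |localIncrement 𝒳 L x u| ≤ D) (hdiag : Integrable (fun x ↦ L x x) Q) :
    ∀ᵐ X ∂(Measure.pi fun _ : ι ↦ P), nnBias Finset.univ k Q L X =
      nnBias Finset.univ k Q (localIncrement 𝒳 L) X + ∫ x, L x x ∂Q := by
  filter_upwards [ae_pi_forall_mem hP, ae_pi_ae_injective_norm_sub hPsphere Q] with X hX hinj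
  refine nnBias_univ_eq_add hk hkι hQ hX hinj ?_ hdiag
  have measurable_right : Measurable (nnSum Finset.univ k (localIncrement 𝒳 L) X) :=
    (measurable_nnSum hk hkι hLm).of_uncurry_left
  exact .of_bound measurable_right.aestronglyMeasurable _ (.of_forall (abs_nnSum_le hLD X))

end Decomposition

section ConditionalBias

variable {d n m k : ℕ} {𝒳 : Set (E d)} {P Q : Measure (E d)} [IsProbabilityMeasure P]
  [IsProbabilityMeasure Q] {M : ℝ} {L : E d → E d → ℝ}

lemma condExp_average_ae_eq {Ω : Type*} {m₀ mΩ : MeasurableSpace Ω} {μ : Measure Ω} (hm : 1 ≤ m)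
    {f : Fin m → Ω → ℝ} {φ : Ω → ℝ} (hf : ∀ j, Integrable (f j) μ)
    (hφ : ∀ j, μ[f j | m₀] =ᵐ[μ] φ) : μ[fun ω ↦ 1 / (m : ℝ) * ∑ j, f j ω | m₀] =ᵐ[μ] φ := by
  have average_eq : (fun ω ↦ 1 / (m : ℝ) * ∑ j, f j ω) = (1 / (m : ℝ)) • ∑ j, f j := by
    ext ω
    simp
  rw [average_eq]
  filter_upwards [condExp_smul (1 / (m : ℝ)) (∑ j, f j) m₀,
    condExp_finsetSum (fun j (_ : j ∈ Finset.univ) ↦ hf j) m₀, ae_all_iff.2 hφ]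
    with ω hsmul hsum hφω
  rw [hsmul, Pi.smul_apply, hsum, Finset.sum_apply, Finset.sum_congr rfl fun j _ ↦ hφω j]
  simp [field]

theorem UniformTaylor.exists_integral_sq_condBias_le (hL : UniformTaylor 𝒳 M L) (hM : 0 ≤ M)
    (hLm : Measurable (Function.uncurry L)) (hdiag : Integrable (fun x ↦ L x x) Q) (hd : 1 ≤ d)
    (hP : P 𝒳ᶜ = 0) (hQ : Q 𝒳ᶜ = 0) (hX1 : IsCompact 𝒳) (hX2 : BallVolume 𝒳)
    {p q : E d → ℝ} (hp : IsDensity P p) (hq : IsDensity Q q)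
    (hpinf : ∃ pinf : ℝ, 0 < pinf ∧ ∀ x ∈ 𝒳, pinf ≤ p x)
    (hqsup : ∃ qsup : ℝ, 0 < qsup ∧ ∀ x ∈ 𝒳, q x ≤ qsup)
    (hX5 : ∃ K, LipschitzOnWith K p 𝒳) (hA : GeomCondition 𝒳 Q) :
    ∃ C : ℝ, ∀ (Ω : Type u) [MeasurableSpace Ω] (μ : Measure Ω) (n m k : ℕ)
      (X : Fin n → Ω → E d) (f : Fin m → Ω → ℝ), 1 ≤ k → k ≤ n → 1 ≤ m →
      Measurable (fun ω i ↦ X i ω) → μ.map (fun ω i ↦ X i ω) = Measure.pi (fun _ ↦ P) →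
      (∀ j, Integrable (f j) μ) →
      (∀ j, μ[f j | covSigma X] =ᵐ[μ] fun ω ↦ nnBias Finset.univ k Q L fun i ↦ X i ω) →
      Integrable (fun ω ↦
        condBias μ X (fun ω ↦ 1 / (m : ℝ) * ∑ j, f j ω) (∫ x, L x x ∂Q) ω ^ 2) μ ∧
      ∫ ω, condBias μ X (fun ω ↦ 1 / (m : ℝ) * ∑ j, f j ω) (∫ x, L x x ∂Q) ω ^ 2 ∂μ ≤
        C * ((k : ℝ) / ((n : ℝ) + 1)) ^ (min (4 / (d : ℝ)) 3) := by
  have hΦ := hL.isLocalIncrement hX1.measurableSet hLm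
  have hΦD := hΦ.abs_le_diam hM hX1.isBounded
  obtain ⟨C, hC⟩ :=
    hΦ.exists_integral_sq_nnBias_le hM hd hP hQ hX1 hX2 hp hq hpinf hqsup hX5 hA
  refine ⟨C, fun Ω _ μ n m k X f hk hkn hm hX hXP hf hfL ↦ ?_⟩
  have hkn' : k ≤ (Finset.univ : Finset (Fin n)).card := by simpa using hkn
  have sq_condBias_eq : (fun ω ↦ nnBias Finset.univ k Q (localIncrement 𝒳 L) (fun i ↦ X i ω) ^ 2)
      =ᵐ[μ] fun ω ↦
        condBias μ X (fun ω ↦ 1 / (m : ℝ) * ∑ j, f j ω) (∫ x, L x x ∂Q) ω ^ 2 := by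
    filter_upwards [condExp_average_ae_eq hm hf hfL, ae_of_ae_map hX.aemeasurable (hXP ▸
      ae_pi_nnBias_eq_add hk hkn' hP (hp.measure_sphere_eq_zero hd) hQ hΦ.measurable hΦD hdiag)]
      with ω hcond hadd
    rw [condBias, hcond, hadd, add_sub_cancel_right]
  have memLp := memLp_nnBias (ν := Measure.pi fun _ : Fin n ↦ P) hk hkn' hΦ.measurable hΦD Q 2
  rw [← integrable_congr sq_condBias_eq, ← integral_congr_ae sq_condBias_eq]
  constructor
  · exact (hXP ▸ memLp.integrable_sq).comp_measurable hX
  · rw [← integral_map hX.aemeasurable (f := fun X ↦ nnBias _ k Q _ X ^ 2)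
      (hXP ▸ memLp.integrable_sq.aestronglyMeasurable), hXP]
    exact hC n k hk hkn

end ConditionalBias

section Estimators

variable {d n m k : ℕ} {κ : Kernel (E d) ℝ} {h : E d → ℝ → ℝ}

lemma measurable_Delta [IsSFiniteKernel κ] (hh : Measurable (Function.uncurry h)) :
    Measurable (Function.uncurry (Delta κ h)) :=
  measurable_labelMean (H := fun x _ y ↦ h x y)
    (hh.comp (by fun_prop : Measurable fun z : (E d × E d) × ℝ ↦ (z.1.1, z.2)))

lemma measurable_regr [IsSFiniteKernel κ] (hh : Measurable (Function.uncurry h)) :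
    Measurable (regr κ h) :=
  (measurable_Delta hh).comp (measurable_id.prodMk measurable_id)

lemma est2_eq_average_nnMean (hn : n ≠ 0) (X : Fin n → E d) (Y : Fin n → ℝ) (Xs : Fin m → E d) :
    est2 k h X Y Xs = 1 / (m : ℝ) * ∑ j, nnMean k (fun _ u y ↦ h u y) X Y (Xs j) := by
  have matchCount_eq (i : Fin n) : (matchCount k X Xs (X i) : ℝ) =
      ∑ j, if ‖X i - Xs j‖ ≤ knnRadius k X (Xs j) then 1 else 0 := by
    rw [matchCount, Finset.sum_boole]
  simp only [est2, nnMean, Finset.sum_filter]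
  rw [← Finset.mul_sum, Finset.sum_comm, Finset.mul_sum, Finset.mul_sum, Finset.mul_sum]
  refine Finset.sum_congr rfl fun i _ ↦ ?_
  simp only [← boole_mul _ (h _ _), ← Finset.sum_mul, ← matchCount_eq]
  field_simp

variable {Ω : Type*} [MeasurableSpace Ω] {μ : Measure Ω} {P Q : Measure (E d)}
  {X : Fin n → Ω → E d} {Y : Fin n → Ω → ℝ} {Xs : Fin m → Ω → E d}

namespace IsSample

lemma integrable_source (hS : IsSample μ P Q κ X Y Xs)
    (hint : Integrable (Function.uncurry h) (P ⊗ₘ κ)) (i : Fin n) :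
    Integrable (fun ω ↦ h (X i ω) (Y i ω)) μ := by
  rw [← hS.law_XY i] at hint
  exact hint.comp_measurable ((hS.measurable_X i).prodMk (hS.measurable_Y i))

lemma integrable_nnMean (hS : IsSample μ P Q κ X Y Xs) (hk : 1 ≤ k) (hkn : k ≤ n) (j : Fin m)
    {H : E d → E d → ℝ → ℝ}
    (hint : ∀ i, IntegrableOn (fun ω ↦ H (Xs j ω) (X i ω) (Y i ω))
      (neighborEvent k X Xs i j) μ) :
    Integrable (fun ω ↦ nnMean k H (fun i ↦ X i ω) (fun i ↦ Y i ω) (Xs j ω)) μ := by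
  simp only [nnMean_eq_sum_indicator]
  exact (integrable_finsetSum _ fun i _ ↦ (hint i).integrable_indicator
    (hS.measurableSet_neighborEvent hk hkn i j)).const_mul _

end IsSample

lemma IsLabels.condExp_covSigma [IsProbabilityMeasure μ] [IsProbabilityMeasure P]
    [IsProbabilityMeasure Q] [IsMarkovKernel κ] {Yhat : Fin m → Ω → ℝ}
    (hL : IsLabels μ k X Y Xs Yhat) (hS : IsSample μ P Q κ X Y Xs)
    (hk : 1 ≤ k) (hkn : k ≤ n) (hh : Measurable (Function.uncurry h)) (j : Fin m)
    (hint : Integrable (fun ω ↦ h (Xs j ω) (Yhat j ω)) μ) :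
    μ[fun ω ↦ h (Xs j ω) (Yhat j ω) | covSigma X] =ᵐ[μ]
      fun ω ↦ nnBias Finset.univ k Q (Delta κ h) fun i ↦ X i ω := by
  have measurable_label : Measurable
      fun z : ((Fin n → E d × ℝ) × (Fin m → E d)) × ℝ ↦ h (z.1.2 j) z.2 :=
    hh.comp (by fun_prop : Measurable
      fun z : ((Fin n → E d × ℝ) × (Fin m → E d)) × ℝ ↦ (z.1.2 j, z.2))
  have covSigma_le : covSigma X ≤ dataSigma X Y Xs := by
    rintro _ ⟨S, hS, rfl⟩
    exact ⟨_, (by fun_prop : Measurable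
      fun (z : (Fin n → E d × ℝ) × (Fin m → E d)) i ↦ (z.1 i).1) hS, rfl⟩
  have condExp_data : μ[fun ω ↦ h (Xs j ω) (Yhat j ω) | dataSigma X Y Xs] =ᵐ[μ]
      fun ω ↦ nnMean k (fun x _ y ↦ h x y) (fun i ↦ X i ω) (fun i ↦ Y i ω) (Xs j ω) := by
    simp only [nnMean_eq_sum_indicator]
    exact hL.condExp_dataSigma hS hk hkn j measurable_label hint
  calc μ[fun ω ↦ h (Xs j ω) (Yhat j ω) | covSigma X]
      =ᵐ[μ] μ[μ[fun ω ↦ h (Xs j ω) (Yhat j ω) | dataSigma X Y Xs] | covSigma X] :=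
        (condExp_condExp_of_le covSigma_le hS.dataSigma_le).symm
    _ =ᵐ[μ] _ := condExp_congr_ae condExp_data
    _ =ᵐ[μ] _ := hS.condExp_nnMean hk hkn j
        (hh.comp (by fun_prop : Measurable fun z : (E d × E d) × ℝ ↦ (z.1.1, z.2)))
        fun i ↦ hL.integrableOn_neighborEvent hS hk hkn j measurable_label hint i

end Estimators

end Matching

end

theorem mainTheorem1_general (d : ℕ) (hd : 1 ≤ d)
    (𝒳 : Set (Matching.E d))
    (P Q : Measure (Matching.E d)) [IsProbabilityMeasure P] [IsProbabilityMeasure Q]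
    (hP𝒳 : P 𝒳ᶜ = 0) (hQ𝒳 : Q 𝒳ᶜ = 0)
    (κ : Kernel (Matching.E d) ℝ) [IsMarkovKernel κ]
    (h : Matching.E d → ℝ → ℝ) (hh : Measurable (Function.uncurry h))
    (hint : Integrable (Function.uncurry h) (P ⊗ₘ κ))
    (hX1 : IsCompact 𝒳)
    (hX2 : Matching.BallVolume 𝒳)
    (p q : Matching.E d → ℝ)
    (hp : Matching.IsDensity P p) (hq : Matching.IsDensity Q q)
    (hpinf : ∃ pinf : ℝ, 0 < pinf ∧ ∀ x ∈ 𝒳, pinf ≤ p x)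
    (hqsup : ∃ qsup : ℝ, 0 < qsup ∧ ∀ x ∈ 𝒳, q x ≤ qsup)
    (hX5 : ∃ K, LipschitzOnWith K p 𝒳)
    (hA : Matching.GeomCondition 𝒳 Q) :
    (Matching.SmoothDelta 𝒳 κ h →
      ∃ C : ℝ, ∀ (Ω : Type u) [MeasurableSpace Ω] (μ : Measure Ω) [IsProbabilityMeasure μ]
        (n m k : ℕ) (X : Fin n → Ω → Matching.E d) (Y : Fin n → Ω → ℝ)
        (Xs : Fin m → Ω → Matching.E d) (Yhat : Fin m → Ω → ℝ),
        1 ≤ k → k ≤ n → 1 ≤ m →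
        Matching.IsSample μ P Q κ X Y Xs →
        Matching.IsLabels μ k X Y Xs Yhat →
        (∀ j, Integrable (fun ω ↦ h (Xs j ω) (Yhat j ω)) μ) →
        Integrable (fun ω ↦ Matching.B1 Q κ h μ X Xs Yhat ω ^ 2) μ ∧
          ∫ ω, Matching.B1 Q κ h μ X Xs Yhat ω ^ 2 ∂μ ≤
            C * ((k : ℝ) / ((n : ℝ) + 1)) ^ (min (4 / (d : ℝ)) 3)) ∧
    (Matching.SmoothRegr 𝒳 κ h →
      ∃ C : ℝ, ∀ (Ω : Type u) [MeasurableSpace Ω] (μ : Measure Ω) [IsProbabilityMeasure μ]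
        (n m k : ℕ) (X : Fin n → Ω → Matching.E d) (Y : Fin n → Ω → ℝ)
        (Xs : Fin m → Ω → Matching.E d),
        1 ≤ k → k ≤ n → 1 ≤ m →
        Matching.IsSample μ P Q κ X Y Xs →
        Integrable (fun ω ↦ Matching.B2 Q κ h μ k X Y Xs ω ^ 2) μ ∧
          ∫ ω, Matching.B2 Q κ h μ k X Y Xs ω ^ 2 ∂μ ≤
            C * ((k : ℝ) / ((n : ℝ) + 1)) ^ (min (4 / (d : ℝ)) 3)) := by
  have hint_target : Integrable (Function.uncurry h) (Q ⊗ₘ κ) :=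
    Matching.integrable_compProd_target hint hq hp hX1.measurableSet hQ𝒳 hpinf hqsup
  have hregr := Matching.integrable_regr hint_target
  refine ⟨fun hD ↦ ?_, fun hG ↦ ?_⟩
  · obtain ⟨M, hM, hTaylor⟩ := hD.exists_uniformTaylor
    obtain ⟨C, hC⟩ := hTaylor.exists_integral_sq_condBias_le hM (Matching.measurable_Delta hh)
      hregr hd hP𝒳 hQ𝒳 hX1 hX2 hp hq hpinf hqsup hX5 hA
    refine ⟨C, fun Ω _ μ _ n m k X Y Xs Yhat hk hkn hm hS hL hYhat ↦ ?_⟩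
    rw [Matching.B1, Matching.targetMean_eq_integral_regr hint_target]
    exact hC Ω μ n m k X _ hk hkn hm hS.measurable_cov hS.map_cov hYhat fun j ↦
      hL.condExp_covSigma hS hk hkn hh j (hYhat j)
  · obtain ⟨M, hM, hTaylor⟩ := hG.exists_uniformTaylor hX1
    obtain ⟨C, hC⟩ := hTaylor.exists_integral_sq_condBias_le hM
      ((Matching.measurable_regr hh).comp measurable_snd)
      hregr hd hP𝒳 hQ𝒳 hX1 hX2 hp hq hpinf hqsup hX5 hA
    refine ⟨C, fun Ω _ μ _ n m k X Y Xs hk hkn hm hS ↦ ?_⟩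
    have hsource (j : Fin m) (i : Fin n) := (hS.integrable_source hint i).integrableOn
      (s := Matching.neighborEvent k X Xs i j)
    simp only [Matching.B2, Matching.targetMean_eq_integral_regr hint_target,
      Matching.est2_eq_average_nnMean (by lia : n ≠ 0)]
    exact hC Ω μ n m k X _ hk hkn hm hS.measurable_cov hS.map_cov
      (fun j ↦ hS.integrable_nnMean hk hkn j (hsource j)) fun j ↦ hS.condExp_nnMean hk hkn j
        (hh.comp ((measurable_snd.comp measurable_fst).prodMk measurable_snd)) (hsource j)

theorem mainTheorem1 (d : ℕ) (hd : 1 ≤ d)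
    (𝒳 : Set (Matching.E d))
    (P Q : Measure (Matching.E d)) [IsProbabilityMeasure P] [IsProbabilityMeasure Q]
    (hP𝒳 : P 𝒳ᶜ = 0) (hQ𝒳 : Q 𝒳ᶜ = 0)
    (κ : Kernel (Matching.E d) ℝ) [IsMarkovKernel κ]
    (h : Matching.E d → ℝ → ℝ) (hh : Measurable (Function.uncurry h))
    (hint : Integrable (Function.uncurry h) (P ⊗ₘ κ))
    (hX1 : IsCompact 𝒳)
    (hX2 : Matching.BallVolume 𝒳)
    (p q : Matching.E d → ℝ)
    (hp : Matching.IsDensity P p) (hq : Matching.IsDensity Q q)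
    (hpinf : ∃ pinf : ℝ, 0 < pinf ∧ ∀ x ∈ 𝒳, pinf ≤ p x)
    (hqsup : ∃ qsup : ℝ, 0 < qsup ∧ ∀ x ∈ 𝒳, q x ≤ qsup)
    (hX4 : ∃ K, LipschitzOnWith K (Matching.regr κ h) 𝒳)
    (hX5 : ∃ K, LipschitzOnWith K p 𝒳)
    (hA : Matching.GeomCondition 𝒳 Q) :
    (Matching.SmoothDelta 𝒳 κ h →
      ∃ C : ℝ, ∀ (Ω : Type u) [MeasurableSpace Ω] (μ : Measure Ω) [IsProbabilityMeasure μ]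
        (n m k : ℕ) (X : Fin n → Ω → Matching.E d) (Y : Fin n → Ω → ℝ)
        (Xs : Fin m → Ω → Matching.E d) (Yhat : Fin m → Ω → ℝ),
        1 ≤ k → k ≤ n → 1 ≤ m →
        Matching.IsSample μ P Q κ X Y Xs →
        Matching.IsLabels μ k X Y Xs Yhat →
        (∀ j, Integrable (fun ω => h (Xs j ω) (Yhat j ω)) μ) →
        Integrable (fun ω => (Matching.B1 Q κ h μ X Xs Yhat ω) ^ 2) μ ∧
          ∫ ω, (Matching.B1 Q κ h μ X Xs Yhat ω) ^ 2 ∂μ ≤ C * ((k : ℝ) / ((n : ℝ) + 1)) ^ (min (4 / (d : ℝ)) 3)) ∧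
    (Matching.SmoothRegr 𝒳 κ h →
      ∃ C : ℝ, ∀ (Ω : Type u) [MeasurableSpace Ω] (μ : Measure Ω) [IsProbabilityMeasure μ]
        (n m k : ℕ) (X : Fin n → Ω → Matching.E d) (Y : Fin n → Ω → ℝ)
        (Xs : Fin m → Ω → Matching.E d),
        1 ≤ k → k ≤ n → 1 ≤ m →
        Matching.IsSample μ P Q κ X Y Xs →
        Integrable (fun ω => (Matching.B2 Q κ h μ k X Y Xs ω) ^ 2) μ ∧
          ∫ ω, (Matching.B2 Q κ h μ k X Y Xs ω) ^ 2 ∂μ ≤ C * ((k : ℝ) / ((n : ℝ) + 1)) ^ (min (4 / (d : ℝ)) 3)) :=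
  mainTheorem1_general d hd 𝒳 P Q hP𝒳 hQ𝒳 κ h hh hint hX1 hX2 p q hp hq hpinf hqsup hX5 hA
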